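/- **Setting.** Let $d\ge 1$, let $P$ be a probability measure on $\mathbb R^d$ with $\mathbb E\|X\|^4<\infty$ for $X\sim P$, and let $X_1,\dots,X_n$ be an i.i.d. sample of law $P$. Put $G=\mathbb E(XX^\top)$, with eigenvalues $\lambda_1\ge\dots\ge\lambda_d$, $s_4^2=\mathbb E(\|X\|^4)^{1/2}$ and $$\kappa=\sup_{\theta:\ \mathbb E\langle\theta,X\rangle^2>0}\frac{\mathbb E\langle\theta,X\rangle^4}{(\mathbb E\langle\theta,X\rangle^2)^2}.$$ Let $a>0$, $\epsilon>0$, $\delta>0$, let $0<\sigma\le s_4^2$ be a threshold and let $\Theta$ be a finite $\delta$-net of the unit sphere of $\mathbb R^d$ (a finite subset of the sphere such that each point of the sphere is at distance at most $\delta$ from it). $\|\cdot\|_\infty$ is the operator norm on Euclidean space and $\|\cdot\|_F$ the Frobenius norm. Put $$c=\tfrac{15}{8\log(2)(\sqrt2-1)}\exp\Bigl(\tfrac{1+2\sqrt2}{2}\Bigr),\qquad K=1+\Bigl\lceil a^{-1}\log\Bigl(\frac{n}{72(2+c)\kappa^{1/2}}\Bigr)\Bigr\rceil,$$ $$\zeta(t)=\sqrt{2(\kappa-1)\Bigl(\frac{(2+3c)s_4^2}{4(2+c)\kappa^{1/2}t}+\log(K/\epsilon)\Bigr)}\cosh(a/4)+\sqrt{\frac{2(2+c)\kappa^{1/2}s_4^2}{t}}\cosh(a/2),$$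 $$B_*(t)=\begin{cases}\dfrac{n^{-1/2}\zeta(\max\{t,\sigma\})}{1-4n^{-1/2}\zeta(\max\{t,\sigma\})}&\text{if }[6+(\kappa-1)^{-1}]\,\zeta(\max\{t,\sigma\})\le\sqrt n,\\ +\infty&\text{otherwise,}\end{cases}$$ $$B(t)=2\max\{t,\sigma\}B_*(\min\{t,s_4^2\})+7\delta\|G\|_F+\sigma .$$ **The estimator.** Let $\psi$ be the odd function with $\psi(t)=-\log(1-t+t^2/2)$ for $0\le t\le1$ and $\psi(t)=\log 2$ for $t\ge1$. For $l>0$ and $\theta\in\mathbb R^d$ let $r_l(\theta)=\frac1n\sum_{i=1}^n\psi(\langle\theta,X_i\rangle^2-l)$, $\hat\alpha_l(\theta)=\sup\{\alpha\ge0: r_l(\alpha\theta)\le0\}$ and $\tilde N_l(\theta)=l/\hat\alpha_l(\theta)^2$ (equal to $0$ if $\hat\alpha_l(\theta)=+\infty$). For $0\le j<K$ put $$l_j=\sqrt{\tfrac{2}{n(\kappa-1)}\Bigl(\tfrac{(2+3c)e^{ja}}{4(2+c)\kappa^{1/2}}+\log(K/\epsilon)\Bigr)},\qquad \beta_j=s_4^2\sqrt{2(2+c)\kappa^{1/2}\,n\,e^{-(j-1/2)a}},$$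 $$\mu_j=(\kappa-1)l_j+\tfrac{(2+c)\kappa^{1/2}s_4^2}{\beta_j},\qquad \gamma_j=\tfrac{(\kappa-1)l_j}{2}+\tfrac{(2+c)\kappa^{1/2}s_4^2}{\beta_j}+\tfrac{(2+3c)s_4^4}{2\beta_j^2l_j}+\tfrac{\log(K/\epsilon)}{n\,l_j},\qquad \rho_j(t)=\tfrac{\beta_j}{2nt}.$$ Say that $q\in\mathbb R$ is $j$-admissible at $\theta$ if, with $S=\max\{\tilde N_{l_j}(\theta),\sigma\}$, either $6(\gamma_j+\rho_j(S))>1$, or $$\bigl|\max\{q,\sigma\}-S\bigr|\le S\,\frac{\gamma_j+\rho_j(S)}{1-\mu_j-\gamma_j-2\rho_j(S)} .$$ Let $Q$ be the matrix of least Frobenius norm among the symmetric $d\times d$ matrices such that, for every $\theta\in\Theta$, $\theta^\top Q\theta\ge0$ and $\theta^\top Q\theta$ is $j$-admissible at $\theta$ for all $0\le j<K$ (put $Q=0$ if there is no such matrix). The robust estimator of $G$ is the positive part $\widehat G=Q_+$ of $Q$. For a symmetric matrix $M=U\,\mathrm{diag}(m_1,\dots,m_d)\,U^\top$ with $U$ orthogonal,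 and $f:\mathbb R\to\mathbb R$, put $f(M)=U\,\mathrm{diag}(f(m_1),\dots,f(m_d))\,U^\top$. **Proposition (Operator norm).** Assume that $8\zeta(\sigma)\le\sqrt n$ and $\kappa\ge 3/2$. With probability at least $1-2\epsilon$, the following holds simultaneously for all $L>0$ and all $1/L$-Lipschitz functions $f:\mathbb R\to\mathbb R$: $$\|f(G)-f(\widehat G)\|_\infty\le\min_{r\in\{1,\dots,d\}}L^{-1}\Bigl(B(\lambda_1)+\sqrt{4rB(\lambda_1)^2+2\textstyle\sum_{i=r+1}^d\lambda_i^2}\Bigr).$$ -/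

import Mathlib

open MeasureTheory ProbabilityTheory
open scoped NNReal ENNReal

noncomputable section

namespace RobustPCA

/-! ### Moments of a law `P` on `ℝ^d` -/

/-- The quadratic form `N(θ) = E ⟨θ, X⟩²`, for `X` of law `P`. -/
def secondMoment {d : ℕ} (P : Measure (EuclideanSpace ℝ (Fin d)))
    (θ : EuclideanSpace ℝ (Fin d)) : ℝ :=
  ∫ x, (inner ℝ θ x) ^ 2 ∂P

/-- `E ⟨θ, X⟩⁴`. -/
def fourthMoment {d : ℕ} (P : Measure (EuclideanSpace ℝ (Fin d)))
    (θ : EuclideanSpace ℝ (Fin d)) : ℝ :=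
  ∫ x, (inner ℝ θ x) ^ 4 ∂P

/-- `κ = sup { E ⟨θ, X⟩⁴ / (E ⟨θ, X⟩²)² : E ⟨θ, X⟩² > 0 }` (finite as soon as `E ‖X‖⁴ < ∞`). -/
def kurtosis {d : ℕ} (P : Measure (EuclideanSpace ℝ (Fin d))) : ℝ :=
  sSup {k : ℝ | ∃ θ : EuclideanSpace ℝ (Fin d), 0 < secondMoment P θ ∧
    k = fourthMoment P θ / secondMoment P θ ^ 2}

/-- `s₄² = (E ‖X‖⁴)^{1/2}`. -/
def s4sq {d : ℕ} (P : Measure (EuclideanSpace ℝ (Fin d))) : ℝ :=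
  Real.sqrt (∫ x, ‖x‖ ^ 4 ∂P)

/-- The Gram matrix `G = E (X Xᵀ)`. -/
def gram {d : ℕ} (P : Measure (EuclideanSpace ℝ (Fin d))) : Matrix (Fin d) (Fin d) ℝ :=
  Matrix.of fun j k => ∫ x, x j * x k ∂P

theorem gram_isHermitian {d : ℕ} (P : Measure (EuclideanSpace ℝ (Fin d))) :
    (gram P).IsHermitian := by
  ext j k
  simp [gram, mul_comm]

/-- The eigenvalues of `G` with multiplicity, in non-increasing order;
the index starts from `0`, so that `λ₁` is `gramEigenvalue P 0`. -/
def gramEigenvalue {d : ℕ} (P : Measure (EuclideanSpace ℝ (Fin d))) (i : Fin d) : ℝ :=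
  (gram_isHermitian P).eigenvalues₀ (Fin.cast (Fintype.card_fin d).symm i)

/-! ### Matrices -/

/-- `‖M‖_F = Tr(Mᵀ M)^{1/2}`. -/
def frobNorm {d : ℕ} (M : Matrix (Fin d) (Fin d) ℝ) : ℝ :=
  Real.sqrt (M.transpose * M).trace

/-- `‖M‖_∞`, the operator norm of `M` acting on Euclidean space. -/
def opNorm {d : ℕ} (M : Matrix (Fin d) (Fin d) ℝ) : ℝ :=
  ‖Matrix.toEuclideanCLM (n := Fin d) (𝕜 := ℝ) M‖

/-- `θᵀ M θ`. -/
def quadForm {d : ℕ} (M : Matrix (Fin d) (Fin d) ℝ) (θ : EuclideanSpace ℝ (Fin d)) : ℝ :=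
  ∑ j, ∑ k, θ j * M j k * θ k

/-- For a symmetric `M = U diag(μ₁, …, μ_d) Uᵀ`, the matrix `U diag(f(μ₁), …, f(μ_d)) Uᵀ`. -/
def spectralMap {d : ℕ} (f : ℝ → ℝ) (M : Matrix (Fin d) (Fin d) ℝ) : Matrix (Fin d) (Fin d) ℝ :=
  cfc f M

/-- `M₊`: every eigenvalue of the symmetric matrix `M` is replaced by its positive part. -/
def posPart {d : ℕ} (M : Matrix (Fin d) (Fin d) ℝ) : Matrix (Fin d) (Fin d) ℝ :=
  spectralMap (fun t => max t 0) M

/-! ### The deviation functions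

Below `n` is the sample size, `κ` and `s` stand for `kurtosis P` and `s4sq P`, `a > 0` is the
step of the grid, `ε` the confidence parameter and `σ` the threshold. -/

/-- `c = 15 / (8 log(2) (√2 - 1)) · exp((1 + 2√2) / 2)`. -/
def cConst : ℝ :=
  15 / (8 * Real.log 2 * (Real.sqrt 2 - 1)) * Real.exp ((1 + 2 * Real.sqrt 2) / 2)

/-- `K = 1 + ⌈a⁻¹ log(n / (72 (2 + c) κ^{1/2}))⌉`. -/
def gridSize (n : ℕ) (κ a : ℝ) : ℕ :=
  1 + ⌈a⁻¹ * Real.log (n / (72 * (2 + cConst) * Real.sqrt κ))⌉₊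

/-- The function `ζ`. -/
def zeta (n : ℕ) (κ s a ε : ℝ) (t : ℝ) : ℝ :=
  Real.sqrt (2 * (κ - 1) * ((2 + 3 * cConst) * s / (4 * (2 + cConst) * Real.sqrt κ * t)
      + Real.log (gridSize n κ a / ε))) * Real.cosh (a / 4)
    + Real.sqrt (2 * (2 + cConst) * Real.sqrt κ * s / t) * Real.cosh (a / 2)

open Classical in
/-- The function `B_*`, which may take the value `+∞`. -/
def Bstar (n : ℕ) (κ s a ε σ : ℝ) (t : ℝ) : ℝ≥0∞ :=
  if (6 + (κ - 1)⁻¹) * zeta n κ s a ε (max t σ) ≤ Real.sqrt n then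
    ENNReal.ofReal ((Real.sqrt n)⁻¹ * zeta n κ s a ε (max t σ) /
      (1 - 4 * (Real.sqrt n)⁻¹ * zeta n κ s a ε (max t σ)))
  else ⊤

/-- `B(t) = 2 max{t, σ} B_*(min{t, s₄²}) + 7 δ ‖G‖_F + σ`. -/
def Bdev {d : ℕ} (P : Measure (EuclideanSpace ℝ (Fin d))) (n : ℕ) (a ε σ δ : ℝ) (t : ℝ) : ℝ≥0∞ :=
  ENNReal.ofReal (2 * max t σ) * Bstar n (kurtosis P) (s4sq P) a ε σ (min t (s4sq P))
    + ENNReal.ofReal (7 * δ * frobNorm (gram P) + σ)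

/-! ### The robust estimator -/

/-- The influence function `ψ`: odd, equal to `-log(1 - t + t²/2)` on `[0, 1]` and to `log 2` on
`[1, ∞)`. -/
def psi (t : ℝ) : ℝ :=
  if 1 ≤ t then Real.log 2
  else if 0 ≤ t then -Real.log (1 - t + t ^ 2 / 2)
  else if -1 ≤ t then Real.log (1 + t + t ^ 2 / 2)
  else -Real.log 2

/-- `r_l(θ) = n⁻¹ ∑ᵢ ψ(⟨θ, xᵢ⟩² - l)`, for the sample `x = (x₁, …, x_n)`. -/
def rCrit {n d : ℕ} (x : Fin n → EuclideanSpace ℝ (Fin d)) (l : ℝ)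
    (θ : EuclideanSpace ℝ (Fin d)) : ℝ :=
  (n : ℝ)⁻¹ * ∑ i, psi ((inner ℝ θ (x i)) ^ 2 - l)

/-- The estimator `Ñ_l(θ) = l / α̂²` of `N(θ)`, where `α̂ = sup {α ≥ 0 : r_l(αθ) ≤ 0}`
(and `Ñ_l(θ) = 0` if `α̂ = +∞`), for `l > 0`. It is written as an infimum over `α`, so that the
case `α̂ = +∞` is included. -/
def Ntilde {n d : ℕ} (x : Fin n → EuclideanSpace ℝ (Fin d)) (l : ℝ)
    (θ : EuclideanSpace ℝ (Fin d)) : ℝ :=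
  sInf {v : ℝ | ∃ α : ℝ, 0 < α ∧ rCrit x l (α • θ) ≤ 0 ∧ v = l / α ^ 2}

/-- The scale `λ_j`, `0 ≤ j < K`. -/
def lamGrid (n : ℕ) (κ a ε : ℝ) (j : ℕ) : ℝ :=
  Real.sqrt (2 / (n * (κ - 1)) * ((2 + 3 * cConst) / (4 * (2 + cConst) * Real.sqrt κ)
    * Real.exp (j * a) + Real.log (gridSize n κ a / ε)))

/-- The inverse variance `β_j`, `0 ≤ j < K`, of the Gaussian perturbation of `θ`. -/
def betaGrid (n : ℕ) (κ s a : ℝ) (j : ℕ) : ℝ :=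
  s * Real.sqrt (2 * (2 + cConst) * Real.sqrt κ * n * Real.exp (-((j : ℝ) - 1 / 2) * a))

/-- `μ_j = (κ - 1) λ_j + (2 + c) κ^{1/2} s₄² / β_j`. -/
def muGrid (n : ℕ) (κ s a ε : ℝ) (j : ℕ) : ℝ :=
  (κ - 1) * lamGrid n κ a ε j + (2 + cConst) * Real.sqrt κ * s / betaGrid n κ s a j

/-- `γ_j = (κ - 1) λ_j / 2 + (2 + c) κ^{1/2} s₄² / β_j + (2 + 3c) s₄⁴ / (2 β_j² λ_j)
+ log(K/ε) / (n λ_j)`. -/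
def gammaGrid (n : ℕ) (κ s a ε : ℝ) (j : ℕ) : ℝ :=
  (κ - 1) * lamGrid n κ a ε j / 2 + (2 + cConst) * Real.sqrt κ * s / betaGrid n κ s a j
    + (2 + 3 * cConst) * s ^ 2 / (2 * betaGrid n κ s a j ^ 2 * lamGrid n κ a ε j)
    + Real.log (gridSize n κ a / ε) / (n * lamGrid n κ a ε j)

/-- `ρ_j(t) = β_j / (2 n t)`. -/
def rhoGrid (n : ℕ) (κ s a : ℝ) (j : ℕ) (t : ℝ) : ℝ :=
  betaGrid n κ s a j / (2 * n * t)

/-- `q` lies in the confidence interval for `θᵀ G θ` computed from the sample `x` at the scale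
`(λ_j, β_j)`: with `S = max {Ñ_{λ_j}(θ), σ}`, one has
`|max {q, σ} - S| ≤ S (γ_j + ρ_j(S)) / (1 - μ_j - γ_j - 2 ρ_j(S))`.
There is no constraint when `6 (γ_j + ρ_j(S)) > 1`. -/
def InConfidenceInterval {n d : ℕ} (κ s a ε σ : ℝ) (x : Fin n → EuclideanSpace ℝ (Fin d))
    (j : ℕ) (θ : EuclideanSpace ℝ (Fin d)) (q : ℝ) : Prop :=
  let S := max (Ntilde x (lamGrid n κ a ε j) θ) σ
  6 * (gammaGrid n κ s a ε j + rhoGrid n κ s a j S) ≤ 1 →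
    |max q σ - S| ≤ S * ((gammaGrid n κ s a ε j + rhoGrid n κ s a j S) /
      (1 - muGrid n κ s a ε j - gammaGrid n κ s a ε j - 2 * rhoGrid n κ s a j S))

/-- `Θ` is a finite `δ`-net of the unit sphere of `ℝ^d`. -/
def IsSphereNet {d : ℕ} (δ : ℝ) (Θ : Finset (EuclideanSpace ℝ (Fin d))) : Prop :=
  (∀ ξ ∈ Θ, ‖ξ‖ = 1) ∧ ∀ θ : EuclideanSpace ℝ (Fin d), ‖θ‖ = 1 → ∃ ξ ∈ Θ, ‖θ - ξ‖ ≤ δ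

/-- The (convex) set of the symmetric matrices `Q` such that, for every `θ` in the net `Θ`, the
value `θᵀ Q θ` is non-negative and belongs to all the confidence intervals for `θᵀ G θ`. -/
def feasible {n d : ℕ} (κ s a ε σ : ℝ) (Θ : Finset (EuclideanSpace ℝ (Fin d)))
    (x : Fin n → EuclideanSpace ℝ (Fin d)) : Set (Matrix (Fin d) (Fin d) ℝ) :=
  {Q | Q.IsSymm ∧ ∀ θ ∈ Θ, 0 ≤ quadForm Q θ ∧
    ∀ j < gridSize n κ a, InConfidenceInterval κ s a ε σ x j θ (quadForm Q θ)}

/-- `Q` solves the convex program: it has the least Frobenius norm in `feasible`. -/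
def IsLeastNormFeasible {n d : ℕ} (κ s a ε σ : ℝ) (Θ : Finset (EuclideanSpace ℝ (Fin d)))
    (x : Fin n → EuclideanSpace ℝ (Fin d)) (Q : Matrix (Fin d) (Fin d) ℝ) : Prop :=
  Q ∈ feasible κ s a ε σ Θ x ∧ ∀ Q' ∈ feasible κ s a ε σ Θ x, frobNorm Q ≤ frobNorm Q'

open Classical in
/-- The matrix `Q`: the solution of the convex program (`0` if there is none). -/
def estQ {n d : ℕ} (κ s a ε σ : ℝ) (Θ : Finset (EuclideanSpace ℝ (Fin d)))
    (x : Fin n → EuclideanSpace ℝ (Fin d)) : Matrix (Fin d) (Fin d) ℝ :=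
  if h : ∃ Q, IsLeastNormFeasible κ s a ε σ Θ x Q then h.choose else 0

/-- The robust estimator `Ĝ = Q₊` of the Gram matrix. -/
def estGram {n d : ℕ} (κ s a ε σ : ℝ) (Θ : Finset (EuclideanSpace ℝ (Fin d)))
    (x : Fin n → EuclideanSpace ℝ (Fin d)) : Matrix (Fin d) (Fin d) ℝ :=
  posPart (estQ κ s a ε σ Θ x)

end RobustPCA

end

/-!
# Operator norm bound for functions of a robust Gram matrix estimator

The proof separates a probabilistic estimate of the quadratic form `N(θ) = E ⟨θ, X⟩²`, uniform in
the direction `θ`, from the deterministic consequences it has for the estimator.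

*Concentration of the criterion.* The direction `θ` is perturbed by a Gaussian vector of
covariance `β⁻¹ I`, and the PAC-Bayesian inequality (`integral_shift_le_of_lintegral_exp_le`, a
consequence of the Cameron–Martin formula and of Jensen's inequality) turns an exponential moment
at each fixed `θ`, in which independence is used, into a bound valid for all `θ` at once. The
influence function `ψ` is not convex, so it cannot be averaged over the perturbation directly;
`psi_le_integral_log_perturb` bounds it by the Gaussian average of `log (1 + polynomial)`, at the
price of the constant `c`. Using only moments of order four, this gives
`exists_samples_abs_rCrit_sub_le`: with high probability, `|r_l(θ) - (N(θ) - l)| ≤ critDev` for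
every `θ`.

*Confidence intervals.* As `ψ` is monotone, the definition of `Ñ_l(θ)` as a threshold transfers
this bound into two quadratic inequalities for `N(θ) / t - 1` (`CriterionBounds`). They show that
the intervals of the convex program contain `N(θ)` (`CriterionBounds.abs_max_sub_le`), and that
the interval is narrow at a scale adapted to `N(θ)` (`CriterionBounds.width_le`); the geometric
grid contains such a scale up to the factors `cosh (a / 4)` and `cosh (a / 2)` (`exists_scale`). A
union bound over the grid has a total probability of failure at most `2 ε`.

*The estimator.* Hence `G` satisfies the constraints of the program, so `Q` exists and `‖Q‖_F ≤
‖G‖_F`; on the net, `Q` and `G` lie in the same narrow intervals. Going from the net to the sphere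
and taking the positive part costs at most `6 δ ‖G‖_F`, and `‖G - Ĝ‖_∞ ≤ B(λ₁)`
(`norm_gram_sub_estGram_le`).

*Lipschitz functions.* In the eigenbases `p` of `G` and `q` of `Ĝ`, the coordinates of `F = f(G) -
f(Ĝ)` are `⟨p_i, F q_k⟩ = (f(λ_i) - f(ν_k)) ⟨p_i, q_k⟩`, so `F` maps each eigenvector to a vector
of norm at most `L⁻¹ B`. The `r` leading eigenvectors of each matrix contribute `r B²` to the
square of the norm. For the others, the eigenvalues are at most `ℓ = λ_{r+1}` for `G` and, by
Weyl's inequality, `ℓ + B` for `Ĝ`, so this part of `F` has norm at most `L⁻¹ (ℓ + B)`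
(`IsDiag.norm_sub_apply_le`). The bound `2 r B² + (B + ℓ)²` obtained for `L² ‖F‖²` is at most the
square of `B + √(4 r B² + 2 ∑_{i > r} λ_i²)`.
-/

noncomputable section
namespace RobustPCA

/-! ### The influence function -/

theorem one_sub_add_sq_half_pos (t : ℝ) : 0 < 1 - t + t ^ 2 / 2 := by nlinarith [sq_nonneg (t - 1)]

theorem one_add_add_sq_half_pos (t : ℝ) : 0 < 1 + t + t ^ 2 / 2 := by nlinarith [sq_nonneg (t + 1)]

theorem psi_of_one_le {t : ℝ} (h : 1 ≤ t) : psi t = Real.log 2 := by simp [psi, h]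

theorem psi_of_mem_Icc {t : ℝ} (h0 : 0 ≤ t) (h1 : t ≤ 1) :
    psi t = -Real.log (1 - t + t ^ 2 / 2) := by
  rcases h1.lt_or_eq with h | rfl
  · simp [psi, h0, not_le.mpr h]
  · rw [psi_of_one_le le_rfl, ← Real.log_inv]; norm_num

theorem psi_neg (t : ℝ) : psi (-t) = -psi t := by
  unfold psi
  rcases lt_trichotomy t 0 with h | rfl | h
  · by_cases h1 : t ≤ -1
    · rcases h1.lt_or_eq with h1 | rfl
      · rw [if_pos (by linarith), if_neg (by linarith), if_neg (by linarith), if_neg (by linarith)]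
        simp
      · norm_num
        rw [show (1 / 2 : ℝ) = 2⁻¹ by norm_num, Real.log_inv]; simp
    · push Not at h1
      rw [if_neg (by linarith), if_pos (by linarith), if_neg (by linarith), if_neg (by linarith),
        if_pos (by linarith)]
      simp
  · norm_num
  · by_cases h1 : 1 ≤ t
    · rw [if_neg (by linarith), if_neg (by linarith), if_pos h1]
      rcases h1.lt_or_eq with h1 | rfl
      · rw [if_neg (by linarith)]
      · norm_num
        rw [show (1 / 2 : ℝ) = 2⁻¹ by norm_num, Real.log_inv]
    · push Not at h1
      rw [if_neg (by linarith), if_neg (by linarith), if_pos (by linarith), if_neg (by linarith),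
        if_pos h.le]
      simp [sub_eq_add_neg]

/-- The derivative of `psi`. -/
def psiDeriv (t : ℝ) : ℝ := max (1 - |t|) 0 / (1 - |t| + t ^ 2 / 2)

theorem psiDeriv_neg (t : ℝ) : psiDeriv (-t) = psiDeriv t := by simp [psiDeriv]

theorem psiDeriv_nonneg (t : ℝ) : 0 ≤ psiDeriv t := by
  have := one_sub_add_sq_half_pos |t|
  rw [sq_abs] at this
  exact div_nonneg (le_max_right _ _) this.le

theorem hasDerivWithinAt_psi_of_nonneg {t : ℝ} (ht : 0 ≤ t) :
    HasDerivWithinAt psi (psiDeriv t) (Set.Ici 0) t := by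
  have key : ∀ u ∈ Set.Icc (0 : ℝ) 1, HasDerivWithinAt psi (psiDeriv u) (Set.Icc 0 1) u := by
    intro u hu
    have hp := one_sub_add_sq_half_pos u
    have h1 : HasDerivAt (fun t : ℝ => 1 - t + t ^ 2 / 2) (-1 + u) u := by
      have := (((hasDerivAt_id u).const_sub 1).add (((hasDerivAt_id u).pow 2).div_const 2))
      convert! this using 1
      simp
    have h2 := (h1.log hp.ne').neg
    have h3 : psiDeriv u = -((-1 + u) / (1 - u + u ^ 2 / 2)) := by
      rw [psiDeriv, abs_of_nonneg hu.1, max_eq_left (by linarith [hu.2]), ← neg_div]; congr 1; ring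
    rw [h3]
    exact h2.hasDerivWithinAt.congr (fun v hv => psi_of_mem_Icc hv.1 hv.2)
      (psi_of_mem_Icc hu.1 hu.2)
  have key' : ∀ u, 1 ≤ u → HasDerivWithinAt psi (psiDeriv u) (Set.Ici 1) u := by
    intro u hu
    have h3 : psiDeriv u = 0 := by
      rw [psiDeriv, abs_of_nonneg (by linarith), max_eq_right (by linarith), zero_div]
    rw [h3]
    exact (hasDerivWithinAt_const u _ (Real.log 2)).congr (fun v hv => psi_of_one_le hv)
      (psi_of_one_le hu)
  rcases lt_trichotomy t 1 with h | rfl | h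
  · refine (key t ⟨ht, h.le⟩).mono_of_mem_nhdsWithin ?_
    rw [← Set.Ici_inter_Iic]
    exact Filter.inter_mem self_mem_nhdsWithin (mem_nhdsWithin_of_mem_nhds (Iic_mem_nhds h))
  · have := (key 1 (by simp)).union (key' 1 le_rfl)
    rwa [Set.Icc_union_Ici_eq_Ici (by norm_num)] at this
  · refine (key' t h.le).mono_of_mem_nhdsWithin ?_
    exact mem_nhdsWithin_of_mem_nhds (Ici_mem_nhds h)

theorem hasDerivAt_psi (t : ℝ) : HasDerivAt psi (psiDeriv t) t := by
  have hneg : ∀ t : ℝ, t ≤ 0 → HasDerivWithinAt psi (psiDeriv t) (Set.Iic 0) t := by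
    intro t ht
    have h := hasDerivWithinAt_psi_of_nonneg (t := -t) (by linarith)
    have h2 := (h.scomp (h := fun x : ℝ => -x) (s := Set.Iic 0) t
      (hasDerivAt_neg t).hasDerivWithinAt
      (fun x hx => by simpa using hx)).neg
    refine (h2.congr_deriv ?_).congr (fun x _ => ?_) ?_
    · simp [psiDeriv_neg]
    · simp [psi_neg]
    · simp [psi_neg]
  rcases lt_trichotomy t 0 with h | rfl | h
  · exact (hneg t h.le).hasDerivAt (Iic_mem_nhds h)
  · have := (hneg 0 le_rfl).union (hasDerivWithinAt_psi_of_nonneg le_rfl)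
    rwa [Set.Iic_union_Ici, hasDerivWithinAt_univ] at this
  · exact (hasDerivWithinAt_psi_of_nonneg h.le).hasDerivAt (Ici_mem_nhds h)

theorem continuous_psi : Continuous psi :=
  continuous_iff_continuousAt.2 fun t => (hasDerivAt_psi t).continuousAt

theorem psi_monotone : Monotone psi :=
  monotone_of_deriv_nonneg (fun t => (hasDerivAt_psi t).differentiableAt) fun t => by
    rw [(hasDerivAt_psi t).deriv]; exact psiDeriv_nonneg t

theorem psi_le_log_two (t : ℝ) : psi t ≤ Real.log 2 := by
  rw [← psi_of_one_le (le_max_right t 1)]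
  exact psi_monotone (le_max_left _ _)

theorem neg_log_two_le_psi (t : ℝ) : -Real.log 2 ≤ psi t := by
  have := psi_le_log_two (-t); rw [psi_neg] at this; linarith

/-- With the oddness of `ψ`, this bounds `exp (± ψ t)` by `1 ± t + t² / 2`, which is what makes the
exponential moments of `ψ` accessible under a moment of order two of `t`. -/
theorem psi_le_log (t : ℝ) : psi t ≤ Real.log (1 + t + t ^ 2 / 2) := by
  have hp := one_add_add_sq_half_pos t
  have hq := one_sub_add_sq_half_pos t
  unfold psi
  split_ifs with h1 h2 h3
  · exact Real.log_le_log (by norm_num) (by nlinarith)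
  · rw [← Real.log_inv]
    refine Real.log_le_log (by positivity) ?_
    rw [inv_le_comm₀ hq hp, inv_le_iff_one_le_mul₀ hp]
    nlinarith [sq_nonneg (t ^ 2)]
  · exact le_rfl
  · rw [← Real.log_inv]
    exact Real.log_le_log (by norm_num) (by nlinarith [sq_nonneg (t + 1)])

/-- The derivative of `psi` does not decrease faster than `-2t`. -/
theorem psiDeriv_add_two_mul_monotone : Monotone fun t => psiDeriv t + 2 * t := by
  have h01 : ∀ s t : ℝ, 0 ≤ s → s ≤ t → t ≤ 1 → psiDeriv s - psiDeriv t ≤ 2 * (t - s) := by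
    intro s t hs hst ht
    have ps := one_sub_add_sq_half_pos s
    have pt := one_sub_add_sq_half_pos t
    rw [psiDeriv, psiDeriv, abs_of_nonneg hs, abs_of_nonneg (hs.trans hst),
      max_eq_left (by linarith), max_eq_left (by linarith), div_sub_div _ _ ps.ne' pt.ne',
      div_le_iff₀ (by positivity)]
    have e : (1 - s) * (1 - t + t ^ 2 / 2) - (1 - s + s ^ 2 / 2) * (1 - t)
        = (t - s) * (1 - (1 - s) * (1 - t)) / 2 := by ring
    have e2 : (1 - s + s ^ 2 / 2) * (1 - t + t ^ 2 / 2)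
        = (1 + (1 - s) ^ 2) * (1 + (1 - t) ^ 2) / 4 := by ring
    rw [e, e2]
    have : 1 - (1 - s) * (1 - t) ≤ (1 + (1 - s) ^ 2) * (1 + (1 - t) ^ 2) := by
      have h1 : 0 ≤ (1 - s) * (1 - t) := mul_nonneg (by linarith) (by linarith)
      nlinarith [sq_nonneg ((1 - s) * (1 - t)), sq_nonneg (1 - s), sq_nonneg (1 - t)]
    nlinarith [mul_le_mul_of_nonneg_left this (sub_nonneg.2 hst)]
  have h1 : ∀ t : ℝ, 1 ≤ t → psiDeriv t = 0 := fun t ht => by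
    rw [psiDeriv, abs_of_nonneg (by linarith), max_eq_right (by linarith), zero_div]
  have h0 : MonotoneOn (fun t => psiDeriv t + 2 * t) (Set.Ici 0) := by
    intro s hs t ht hst
    simp only [Set.mem_Ici] at hs ht
    show psiDeriv s + 2 * s ≤ psiDeriv t + 2 * t
    rcases le_total t 1 with h | h
    · linarith [h01 s t hs hst h]
    · rcases le_total s 1 with h' | h'
      · have := h01 s 1 hs h' le_rfl
        rw [h1 1 le_rfl] at this; rw [h1 t h]; linarith
      · rw [h1 s h', h1 t h]; linarith
  -- on the negative half-line `psiDeriv` itself is nondecreasing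
  have h0' : MonotoneOn (fun t => psiDeriv t + 2 * t) (Set.Iic 0) := by
    have anti : ∀ s t : ℝ, 0 ≤ s → s ≤ t → psiDeriv t ≤ psiDeriv s := by
      intro s t hs hst
      rcases le_total 1 t with h | h
      · rw [h1 t h]; exact psiDeriv_nonneg s
      have ps := one_sub_add_sq_half_pos s
      have pt := one_sub_add_sq_half_pos t
      rw [psiDeriv, psiDeriv, abs_of_nonneg hs, abs_of_nonneg (hs.trans hst),
        max_eq_left (by linarith), max_eq_left (by linarith), div_le_div_iff₀ pt ps, ← sub_nonneg]
      have e : (1 - s) * (1 - t + t ^ 2 / 2) - (1 - t) * (1 - s + s ^ 2 / 2)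
        = (t - s) * (s + t * (1 - s)) / 2 := by ring
      rw [e]
      have := mul_nonneg (hs.trans hst) (by linarith : 0 ≤ 1 - s)
      have := mul_nonneg (sub_nonneg.2 hst) (add_nonneg hs this)
      linarith
    intro s hs t ht hst
    simp only [Set.mem_Iic] at hs ht
    have := anti (-t) (-s) (by linarith) (by linarith)
    rw [psiDeriv_neg, psiDeriv_neg] at this
    show psiDeriv s + 2 * s ≤ psiDeriv t + 2 * t
    linarith
  exact h0'.Iic_union_Ici h0

/-- Although `ψ` is not convex, its second derivative is at least `-2`, so that Jensen's inequality
holds for `ψ` up to a variance term. -/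
theorem convexOn_psi_add_sq : ConvexOn ℝ Set.univ fun t => psi t + t ^ 2 := by
  have hd : ∀ t, HasDerivAt (fun t => psi t + t ^ 2) (psiDeriv t + 2 * t) t := fun t => by
    have := (hasDerivAt_psi t).add (hasDerivAt_pow 2 t)
    convert! this using 1
    simp
  refine Monotone.convexOn_univ_of_deriv (fun t => (hd t).differentiableAt) ?_
  convert psiDeriv_add_two_mul_monotone using 1
  ext t
  exact (hd t).deriv

/-- All that is used of the constant `c`: it is large enough for `psi_le_integral_log_perturb`. -/
theorem forty_le_cConst : 40 ≤ cConst := by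
  have h2 : Real.sqrt 2 ≤ 1.4143 := by rw [Real.sqrt_le_left (by norm_num)]; norm_num
  have h2' : 1.4142 ≤ Real.sqrt 2 := Real.le_sqrt_of_sq_le (by norm_num)
  have hl := Real.log_two_lt_d9
  have hl0 : 0 < Real.log 2 := Real.log_pos (by norm_num)
  have he : (6.4 : ℝ) ≤ Real.exp ((1 + 2 * Real.sqrt 2) / 2) := by
    have h1 : (1.9 : ℝ) ≤ (1 + 2 * Real.sqrt 2) / 2 := by linarith
    refine le_trans ?_ (Real.exp_le_exp.2 h1)
    refine le_trans ?_ (Real.sum_le_exp_of_nonneg (by norm_num) 6)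
    norm_num [Finset.sum_range_succ, Nat.factorial]
  have hd : 8 * Real.log 2 * (Real.sqrt 2 - 1) ≤ 2.3 := by nlinarith
  have hd0 : 0 < 8 * Real.log 2 * (Real.sqrt 2 - 1) := by
    have : 0 < Real.sqrt 2 - 1 := by linarith
    positivity
  have hq : (6.5 : ℝ) ≤ 15 / (8 * Real.log 2 * (Real.sqrt 2 - 1)) := by
    rw [le_div_iff₀ hd0]; linarith
  unfold cConst
  nlinarith

/-! ### Gaussian moments -/

theorem integral_pow_four_gaussianReal (v : ℝ≥0) : ∫ u, u ^ 4 ∂gaussianReal 0 v = 3 * v ^ 2 := by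
  have h := iteratedDeriv_mgf_zero (X := id) (μ := gaussianReal 0 v)
    (by rw [integrableExpSet_id_gaussianReal]; simp) 4
  rw [mgf_id_gaussianReal] at h
  have e : (fun u : ℝ => u ^ 4) = id ^ 4 := by ext; simp
  rw [e]
  refine h.symm.trans ?_
  have hE : ∀ t : ℝ, HasDerivAt (fun t : ℝ => Real.exp ((0 : ℝ) * t + v * t ^ 2 / 2))
      (v * t * Real.exp ((0 : ℝ) * t + v * t ^ 2 / 2)) t := by
    intro t
    have h1 : HasDerivAt (fun t : ℝ => (0 : ℝ) * t + v * t ^ 2 / 2) (v * t) t := by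
      have := ((hasDerivAt_id t).const_mul (0 : ℝ)).add
        (((hasDerivAt_pow 2 t).const_mul (v : ℝ)).div_const 2)
      convert! this using 1
      simp
      ring
    convert! h1.exp using 1
    ring
  have step : ∀ (p p' : ℝ → ℝ), (∀ t, HasDerivAt p (p' t) t) →
      deriv (fun t : ℝ => p t * Real.exp ((0 : ℝ) * t + v * t ^ 2 / 2)) =
        fun t => (p' t + p t * (v * t)) * Real.exp ((0 : ℝ) * t + v * t ^ 2 / 2) := by
    intro p p' hp
    ext t
    have := ((hp t).mul (hE t)).deriv
    refine Eq.trans ?_ (this.trans ?_)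
    · rfl
    · ring
  have d1 : deriv (fun t : ℝ => Real.exp ((0 : ℝ) * t + v * t ^ 2 / 2)) =
      fun t => (v * t) * Real.exp ((0 : ℝ) * t + v * t ^ 2 / 2) := by
    ext t; exact (hE t).deriv
  simp only [iteratedDeriv_succ, iteratedDeriv_zero]
  rw [d1, step (fun t => v * t) (fun _ => v) (fun t => by
      simpa using (hasDerivAt_id t).const_mul (v : ℝ)),
    step (fun t => v + v * t * (v * t)) (fun t => 2 * v ^ 2 * t) (fun t => by
      have := ((hasDerivAt_pow 2 t).const_mul ((v : ℝ) ^ 2)).const_add (v : ℝ)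
      convert! this using 1
      · ext; ring
      · simp; ring),
    step _ (fun t => 3 * v ^ 2 + 3 * v ^ 3 * t ^ 2) (fun t => by
      have := ((hasDerivAt_pow 3 t).const_mul ((v : ℝ) ^ 3)).add
        ((hasDerivAt_id t).const_mul (3 * (v : ℝ) ^ 2))
      convert! this using 1
      · ext; simp; ring
      · simp; ring)]
  simp

theorem integral_sq_gaussianReal (v : ℝ≥0) : ∫ u, u ^ 2 ∂gaussianReal 0 v = v := by
  have := variance_fun_id_gaussianReal (μ := 0) (v := v)
  rw [variance_eq_integral (by fun_prop)] at this
  simpa [integral_id_gaussianReal] using this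

theorem integrable_pow_gaussianReal (v : ℝ≥0) (k : ℕ) :
    Integrable (fun u : ℝ => u ^ k) (gaussianReal 0 v) := by
  rcases Nat.eq_zero_or_pos k with rfl | hk
  · simp
  refine ((memLp_id_gaussianReal (μ := 0) (v := v) k).integrable_norm_pow hk.ne').mono
    (by fun_prop) (by simp)

theorem integrable_comp_neg_gaussianReal {v : ℝ≥0} {f : ℝ → ℝ}
    (hf : Integrable f (gaussianReal 0 v)) : Integrable (fun u => f (-u)) (gaussianReal 0 v) := by
  have hneg : (gaussianReal 0 v).map (fun x => -x) = gaussianReal 0 v := by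
    rw [gaussianReal_map_neg, neg_zero]
  rw [← hneg] at hf
  exact hf.comp_measurable (by fun_prop)

theorem integral_gaussianReal_eq_symm {v : ℝ≥0} {f : ℝ → ℝ} (hf : Integrable f (gaussianReal 0 v)) :
    ∫ u, f u ∂gaussianReal 0 v = ∫ u, (f u + f (-u)) / 2 ∂gaussianReal 0 v := by
  have hneg : (gaussianReal 0 v).map (fun x => -x) = gaussianReal 0 v := by
    rw [gaussianReal_map_neg, neg_zero]
  have hf' : Integrable f ((gaussianReal 0 v).map (fun x => -x)) := by rwa [hneg]
  have h2 : ∫ u, f (-u) ∂gaussianReal 0 v = ∫ u, f u ∂gaussianReal 0 v := by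
    rw [← integral_map (φ := fun x : ℝ => -x) (by fun_prop) hf'.1, hneg]
  rw [integral_div, integral_add hf (integrable_comp_neg_gaussianReal hf), h2]
  ring

/-- A lower bound for the integral against a centred Gaussian law, from symmetric pairs. -/
theorem le_integral_gaussianReal_of_pairs {v : ℝ≥0} {f : ℝ → ℝ}
    (hf : Integrable f (gaussianReal 0 v)) {a : ℝ} (h : ∀ u, 2 * a ≤ f u + f (-u)) :
    a ≤ ∫ u, f u ∂gaussianReal 0 v := by
  rw [integral_gaussianReal_eq_symm hf]
  have := integral_mono (μ := gaussianReal 0 v) (integrable_const a)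
    ((hf.add (integrable_comp_neg_gaussianReal hf)).div_const 2)
    (fun u => by simp only [Pi.add_apply]; linarith [h u])
  simpa using this

theorem integrable_quartic_gaussianReal (v : ℝ≥0) (a₀ a₁ a₂ a₃ a₄ : ℝ) :
    Integrable (fun u : ℝ => a₀ + a₁ * u + a₂ * u ^ 2 + a₃ * u ^ 3 + a₄ * u ^ 4)
      (gaussianReal 0 v) := by
  have h1 := (integrable_pow_gaussianReal v 1).const_mul a₁
  simp only [pow_one] at h1
  exact ((((integrable_const a₀).add h1).add ((integrable_pow_gaussianReal v 2).const_mul a₂)).add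
    ((integrable_pow_gaussianReal v 3).const_mul a₃)).add
    ((integrable_pow_gaussianReal v 4).const_mul a₄)

theorem integral_quartic_gaussianReal (v : ℝ≥0) (a₀ a₁ a₂ a₃ a₄ : ℝ) :
    ∫ u, (a₀ + a₁ * u + a₂ * u ^ 2 + a₃ * u ^ 3 + a₄ * u ^ 4) ∂gaussianReal 0 v
      = a₀ + a₂ * v + a₄ * (3 * v ^ 2) := by
  rw [integral_gaussianReal_eq_symm (integrable_quartic_gaussianReal v _ _ _ _ _)]
  have e : ∀ u : ℝ, ((a₀ + a₁ * u + a₂ * u ^ 2 + a₃ * u ^ 3 + a₄ * u ^ 4) + (a₀ + a₁ * (-u)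
      + a₂ * (-u) ^ 2 + a₃ * (-u) ^ 3 + a₄ * (-u) ^ 4)) / 2 = a₀ + a₂ * u ^ 2 + a₄ * u ^ 4 := by
    intro u; ring
  simp_rw [e]
  have i2 := (integrable_pow_gaussianReal v 2).const_mul a₂
  have i4 := (integrable_pow_gaussianReal v 4).const_mul a₄
  rw [integral_add (f := fun u => a₀ + a₂ * u ^ 2) ((integrable_const a₀).add i2) i4,
    integral_add (integrable_const a₀) i2, integral_const_mul, integral_const_mul,
    integral_sq_gaussianReal, integral_pow_four_gaussianReal]
  simp

/-! ### The influence function and Gaussian perturbations -/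

/-- The exponential bound `1 + perturb e l v w` for `exp (ψ (± (m ^ 2 - l)))`, where `w` stands for
a Gaussian perturbation of `m` of variance `v` and `e = ± 1` is a sign. -/
def perturb (e l v w : ℝ) : ℝ :=
  e * (w ^ 2 - v - l) + (w ^ 2 - v - l) ^ 2 / 2 + cConst * (v * (w ^ 2 + v / 2))

theorem neg_half_le_perturb {e l v w : ℝ} (he : e = 1 ∨ e = -1) (hv : 0 ≤ v) :
    -(1 / 2) ≤ perturb e l v w := by
  have hc := forty_le_cConst
  have : 0 ≤ cConst * (v * (w ^ 2 + v / 2)) := by positivity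
  unfold perturb
  rcases he with rfl | rfl
  · nlinarith [sq_nonneg (w ^ 2 - v - l + 1)]
  · nlinarith [sq_nonneg (w ^ 2 - v - l - 1)]

theorem integrable_log_one_add {α : Type*} [MeasurableSpace α] {μ : Measure α}
    [IsFiniteMeasure μ] {f : α → ℝ} (hf : Integrable f μ) (h : ∀ x, -(1 / 2) ≤ f x) :
    Integrable (fun x => Real.log (1 + f x)) μ := by
  refine Integrable.mono' (hf.abs.add (integrable_const (Real.log 2)))
    ((Real.measurable_log.comp_aemeasurable (hf.1.aemeasurable.const_add 1)).aestronglyMeasurable)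
    (Filter.Eventually.of_forall fun x => ?_)
  have hx := h x
  have h1 : Real.log (1 + f x) ≤ |f x| :=
    (Real.log_le_sub_one_of_pos (by linarith)).trans (by linarith [le_abs_self (f x)])
  have h2 : -Real.log 2 ≤ Real.log (1 + f x) := by
    rw [← Real.log_inv]; exact Real.log_le_log (by norm_num) (by linarith)
  have h3 : 0 ≤ Real.log 2 := Real.log_nonneg (by norm_num)
  have h4 := abs_nonneg (f x)
  rw [Real.norm_eq_abs, abs_le]
  simp only [Pi.add_apply]
  constructor <;> linarith

theorem integrable_perturb (e l m : ℝ) (v : ℝ≥0) :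
    Integrable (fun u => perturb e l v (m + u)) (gaussianReal 0 v) := by
  refine (integrable_quartic_gaussianReal v (e * (m ^ 2 - v - l) + (m ^ 2 - v - l) ^ 2 / 2 +
    cConst * (v * (m ^ 2 + v / 2))) (e * (2 * m) + 2 * m * (m ^ 2 - v - l) + cConst * v * (2 * m))
    (e + (m ^ 2 - v - l) + 2 * m ^ 2 + cConst * v) (2 * m) (1 / 2)).congr
    (Filter.Eventually.of_forall fun u => ?_)
  simp only [perturb]; ring

theorem integral_perturb (e l m : ℝ) (v : ℝ≥0) :
    ∫ u, perturb e l v (m + u) ∂gaussianReal 0 v =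
      e * (m ^ 2 - l) + (m ^ 2 - l) ^ 2 / 2 + (2 + cConst) * (v * m ^ 2)
        + (2 + 3 * cConst) / 2 * v ^ 2 := by
  have := integral_quartic_gaussianReal v (e * (m ^ 2 - v - l) + (m ^ 2 - v - l) ^ 2 / 2 +
    cConst * (v * (m ^ 2 + v / 2))) (e * (2 * m) + 2 * m * (m ^ 2 - v - l) + cConst * v * (2 * m))
    (e + (m ^ 2 - v - l) + 2 * m ^ 2 + cConst * v) (2 * m) (1 / 2)
  rw [show (fun u => perturb e l v (m + u)) = _ from funext fun u => show _ =
    (e * (m ^ 2 - v - l) + (m ^ 2 - v - l) ^ 2 / 2 + cConst * (v * (m ^ 2 + v / 2))) +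
    (e * (2 * m) + 2 * m * (m ^ 2 - v - l) + cConst * v * (2 * m)) * u +
    (e + (m ^ 2 - v - l) + 2 * m ^ 2 + cConst * v) * u ^ 2 + (2 * m) * u ^ 3 + (1 / 2) * u ^ 4 by
    unfold perturb; ring, this]
  ring

/-- `ψ` loses at most the variance when the square of a number is perturbed by a Gaussian
variable. -/
theorem psi_sub_le_integral_psi {e : ℝ} (he : e = 1 ∨ e = -1) (l m : ℝ) (v : ℝ≥0) :
    psi (e * (m ^ 2 - l)) - (4 * v * m ^ 2 + 2 * v ^ 2) ≤
      ∫ u, psi (e * ((m + u) ^ 2 - v - l)) ∂gaussianReal 0 v := by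
  have he2 : e ^ 2 = 1 := by rcases he with rfl | rfl <;> norm_num
  have i1 : Integrable (fun u => e * ((m + u) ^ 2 - v - l)) (gaussianReal 0 v) := by
    refine (integrable_quartic_gaussianReal v (e * (m ^ 2 - v - l)) (2 * e * m) e 0 0).congr
      (Filter.Eventually.of_forall fun u => ?_)
    ring
  have e1 : ∫ u, e * ((m + u) ^ 2 - v - l) ∂gaussianReal 0 v = e * (m ^ 2 - l) := by
    have := integral_quartic_gaussianReal v (e * (m ^ 2 - v - l)) (2 * e * m) e 0 0
    rw [show (fun u => e * ((m + u) ^ 2 - v - l)) = _ from funext fun u => show _ =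
      (e * (m ^ 2 - v - l)) + (2 * e * m) * u + e * u ^ 2 + 0 * u ^ 3 + 0 * u ^ 4 by ring, this]
    ring
  have i2 : Integrable (fun u => (e * ((m + u) ^ 2 - v - l)) ^ 2) (gaussianReal 0 v) := by
    refine (integrable_quartic_gaussianReal v ((m ^ 2 - v - l) ^ 2) (4 * m * (m ^ 2 - v - l))
      (4 * m ^ 2 + 2 * (m ^ 2 - v - l)) (4 * m) 1).congr (Filter.Eventually.of_forall fun u => ?_)
    simp only [mul_pow, he2]; ring
  have e2 : ∫ u, (e * ((m + u) ^ 2 - v - l)) ^ 2 ∂gaussianReal 0 v =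
      (e * (m ^ 2 - l)) ^ 2 + (4 * v * m ^ 2 + 2 * v ^ 2) := by
    have := integral_quartic_gaussianReal v ((m ^ 2 - v - l) ^ 2) (4 * m * (m ^ 2 - v - l))
      (4 * m ^ 2 + 2 * (m ^ 2 - v - l)) (4 * m) 1
    rw [show (fun u => (e * ((m + u) ^ 2 - v - l)) ^ 2) = _ from funext fun u => show _ =
      ((m ^ 2 - v - l) ^ 2) + (4 * m * (m ^ 2 - v - l)) * u +
      (4 * m ^ 2 + 2 * (m ^ 2 - v - l)) * u ^ 2 + (4 * m) * u ^ 3 + 1 * u ^ 4 by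
      rw [mul_pow, he2]; ring, this, mul_pow, he2]
    ring
  have i3 : Integrable (fun u => psi (e * ((m + u) ^ 2 - v - l))) (gaussianReal 0 v) := by
    refine Integrable.of_bound (C := Real.log 2) ?_ (Filter.Eventually.of_forall fun u => ?_)
    · exact (continuous_psi.comp (by fun_prop)).aestronglyMeasurable
    · rw [Real.norm_eq_abs, abs_le]
      exact ⟨neg_log_two_le_psi _, psi_le_log_two _⟩
  have J := convexOn_psi_add_sq.map_integral_le (μ := gaussianReal 0 v)
    (f := fun u => e * ((m + u) ^ 2 - v - l))
    (by have := continuous_psi; fun_prop) isClosed_univ (by simp) i1 (i3.add i2)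
  rw [integral_add i3 i2, e1, e2] at J
  linarith

/-- The chord of the logarithm between `1` and `19 / 4`: its slope is at least `2 / 5`, since
`log (19 / 4) ≥ 3 / 2`. -/
theorem log_one_add_ge {s : ℝ} (h0 : 0 ≤ s) (h1 : s ≤ 15 / 4) : 2 / 5 * s ≤ Real.log (1 + s) := by
  have hcv : ConcaveOn ℝ (Set.Ioi 0) Real.log := strictConcaveOn_log_Ioi.concaveOn
  have h := hcv.2 (Set.mem_Ioi.2 one_pos)
    (Set.mem_Ioi.2 (by norm_num : (0 : ℝ) < 19 / 4)) (by linarith : 0 ≤ 1 - 4 * s / 15)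
    (by positivity : 0 ≤ 4 * s / 15) (by ring)
  simp only [smul_eq_mul, Real.log_one, mul_zero, zero_add] at h
  have e : (1 - 4 * s / 15) * 1 + 4 * s / 15 * (19 / 4) = 1 + s := by ring
  rw [e] at h
  have h2 : (3 / 2 : ℝ) ≤ Real.log (19 / 4) := by
    rw [Real.le_log_iff_exp_le (by norm_num)]
    have h3 : Real.exp (3 / 2) ^ 2 ≤ (19 / 4 : ℝ) ^ 2 := by
      rw [← Real.exp_nat_mul]
      have : Real.exp ((2 : ℕ) * (3 / 2)) = Real.exp 1 ^ 3 := by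
        rw [← Real.exp_nat_mul]; norm_num
      rw [this]
      refine (pow_le_pow_left₀ (Real.exp_pos 1).le Real.exp_one_lt_d9.le 3).trans ?_
      norm_num
    exact le_of_sq_le_sq h3 (by norm_num)
  nlinarith

/-- The comparison that makes the non-convex function `ψ` accessible to exponential moments: the
value of `ψ` at `± (m² - l)` is at most the average, under a Gaussian perturbation of `m`, of the
logarithm of a polynomial. When `v m² + v² / 2` is large, the last term of `perturb` alone exceeds
the bound `log 2` of `ψ`; when it is small, this term compensates for the lack of convexity of
`ψ`. -/
theorem psi_le_integral_log_perturb {e : ℝ} (he : e = 1 ∨ e = -1) (l m : ℝ) (v : ℝ≥0) :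
    psi (e * (m ^ 2 - l)) ≤
      ∫ u, Real.log (1 + perturb e l v (m + u)) ∂gaussianReal 0 v := by
  have hc := forty_le_cConst
  have hi := integrable_log_one_add (integrable_perturb e l m v)
    (fun u => neg_half_le_perturb he v.2)
  have hv : (0 : ℝ) ≤ v := v.2
  set c := cConst with hcdef
  set B : ℝ → ℝ := fun w => c * (v * (w ^ 2 + v / 2)) with hB
  have hB0 : ∀ w, 0 ≤ B w := fun w => by simp only [hB]; positivity
  set t : ℝ := v * (m ^ 2 + v / 2) with ht
  have ht0 : 0 ≤ t := by positivity
  have hA : ∀ w, 0 < 1 + e * (w ^ 2 - v - l) + (e * (w ^ 2 - v - l)) ^ 2 / 2 :=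
    fun w => one_add_add_sq_half_pos _
  have he2 : e ^ 2 = 1 := by rcases he with rfl | rfl <;> norm_num
  have hsplit : ∀ w, 1 + perturb e l v w =
      (1 + e * (w ^ 2 - v - l) + (e * (w ^ 2 - v - l)) ^ 2 / 2) + B w := fun w => by
    rw [mul_pow, he2]; simp only [perturb, hB]; ring
  -- of two symmetric perturbations of `m`, one is at least as large as `m`
  have hpair : ∀ u, c * t ≤ B (m + u) ∨ c * t ≤ B (m - u) := by
    intro u
    rcases le_total 0 (m * u) with h | h
    · left
      simp only [hB, ht]
      have : m ^ 2 ≤ (m + u) ^ 2 := by nlinarith [sq_nonneg u]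
      gcongr
    · right
      simp only [hB, ht]
      have : m ^ 2 ≤ (m - u) ^ 2 := by nlinarith [sq_nonneg u]
      gcongr
  -- `15 / 2` is the value of `B` for which `(1 / 2) * (1 / 2 + B)` is `4 = exp (2 log 2)`
  rcases le_total (15 / 2) (c * t) with hct | hct
  · refine (psi_le_log_two _).trans ?_
    refine le_integral_gaussianReal_of_pairs hi fun u => ?_
    have h1 : ∀ w, 1 / 2 + B w ≤ 1 + perturb e l v w := fun w => by
      rw [hsplit]
      nlinarith [sq_nonneg (e * (w ^ 2 - v - l) + 1)]
    have g1 := h1 (m + u)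
    have g2 := h1 (m + -u)
    have b1 := hB0 (m + u)
    have b2 := hB0 (m + -u)
    rw [← Real.log_mul (by linarith) (by linarith), ← Real.log_rpow (by norm_num)]
    refine Real.log_le_log (by positivity) ?_
    have : (1 / 2 + B (m + u)) * (1 / 2 + B (m + -u)) ≤
        (1 + perturb e l v (m + u)) * (1 + perturb e l v (m + -u)) :=
      mul_le_mul g1 g2 (by linarith) (by linarith)
    refine le_trans ?_ this
    norm_num
    have := hpair u
    rw [sub_eq_add_neg] at this
    rcases this with h | h <;> nlinarith
  · have hBi : Integrable (fun u => B (m + u) / 2) (gaussianReal 0 v) := by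
      refine (integrable_quartic_gaussianReal v (c * (v * (m ^ 2 + v / 2)) / 2) (c * v * m)
        (c * v / 2) 0 0).congr (Filter.Eventually.of_forall fun u => ?_)
      simp only [hB]; ring
    have hLi := integrable_log_one_add hBi (fun u => by have := hB0 (m + u); linarith)
    have i3 : Integrable (fun u => psi (e * ((m + u) ^ 2 - v - l))) (gaussianReal 0 v) := by
      refine Integrable.of_bound (C := Real.log 2) ?_ (Filter.Eventually.of_forall fun u => ?_)
      · exact (continuous_psi.comp (by fun_prop)).aestronglyMeasurable
      · rw [Real.norm_eq_abs, abs_le]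
        exact ⟨neg_log_two_le_psi _, psi_le_log_two _⟩
    -- `exp ψ` is at most `2` and at most the polynomial in `w`, hence
    -- `exp ψ * (1 + B / 2) ≤ exp ψ + B` is at most the polynomial plus `B`
    have hlow : ∀ u, psi (e * ((m + u) ^ 2 - v - l)) + Real.log (1 + B (m + u) / 2) ≤
        Real.log (1 + perturb e l v (m + u)) := by
      intro u
      have b := hB0 (m + u)
      have hp := psi_le_log (e * ((m + u) ^ 2 - v - l))
      have hq := psi_le_log_two (e * ((m + u) ^ 2 - v - l))
      set p := psi (e * ((m + u) ^ 2 - v - l)) with hpdef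
      have e1 : Real.exp p ≤ 1 + e * ((m + u) ^ 2 - v - l) + (e * ((m + u) ^ 2 - v - l)) ^ 2 / 2 :=
        (Real.le_log_iff_exp_le (hA _)).1 hp
      have e2 : Real.exp p ≤ 2 := (Real.le_log_iff_exp_le two_pos).1 hq
      rw [Real.le_log_iff_exp_le (by rw [hsplit]; linarith [hA (m + u)]), Real.exp_add,
        Real.exp_log (by linarith), hsplit]
      nlinarith
    have hlog : 4 * t ≤ ∫ u, Real.log (1 + B (m + u) / 2) ∂gaussianReal 0 v := by
      refine le_integral_gaussianReal_of_pairs hLi fun u => ?_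
      have b1 := hB0 (m + u)
      have b2 := hB0 (m + -u)
      have h0 := log_one_add_ge (s := c * t / 2) (by positivity) (by linarith)
      have h1 : 8 * t ≤ 2 / 5 * (c * t / 2) := by nlinarith
      have n1 : 0 ≤ Real.log (1 + B (m + u) / 2) := Real.log_nonneg (by linarith)
      have n2 : 0 ≤ Real.log (1 + B (m + -u) / 2) := Real.log_nonneg (by linarith)
      have hct0 : 0 ≤ c * t := by positivity
      have := hpair u
      rw [sub_eq_add_neg] at this
      rcases this with h | h
      · have := Real.log_le_log (by linarith) (by linarith : 1 + c * t / 2 ≤ 1 + B (m + u) / 2)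
        linarith
      · have := Real.log_le_log (by linarith) (by linarith : 1 + c * t / 2 ≤ 1 + B (m + -u) / 2)
        linarith
    have hint := integral_mono (i3.add hLi) hi hlow
    rw [show (∫ u, ((fun u => psi (e * ((m + u) ^ 2 - v - l))) + fun u =>
      Real.log (1 + B (m + u) / 2)) u ∂gaussianReal 0 v) = _ from integral_add i3 hLi] at hint
    have hJ := psi_sub_le_integral_psi he l m v
    have : 4 * t = 4 * v * m ^ 2 + 2 * v ^ 2 := by rw [ht]; ring
    linarith

/-! ### Shifting the standard Gaussian law -/

section Gaussian

variable {E : Type*} [NormedAddCommGroup E] [InnerProductSpace ℝ E] [FiniteDimensional ℝ E]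
  [MeasurableSpace E] [BorelSpace E]

theorem integral_exp_neg_half_sq_norm_pos : 0 < ∫ v : E, Real.exp (-(1 / 2) * ‖v‖ ^ 2) := by
  rw [GaussianFourier.integral_rexp_neg_mul_sq_norm (by norm_num)]
  positivity

variable (E) in
/-- The normalizing constant of the standard Gaussian density. -/
def gaussConst : ℝ := (∫ v : E, Real.exp (-(1 / 2) * ‖v‖ ^ 2))⁻¹

theorem gaussConst_pos : 0 < gaussConst E := inv_pos.2 integral_exp_neg_half_sq_norm_pos

theorem integrable_exp_neg_half_sq_norm :
    Integrable (fun v : E => Real.exp (-(1 / 2) * ‖v‖ ^ 2)) := by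
  by_contra h
  exact integral_exp_neg_half_sq_norm_pos.ne' (integral_undef h)

theorem measurable_gauss_density : Measurable
    (fun v : E => ENNReal.ofReal (gaussConst E * Real.exp (-(1 / 2) * ‖v‖ ^ 2))) := by
  fun_prop

/-- The two laws have the same characteristic function. -/
theorem stdGaussian_eq_withDensity : stdGaussian E = (volume : Measure E).withDensity
    (fun v => ENNReal.ofReal (gaussConst E * Real.exp (-(1 / 2) * ‖v‖ ^ 2))) := by
  have hfin : IsFiniteMeasure ((volume : Measure E).withDensity
      (fun v => ENNReal.ofReal (gaussConst E * Real.exp (-(1 / 2) * ‖v‖ ^ 2)))) :=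
    isFiniteMeasure_withDensity_ofReal (integrable_exp_neg_half_sq_norm.const_mul _).2
  refine Measure.ext_of_charFun (E := E) ?_
  ext t
  have hA : (gaussConst E : ℂ) *
      ((Real.pi : ℂ) / (1 / 2 : ℂ)) ^ (Module.finrank ℝ E / 2 : ℂ) = 1 := by
    rw [← GaussianFourier.integral_cexp_neg_mul_sq_norm (V := E) (b := 1 / 2) (by norm_num)]
    have h1 : ∫ v : E, Complex.exp (-(1 / 2 : ℂ) * ‖v‖ ^ 2) =
        ((∫ v : E, Real.exp (-(1 / 2) * ‖v‖ ^ 2) : ℝ) : ℂ) := by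
      rw [← integral_complex_ofReal]
      congr 1
      ext v
      push_cast
      rfl
    rw [h1, gaussConst, ← Complex.ofReal_mul,
      inv_mul_cancel₀ (integral_exp_neg_half_sq_norm_pos (E := E)).ne', Complex.ofReal_one]
  rw [charFun_stdGaussian, charFun_apply, integral_withDensity_eq_integral_toReal_smul
    measurable_gauss_density (Filter.Eventually.of_forall fun _ => ENNReal.ofReal_lt_top)]
  have h2 : ∀ v : E, (ENNReal.ofReal (gaussConst E * Real.exp (-(1 / 2) * ‖v‖ ^ 2))).toReal •
      Complex.exp (inner ℝ v t * Complex.I) = (gaussConst E : ℂ) *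
        Complex.exp (-(1 / 2 : ℂ) * ‖v‖ ^ 2 + Complex.I * inner ℝ t v) := by
    intro v
    rw [ENNReal.toReal_ofReal (mul_nonneg gaussConst_pos.le (Real.exp_pos _).le),
      Complex.real_smul, Complex.exp_add, real_inner_comm]
    push_cast
    ring_nf
  simp_rw [h2]
  rw [integral_const_mul, GaussianFourier.integral_cexp_neg_mul_sq_norm_add (by norm_num),
    ← mul_assoc, hA, one_mul]
  congr 1
  rw [Complex.I_sq]
  ring

/-- The Cameron–Martin formula for the standard Gaussian law. -/
theorem lintegral_stdGaussian_eq_shift {F : E → ℝ≥0∞} (hF : Measurable F) (h : E) :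
    ∫⁻ w, F w ∂stdGaussian E = ∫⁻ w, F (w + h) *
      ENNReal.ofReal (Real.exp (-inner ℝ h w - ‖h‖ ^ 2 / 2)) ∂stdGaussian E := by
  have hF' : Measurable fun w => F (w + h) := by fun_prop
  rw [stdGaussian_eq_withDensity, lintegral_withDensity_eq_lintegral_mul _
    measurable_gauss_density hF, lintegral_withDensity_eq_lintegral_mul _
    measurable_gauss_density (g := fun w => F (w + h) *
      ENNReal.ofReal (Real.exp (-inner ℝ h w - ‖h‖ ^ 2 / 2))) (hF'.mul (by fun_prop)),
    ← lintegral_add_right_eq_self _ h]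
  congr 1
  ext w
  simp only [Pi.mul_apply]
  rw [mul_comm (F (w + h)), ← mul_assoc, ← ENNReal.ofReal_mul
    (mul_nonneg gaussConst_pos.le (Real.exp_pos _).le), mul_assoc (gaussConst E), ← Real.exp_add,
    norm_add_sq_real, real_inner_comm]
  congr 5
  ring

theorem integrable_norm_pow_stdGaussian (k : ℕ) :
    Integrable (fun w => ‖w‖ ^ k) (stdGaussian E) := by
  rcases Nat.eq_zero_or_pos k with rfl | hk
  · simp
  exact (IsGaussian.memLp_id (stdGaussian E) k (by simp)).integrable_norm_pow hk.ne'

theorem map_inner_stdGaussian (x : E) :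
    (stdGaussian E).map (fun w => inner ℝ w x) = gaussianReal 0 (‖x‖₊ ^ 2) := by
  have h := IsGaussian.map_eq_gaussianReal (μ := stdGaussian E) (innerSL ℝ x)
  rw [integral_strongDual_stdGaussian, variance_dual_stdGaussian, innerSL_apply_norm] at h
  have e : (fun w : E => inner ℝ w x) = innerSL ℝ x := by
    ext w; simp [real_inner_comm]
  rw [e, h]
  congr 1
  ext
  simp

theorem ofReal_integral_le_lintegral {α : Type*} [MeasurableSpace α] {μ : Measure α} {f : α → ℝ}
    (hf : Integrable f μ) : ENNReal.ofReal (∫ x, f x ∂μ) ≤ ∫⁻ x, ENNReal.ofReal (f x) ∂μ := by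
  rw [integral_eq_lintegral_pos_part_sub_lintegral_neg_part hf]
  exact (ENNReal.ofReal_le_ofReal (sub_le_self _ ENNReal.toReal_nonneg)).trans
    ENNReal.ofReal_toReal_le

/-- The PAC-Bayesian inequality, for Gaussian priors and posteriors: an exponential moment under the
prior controls the expectation under every translate of the prior. -/
theorem integral_shift_le_of_lintegral_exp_le {f : E → ℝ} (hf : Measurable f) {h : E} {C : ℝ}
    (hfi : Integrable (fun w => f (w + h)) (stdGaussian E)) (hC : 0 < C)
    (hexp : ∫⁻ w, ENNReal.ofReal (Real.exp (f w)) ∂stdGaussian E ≤ ENNReal.ofReal C) :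
    ∫ w, f (w + h) ∂stdGaussian E ≤ ‖h‖ ^ 2 / 2 + Real.log C := by
  have hin : Integrable (fun w => inner ℝ h w) (stdGaussian E) :=
    (innerSL ℝ h).integrable_comp IsGaussian.integrable_id
  have hin0 : ∫ w, inner ℝ h w ∂stdGaussian E = 0 := by
    simpa using integral_strongDual_stdGaussian (innerSL ℝ h)
  have hgi : Integrable (fun w => f (w + h) - inner ℝ h w - ‖h‖ ^ 2 / 2) (stdGaussian E) :=
    (hfi.sub hin).sub (integrable_const _)
  set M := ∫ w, (f (w + h) - inner ℝ h w - ‖h‖ ^ 2 / 2) ∂stdGaussian E with hM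
  have hMval : M = ∫ w, f (w + h) ∂stdGaussian E - ‖h‖ ^ 2 / 2 := by
    rw [hM, integral_sub (f := fun w => f (w + h) - inner ℝ h w) (hfi.sub hin) (integrable_const _),
      integral_sub hfi hin, hin0]
    simp
  rw [lintegral_stdGaussian_eq_shift (by fun_prop) h] at hexp
  -- Jensen's inequality, through the tangent to the exponential at `M`
  have hle : ENNReal.ofReal (Real.exp M) ≤ ENNReal.ofReal C := by
    refine le_trans ?_ hexp
    have hti : Integrable (fun w => Real.exp M *
        (1 + ((f (w + h) - inner ℝ h w - ‖h‖ ^ 2 / 2) - M))) (stdGaussian E) :=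
      ((integrable_const 1).add (hgi.sub (integrable_const M))).const_mul _
    have ht : ∫ w, Real.exp M * (1 + ((f (w + h) - inner ℝ h w - ‖h‖ ^ 2 / 2) - M))
        ∂stdGaussian E = Real.exp M := by
      rw [integral_const_mul, integral_add (g := fun w => f (w + h) - inner ℝ h w - ‖h‖ ^ 2 / 2 - M)
        (integrable_const 1) (hgi.sub (integrable_const M)),
        integral_sub hgi (integrable_const M), ← hM]
      simp
    rw [← ht]
    refine (ofReal_integral_le_lintegral hti).trans (lintegral_mono fun w => ?_)
    rw [← ENNReal.ofReal_mul (Real.exp_pos _).le, ← Real.exp_add]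
    refine ENNReal.ofReal_le_ofReal ?_
    have := Real.add_one_le_exp ((f (w + h) - inner ℝ h w - ‖h‖ ^ 2 / 2) - M)
    have h2 := mul_le_mul_of_nonneg_left this (Real.exp_pos M).le
    rw [← Real.exp_add] at h2
    refine le_trans (le_of_eq ?_) (h2.trans (le_of_eq ?_))
    · ring
    · congr 1; ring
  have := (ENNReal.ofReal_le_ofReal_iff hC.le).1 hle
  have := (Real.le_log_iff_exp_le hC).2 this
  linarith

end Gaussian

/-! ### Exponential moments of the sample -/

section Sample

theorem abs_perturb_le {e l v w M : ℝ} (he : e = 1 ∨ e = -1) (h1 : 1 ≤ M) (hl : |l| ≤ M)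
    (hv0 : 0 ≤ v) (hv : v ≤ M) (hw : w ^ 2 ≤ M) :
    |perturb e l v w| ≤ (8 + 2 * cConst) * M ^ 2 := by
  have hc := forty_le_cConst
  have hw0 := sq_nonneg w
  have hMM : M ≤ M ^ 2 := by nlinarith
  unfold perturb
  set q := w ^ 2 - v - l with hqdef
  have hq : |q| ≤ 2 * M := by
    have := abs_le.1 hl
    rw [abs_le]
    constructor <;> linarith
  have hq2 : q ^ 2 ≤ (2 * M) ^ 2 := by
    rw [← sq_abs]; exact pow_le_pow_left₀ (abs_nonneg _) hq 2
  have he' : |e * q| ≤ 2 * M := by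
    rcases he with rfl | rfl
    · simpa using hq
    · simpa using hq
  have hB : v * (w ^ 2 + v / 2) ≤ 3 / 2 * M ^ 2 := by
    have e1 := mul_le_mul hv hw hw0 (by linarith)
    have e2 := mul_le_mul hv hv hv0 (by linarith)
    linarith
  have hB0 : 0 ≤ v * (w ^ 2 + v / 2) := by positivity
  have hcB : cConst * (v * (w ^ 2 + v / 2)) ≤ cConst * (3 / 2 * M ^ 2) :=
    mul_le_mul_of_nonneg_left hB (by linarith)
  have hcB0 : 0 ≤ cConst * (v * (w ^ 2 + v / 2)) := mul_nonneg (by linarith) hB0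
  have he'' := abs_le.1 he'
  have hcM : 0 ≤ cConst * M ^ 2 := by positivity
  have hq0 := sq_nonneg q
  rw [abs_le]
  constructor <;> linarith

variable {E : Type*} [NormedAddCommGroup E] [InnerProductSpace ℝ E]

/-- The bound `perturb` for the observation `y`, when `θ` is a Gaussian perturbation of covariance
`r²` times the identity, so that `⟨θ, y⟩` has variance `r² ‖y‖²`. -/
def perturbAt (e l r : ℝ) (y θ : E) : ℝ := perturb e l (r ^ 2 * ‖y‖ ^ 2) (inner ℝ θ y)

theorem neg_half_le_perturbAt {e l r : ℝ} (he : e = 1 ∨ e = -1) (y θ : E) :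
    -(1 / 2) ≤ perturbAt e l r y θ := neg_half_le_perturb he (by positivity)

theorem coe_nnnorm_smul_sq (r : ℝ) (y : E) :
    ((‖r • y‖₊ ^ 2 : ℝ≥0) : ℝ) = r ^ 2 * ‖y‖ ^ 2 := by
  simp [norm_smul, mul_pow]

/-- A crude bound, in which the variables are separated, used for integrability only. -/
theorem abs_perturbAt_le {e : ℝ} (he : e = 1 ∨ e = -1) (l r : ℝ) (y θ : E) :
    |perturbAt e l r y θ| ≤ (8 + 2 * cConst) * ((1 + r ^ 2) * (1 + |l|)) ^ 2 *
      ((1 + ‖y‖ ^ 2) ^ 2 * (1 + ‖θ‖ ^ 2) ^ 2) := by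
  have hrl : 1 ≤ (1 + r ^ 2) * (1 + |l|) := by nlinarith [sq_nonneg r, abs_nonneg l]
  have hyt : 1 ≤ (1 + ‖y‖ ^ 2) * (1 + ‖θ‖ ^ 2) := by nlinarith [sq_nonneg ‖y‖, sq_nonneg ‖θ‖]
  have h1 : 1 ≤ (1 + r ^ 2) * (1 + |l|) * ((1 + ‖y‖ ^ 2) * (1 + ‖θ‖ ^ 2)) := by nlinarith
  have hl : |l| ≤ (1 + r ^ 2) * (1 + |l|) * ((1 + ‖y‖ ^ 2) * (1 + ‖θ‖ ^ 2)) := by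
    have : |l| ≤ (1 + r ^ 2) * (1 + |l|) := by nlinarith [sq_nonneg r, abs_nonneg l]
    nlinarith [abs_nonneg l]
  have hv : r ^ 2 * ‖y‖ ^ 2 ≤ (1 + r ^ 2) * (1 + |l|) * ((1 + ‖y‖ ^ 2) * (1 + ‖θ‖ ^ 2)) := by
    have a1 : r ^ 2 ≤ (1 + r ^ 2) * (1 + |l|) := by nlinarith [sq_nonneg r, abs_nonneg l]
    have a2 : ‖y‖ ^ 2 ≤ (1 + ‖y‖ ^ 2) * (1 + ‖θ‖ ^ 2) := by
      nlinarith [sq_nonneg ‖y‖, sq_nonneg ‖θ‖, mul_nonneg (sq_nonneg ‖y‖) (sq_nonneg ‖θ‖)]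
    exact mul_le_mul a1 a2 (sq_nonneg _) (by linarith)
  have hw : (inner ℝ θ y) ^ 2 ≤ (1 + r ^ 2) * (1 + |l|) * ((1 + ‖y‖ ^ 2) * (1 + ‖θ‖ ^ 2)) := by
    have a1 : (inner ℝ θ y) ^ 2 ≤ (‖θ‖ * ‖y‖) ^ 2 := by
      rw [← sq_abs]
      exact pow_le_pow_left₀ (abs_nonneg _) (abs_real_inner_le_norm θ y) 2
    have a2 : (‖θ‖ * ‖y‖) ^ 2 ≤ (1 + ‖y‖ ^ 2) * (1 + ‖θ‖ ^ 2) := by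
      nlinarith [sq_nonneg ‖y‖, sq_nonneg ‖θ‖]
    exact (a1.trans a2).trans (le_mul_of_one_le_left (by linarith) hrl)
  refine (abs_perturb_le he h1 hl (by positivity) hv hw).trans (le_of_eq ?_)
  ring

variable [FiniteDimensional ℝ E] [MeasurableSpace E] [BorelSpace E]

theorem measurable_perturbAt (e l r : ℝ) :
    Measurable (fun p : E × E => perturbAt e l r p.1 p.2) := by
  unfold perturbAt perturb
  fun_prop

theorem measurable_perturbAt_left (e l r : ℝ) (θ : E) :
    Measurable (fun y : E => perturbAt e l r y θ) := by
  unfold perturbAt perturb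
  fun_prop

theorem measurable_perturbAt_right (e l r : ℝ) (y : E) :
    Measurable (fun θ : E => perturbAt e l r y θ) := by
  unfold perturbAt perturb
  fun_prop

variable {P : Measure E} [IsProbabilityMeasure P]

theorem integrable_norm_sq_of_pow_four (hP : Integrable (fun x => ‖x‖ ^ 4) P) :
    Integrable (fun x => ‖x‖ ^ 2) P := by
  refine (hP.add (integrable_const 1)).mono (by fun_prop) (Filter.Eventually.of_forall fun x => ?_)
  simp only [Pi.add_apply, Real.norm_eq_abs]
  rw [abs_of_nonneg (by positivity), abs_of_nonneg (by positivity)]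
  nlinarith [sq_nonneg (‖x‖ ^ 2 - 1)]

theorem integrable_one_add_norm_sq_sq (hP : Integrable (fun x => ‖x‖ ^ 4) P) :
    Integrable (fun x => (1 + ‖x‖ ^ 2) ^ 2) P := by
  refine (((integrable_const 1).add ((integrable_norm_sq_of_pow_four hP).const_mul 2)).add hP).congr
    (Filter.Eventually.of_forall fun x => ?_)
  simp only [Pi.add_apply]
  ring

theorem integrable_one_add_norm_shift_sq_sq (θ : E) (r : ℝ) :
    Integrable (fun w => (1 + ‖θ + r • w‖ ^ 2) ^ 2) (stdGaussian E) := by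
  have h := (((integrable_const (1 : ℝ)).add
    ((integrable_norm_pow_stdGaussian (E := E) 2).const_mul 2)).add
    (integrable_norm_pow_stdGaussian (E := E) 4))
  refine (h.const_mul ((1 + 2 * ‖θ‖ ^ 2 + 2 * r ^ 2) ^ 2)).mono (by fun_prop)
    (Filter.Eventually.of_forall fun w => ?_)
  simp only [Pi.add_apply, Real.norm_eq_abs]
  rw [abs_of_nonneg (by positivity), abs_of_nonneg (by positivity)]
  have h1 : ‖θ + r • w‖ ≤ ‖θ‖ + |r| * ‖w‖ := by
    simpa [norm_smul] using norm_add_le θ (r • w)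
  have h2 : ‖θ + r • w‖ ^ 2 ≤ 2 * ‖θ‖ ^ 2 + 2 * (r ^ 2 * ‖w‖ ^ 2) := by
    have := pow_le_pow_left₀ (norm_nonneg _) h1 2
    rw [← sq_abs r]
    nlinarith [sq_nonneg (‖θ‖ - |r| * ‖w‖)]
  have h3 : 1 + ‖θ + r • w‖ ^ 2 ≤ (1 + 2 * ‖θ‖ ^ 2 + 2 * r ^ 2) * (1 + ‖w‖ ^ 2) := by
    nlinarith [sq_nonneg ‖θ‖, sq_nonneg ‖w‖, sq_nonneg r,
      mul_nonneg (sq_nonneg ‖θ‖) (sq_nonneg ‖w‖)]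
  have h4 := pow_le_pow_left₀ (by positivity) h3 2
  nlinarith

theorem integrable_perturbAt_left {e : ℝ} (he : e = 1 ∨ e = -1) (l r : ℝ)
    (hP : Integrable (fun x => ‖x‖ ^ 4) P) (θ : E) :
    Integrable (fun y => perturbAt e l r y θ) P := by
  refine Integrable.mono' (((integrable_one_add_norm_sq_sq hP).mul_const
    ((1 + ‖θ‖ ^ 2) ^ 2)).const_mul ((8 + 2 * cConst) * ((1 + r ^ 2) * (1 + |l|)) ^ 2))
    (measurable_perturbAt_left e l r θ).aestronglyMeasurable
    (Filter.Eventually.of_forall fun y => ?_)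
  exact abs_perturbAt_le he l r y θ

theorem integrable_perturbAt_right {e : ℝ} (he : e = 1 ∨ e = -1) (l r : ℝ) (y θ : E) :
    Integrable (fun w => perturbAt e l r y (θ + r • w)) (stdGaussian E) := by
  refine Integrable.mono' (((integrable_one_add_norm_shift_sq_sq θ r).const_mul
    ((1 + ‖y‖ ^ 2) ^ 2)).const_mul ((8 + 2 * cConst) * ((1 + r ^ 2) * (1 + |l|)) ^ 2))
    (Measurable.aestronglyMeasurable ?_) (Filter.Eventually.of_forall fun w => ?_)
  · have hm : Measurable fun w : E => θ + r • w := by fun_prop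
    have h := (measurable_perturbAt_right e l r y).comp hm
    exact h
  exact abs_perturbAt_le he l r y _

theorem integrable_perturbAt_prod {e : ℝ} (he : e = 1 ∨ e = -1) (l r : ℝ)
    (hP : Integrable (fun x => ‖x‖ ^ 4) P) (θ : E) :
    Integrable (fun p : E × E => perturbAt e l r p.1 (θ + r • p.2)) (P.prod (stdGaussian E)) := by
  refine Integrable.mono' (((integrable_one_add_norm_sq_sq hP).mul_prod
    (integrable_one_add_norm_shift_sq_sq θ r)).const_mul
    ((8 + 2 * cConst) * ((1 + r ^ 2) * (1 + |l|)) ^ 2))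
    (Measurable.aestronglyMeasurable ?_) (Filter.Eventually.of_forall fun p => ?_)
  · have hm : Measurable fun p : E × E => (p.1, θ + r • p.2) := by fun_prop
    have h := (measurable_perturbAt e l r).comp hm
    exact h
  exact abs_perturbAt_le he l r p.1 _

/-- The law of `⟨θ + r w, y⟩` for a standard Gaussian `w`. -/
theorem integral_stdGaussian_inner_shift {φ : ℝ → ℝ} (hφ : Measurable φ) (θ y : E) (r : ℝ) :
    ∫ w, φ (inner ℝ (θ + r • w) y) ∂stdGaussian E =
      ∫ u, φ (inner ℝ θ y + u) ∂gaussianReal 0 (‖r • y‖₊ ^ 2) := by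
  rw [← map_inner_stdGaussian, integral_map (f := fun u => φ (inner ℝ θ y + u))
    (by fun_prop) (hφ.comp (measurable_const_add _)).aestronglyMeasurable]
  simp only [inner_add_left, inner_smul_left, inner_smul_right, conj_trivial]

theorem measurable_perturb (e l v : ℝ) : Measurable (perturb e l v) := by
  unfold perturb; fun_prop

theorem integral_perturbAt_shift (e l r : ℝ) (y θ : E) :
    ∫ w, perturbAt e l r y (θ + r • w) ∂stdGaussian E =
      e * ((inner ℝ θ y) ^ 2 - l) + ((inner ℝ θ y) ^ 2 - l) ^ 2 / 2
        + (2 + cConst) * r ^ 2 * (‖y‖ ^ 2 * (inner ℝ θ y) ^ 2)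
        + (2 + 3 * cConst) / 2 * r ^ 4 * ‖y‖ ^ 4 := by
  unfold perturbAt
  rw [integral_stdGaussian_inner_shift (measurable_perturb _ _ _), ← coe_nnnorm_smul_sq,
    integral_perturb, coe_nnnorm_smul_sq]
  ring

theorem psi_le_integral_log_perturbAt {e : ℝ} (he : e = 1 ∨ e = -1) (l r : ℝ) (y θ : E) :
    psi (e * ((inner ℝ θ y) ^ 2 - l)) ≤
      ∫ w, Real.log (1 + perturbAt e l r y (θ + r • w)) ∂stdGaussian E := by
  unfold perturbAt
  rw [integral_stdGaussian_inner_shift (φ := fun t => Real.log (1 + perturb e l _ t))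
    (Real.measurable_log.comp ((measurable_perturb _ _ _).const_add 1)), ← coe_nnnorm_smul_sq]
  exact psi_le_integral_log_perturb he l _ _

/-- The logarithm of the normalized exponential moment of the sample `x` at the parameter `θ`. -/
def logLik (P : Measure E) (e l r : ℝ) {n : ℕ} (x : Fin n → E) (θ : E) : ℝ :=
  ∑ i, Real.log (1 + perturbAt e l r (x i) θ) - n * ∫ y, perturbAt e l r y θ ∂P

theorem measurable_integral_perturbAt (e l r : ℝ) :
    Measurable (fun θ : E => ∫ y, perturbAt e l r y θ ∂P) := by
  have h : StronglyMeasurable (fun p : E × E => perturbAt e l r p.2 p.1) :=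
    ((measurable_perturbAt e l r).comp measurable_swap).stronglyMeasurable
  exact h.integral_prod_right'.measurable

theorem measurable_logLik (e l r : ℝ) (n : ℕ) :
    Measurable (fun p : (Fin n → E) × E => logLik P e l r p.1 p.2) := by
  unfold logLik
  refine Measurable.sub (Finset.measurable_sum _ fun i _ => ?_)
    (((measurable_integral_perturbAt e l r).comp measurable_snd).const_mul _)
  have hm : Measurable fun p : (Fin n → E) × E => (p.1 i, p.2) := by fun_prop
  have h := (measurable_perturbAt e l r).comp hm
  exact (h.const_add 1).log

/-- By independence the exponential moment factorizes, and `(1 + H)^n ≤ exp (n H)`. -/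
theorem lintegral_exp_logLik_le_one {e : ℝ} (he : e = 1 ∨ e = -1) (l r : ℝ)
    (hP : Integrable (fun x => ‖x‖ ^ 4) P) (n : ℕ) (θ : E) :
    ∫⁻ x, ENNReal.ofReal (Real.exp (logLik P e l r x θ)) ∂Measure.pi (fun _ : Fin n => P) ≤ 1 := by
  have hi := integrable_perturbAt_left he l r hP θ
  set H := ∫ y, perturbAt e l r y θ ∂P with hH
  have hpos : ∀ y, 0 < 1 + perturbAt e l r y θ := fun y => by
    have := neg_half_le_perturbAt (l := l) (r := r) he y θ; linarith
  have hexp : ∀ x : Fin n → E, Real.exp (logLik P e l r x θ) =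
      (∏ i, (1 + perturbAt e l r (x i) θ)) * Real.exp (-(n * H)) := by
    intro x
    rw [logLik, sub_eq_add_neg, Real.exp_add, Real.exp_sum]
    simp_rw [Real.exp_log (hpos _)]
    rfl
  have hi1 : Integrable (fun y => 1 + perturbAt e l r y θ) P := (integrable_const 1).add hi
  have hip : Integrable (fun x : Fin n → E => (∏ i, (1 + perturbAt e l r (x i) θ)) *
      Real.exp (-(n * H))) (Measure.pi (fun _ : Fin n => P)) :=
    (Integrable.fintype_prod (f := fun _ : Fin n => fun y => 1 + perturbAt e l r y θ)
      fun _ => hi1).mul_const _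
  simp_rw [hexp]
  rw [← ofReal_integral_eq_lintegral_ofReal hip (Filter.Eventually.of_forall fun x =>
    mul_nonneg (Finset.prod_nonneg fun i _ => (hpos _).le) (Real.exp_pos _).le),
    integral_mul_const, integral_fintype_prod_eq_pow (fun y => 1 + perturbAt e l r y θ)]
  have h1 : ∫ y, (1 + perturbAt e l r y θ) ∂P = 1 + H := by
    rw [integral_add (integrable_const 1) hi]; simp [hH]
  have h0 : 0 ≤ 1 + H := by
    rw [← h1]; exact integral_nonneg fun y => (hpos y).le
  rw [h1, Fintype.card_fin, ← ENNReal.ofReal_one]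
  refine ENNReal.ofReal_le_ofReal ?_
  have h2 : (1 + H) ^ n ≤ Real.exp (n * H) := by
    rw [Real.exp_nat_mul]
    exact pow_le_pow_left₀ h0 (by linarith [Real.add_one_le_exp H]) n
  calc (1 + H) ^ n * Real.exp (-(n * H)) ≤ Real.exp (n * H) * Real.exp (-(n * H)) := by
        gcongr
    _ = 1 := by rw [← Real.exp_add]; simp

theorem integrable_logLik_shift {e : ℝ} (he : e = 1 ∨ e = -1) (l r : ℝ)
    (hP : Integrable (fun x => ‖x‖ ^ 4) P) {n : ℕ} (x : Fin n → E) (θ : E) :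
    Integrable (fun w => logLik P e l r x (θ + r • w)) (stdGaussian E) := by
  refine Integrable.sub (integrable_finsetSum _ fun i _ => ?_) ?_
  · exact integrable_log_one_add (integrable_perturbAt_right he l r (x i) θ)
      (fun w => neg_half_le_perturbAt he _ _)
  · exact (integrable_perturbAt_prod he l r hP θ).integral_prod_right.const_mul _

/-- The Gaussian average of `logLik` dominates the difference between the empirical criterion and
its theoretical bound. -/
theorem sum_psi_sub_le_integral_logLik {e : ℝ} (he : e = 1 ∨ e = -1) (l r : ℝ)
    (hP : Integrable (fun x => ‖x‖ ^ 4) P) {n : ℕ} (x : Fin n → E) (θ : E) :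
    ∑ i, psi (e * ((inner ℝ θ (x i)) ^ 2 - l)) - n * ∫ y, (e * ((inner ℝ θ y) ^ 2 - l)
        + ((inner ℝ θ y) ^ 2 - l) ^ 2 / 2 + (2 + cConst) * r ^ 2 * (‖y‖ ^ 2 * (inner ℝ θ y) ^ 2)
        + (2 + 3 * cConst) / 2 * r ^ 4 * ‖y‖ ^ 4) ∂P ≤
      ∫ w, logLik P e l r x (θ + r • w) ∂stdGaussian E := by
  have hp := integrable_perturbAt_prod he l r hP θ
  have hs : ∀ i, Integrable (fun w => Real.log (1 + perturbAt e l r (x i) (θ + r • w)))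
      (stdGaussian E) := fun i =>
    integrable_log_one_add (integrable_perturbAt_right he l r (x i) θ)
      (fun w => neg_half_le_perturbAt he _ _)
  unfold logLik
  rw [integral_sub (integrable_finsetSum _ fun i _ => hs i)
    (hp.integral_prod_right.const_mul _), integral_finsetSum _ fun i _ => hs i,
    integral_const_mul, ← integral_integral_swap (f := fun y w => perturbAt e l r y (θ + r • w)) hp]
  simp_rw [integral_perturbAt_shift]
  gcongr with i
  exact psi_le_integral_log_perturbAt he l r (x i) θ

/-- With high probability, the empirical criterion is close to its expectation, uniformly in `θ`. -/
theorem exists_good_samples {e : ℝ} (he : e = 1 ∨ e = -1) (l : ℝ) {r : ℝ} (hr : 0 < r)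
    (hP : Integrable (fun x => ‖x‖ ^ 4) P) (n : ℕ) {η : ℝ} (hη : 0 < η) :
    ∃ S : Set (Fin n → E), MeasurableSet S ∧
      Measure.pi (fun _ : Fin n => P) Sᶜ ≤ ENNReal.ofReal η ∧
      ∀ x ∈ S, ∀ θ : E, ∑ i, psi (e * ((inner ℝ θ (x i)) ^ 2 - l)) ≤
        n * ∫ y, (e * ((inner ℝ θ y) ^ 2 - l)
        + ((inner ℝ θ y) ^ 2 - l) ^ 2 / 2 + (2 + cConst) * r ^ 2 * (‖y‖ ^ 2 * (inner ℝ θ y) ^ 2)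
        + (2 + 3 * cConst) / 2 * r ^ 4 * ‖y‖ ^ 4) ∂P + ‖θ‖ ^ 2 / (2 * r ^ 2) + Real.log η⁻¹ := by
  set F : (Fin n → E) → ℝ≥0∞ := fun x =>
    ∫⁻ w, ENNReal.ofReal (Real.exp (logLik P e l r x (r • w))) ∂stdGaussian E with hF
  have hjm : Measurable (fun p : (Fin n → E) × E =>
      ENNReal.ofReal (Real.exp (logLik P e l r p.1 (r • p.2)))) := by
    have hpm : Measurable fun p : (Fin n → E) × E => (p.1, r • p.2) := by fun_prop
    have h1 := (measurable_logLik (P := P) e l r n).comp hpm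
    exact h1.exp.ennreal_ofReal
  have hFm : Measurable F := hjm.lintegral_prod_right'
  have hFint : ∫⁻ x, F x ∂Measure.pi (fun _ : Fin n => P) ≤ 1 := by
    rw [hF, lintegral_lintegral_swap hjm.aemeasurable]
    calc _ ≤ ∫⁻ w : E, 1 ∂stdGaussian E :=
          lintegral_mono fun w => lintegral_exp_logLik_le_one he l r hP n (r • w)
      _ = 1 := by simp
  refine ⟨{x | F x ≤ ENNReal.ofReal η⁻¹}, measurableSet_le hFm measurable_const, ?_, ?_⟩
  · have hsub : {x | F x ≤ ENNReal.ofReal η⁻¹}ᶜ ⊆ {x | ENNReal.ofReal η⁻¹ ≤ F x} := by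
      intro x hx
      exact (not_le.1 (show ¬F x ≤ ENNReal.ofReal η⁻¹ from hx)).le
    refine (measure_mono hsub).trans ((meas_ge_le_lintegral_div hFm.aemeasurable
      (by simpa using hη) ENNReal.ofReal_ne_top).trans ?_)
    rw [ENNReal.ofReal_inv_of_pos hη, ENNReal.div_eq_inv_mul, inv_inv]
    exact mul_le_of_le_one_right' hFint
  · intro x hx θ
    have hsm : ∀ w, r • (w + r⁻¹ • θ) = θ + r • w := fun w => by
      rw [smul_add, smul_inv_smul₀ hr.ne', add_comm]
    have hpm : Measurable fun w : E => ((x, r • w) : (Fin n → E) × E) := by fun_prop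
    have hfm := (measurable_logLik (P := P) e l r n).comp hpm
    have h := integral_shift_le_of_lintegral_exp_le (f := fun w => logLik P e l r x (r • w)) hfm
      (h := r⁻¹ • θ) (C := η⁻¹)
      (by simp_rw [hsm]; exact integrable_logLik_shift he l r hP x θ) (inv_pos.2 hη) hx
    simp_rw [hsm] at h
    have h2 := sum_psi_sub_le_integral_logLik he l r hP x θ
    have h3 : ‖r⁻¹ • θ‖ ^ 2 / 2 = ‖θ‖ ^ 2 / (2 * r ^ 2) := by
      rw [norm_smul, norm_inv, Real.norm_eq_abs, abs_of_pos hr]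
      field_simp
    linarith

end Sample

/-! ### Moments of the law of the observations -/

section Moments

variable {d : ℕ} {P : Measure (EuclideanSpace ℝ (Fin d))}

theorem inner_sq_le (θ y : EuclideanSpace ℝ (Fin d)) :
    (inner ℝ θ y) ^ 2 ≤ ‖θ‖ ^ 2 * ‖y‖ ^ 2 := by
  rw [← sq_abs, ← mul_pow]
  exact pow_le_pow_left₀ (abs_nonneg _) (abs_real_inner_le_norm θ y) 2

theorem integrable_inner_pow_four (hP : Integrable (fun x => ‖x‖ ^ 4) P)
    (θ : EuclideanSpace ℝ (Fin d)) : Integrable (fun y => (inner ℝ θ y) ^ 4) P := by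
  refine (hP.const_mul (‖θ‖ ^ 4)).mono' (by fun_prop) (Filter.Eventually.of_forall fun y => ?_)
  rw [Real.norm_eq_abs, abs_of_nonneg (by positivity)]
  have := pow_le_pow_left₀ (sq_nonneg _) (inner_sq_le θ y) 2
  nlinarith

theorem integrable_norm_sq_mul_inner_sq (hP : Integrable (fun x => ‖x‖ ^ 4) P)
    (θ : EuclideanSpace ℝ (Fin d)) : Integrable (fun y => ‖y‖ ^ 2 * (inner ℝ θ y) ^ 2) P := by
  refine (hP.const_mul (‖θ‖ ^ 2)).mono' (by fun_prop) (Filter.Eventually.of_forall fun y => ?_)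
  rw [Real.norm_eq_abs, abs_of_nonneg (by positivity)]
  have := mul_le_mul_of_nonneg_left (inner_sq_le θ y) (sq_nonneg ‖y‖)
  nlinarith

theorem secondMoment_nonneg (θ : EuclideanSpace ℝ (Fin d)) : 0 ≤ secondMoment P θ :=
  integral_nonneg fun _ => sq_nonneg _

theorem secondMoment_smul (α : ℝ) (θ : EuclideanSpace ℝ (Fin d)) :
    secondMoment P (α • θ) = α ^ 2 * secondMoment P θ := by
  simp only [secondMoment, inner_smul_left, conj_trivial, mul_pow]
  rw [integral_const_mul]

theorem s4sq_sq : s4sq P ^ 2 = ∫ x, ‖x‖ ^ 4 ∂P :=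
  Real.sq_sqrt (integral_nonneg fun _ => by positivity)

variable [IsProbabilityMeasure P]

theorem integrable_inner_sq (hP : Integrable (fun x => ‖x‖ ^ 4) P)
    (θ : EuclideanSpace ℝ (Fin d)) : Integrable (fun y => (inner ℝ θ y) ^ 2) P := by
  refine ((integrable_norm_sq_of_pow_four hP).const_mul (‖θ‖ ^ 2)).mono' (by fun_prop)
    (Filter.Eventually.of_forall fun y => ?_)
  rw [Real.norm_eq_abs, abs_of_nonneg (sq_nonneg _)]
  exact inner_sq_le θ y

theorem inner_sq_ae_eq_zero (hP : Integrable (fun x => ‖x‖ ^ 4) P)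
    {θ : EuclideanSpace ℝ (Fin d)} (h : secondMoment P θ = 0) :
    (fun y => (inner ℝ θ y) ^ 2) =ᵐ[P] 0 :=
  (integral_eq_zero_iff_of_nonneg (fun _ => sq_nonneg _) (integrable_inner_sq hP θ)).1 h

/-- The supremum defining `kurtosis P` is finite as soon as its value is positive: the supremum of
an unbounded set of reals is `0`. -/
theorem fourthMoment_le (hP : Integrable (fun x => ‖x‖ ^ 4) P) (hκ : 0 < kurtosis P)
    (θ : EuclideanSpace ℝ (Fin d)) :
    fourthMoment P θ ≤ kurtosis P * secondMoment P θ ^ 2 := by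
  rcases (secondMoment_nonneg (P := P) θ).eq_or_lt with h | h
  · have h0 : fourthMoment P θ = 0 := by
      refine integral_eq_zero_of_ae ?_
      filter_upwards [inner_sq_ae_eq_zero hP h.symm] with y hy
      have hy' : (inner ℝ θ y) ^ 2 = 0 := hy
      simp only [Pi.zero_apply]
      rw [show (inner ℝ θ y) ^ 4 = ((inner ℝ θ y) ^ 2) ^ 2 by ring, hy']
      ring
    rw [h0, ← h]
    simp
  · have hb : BddAbove {k : ℝ | ∃ θ : EuclideanSpace ℝ (Fin d), 0 < secondMoment P θ ∧
        k = fourthMoment P θ / secondMoment P θ ^ 2} := by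
      by_contra hb
      exact hκ.ne' (Real.sSup_of_not_bddAbove hb)
    have := le_csSup hb ⟨θ, h, rfl⟩
    rwa [div_le_iff₀ (by positivity)] at this

/-- The Cauchy–Schwarz inequality for `‖X‖²` and `⟨θ, X⟩²`. -/
theorem integral_norm_sq_mul_inner_sq_le (hP : Integrable (fun x => ‖x‖ ^ 4) P)
    (hκ : 0 < kurtosis P) (hs : 0 < s4sq P) (θ : EuclideanSpace ℝ (Fin d)) :
    ∫ y, ‖y‖ ^ 2 * (inner ℝ θ y) ^ 2 ∂P ≤
      Real.sqrt (kurtosis P) * secondMoment P θ * s4sq P := by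
  rcases (secondMoment_nonneg (P := P) θ).eq_or_lt with h | h
  · rw [← h, mul_zero, zero_mul]
    refine (integral_eq_zero_of_ae ?_).le
    filter_upwards [inner_sq_ae_eq_zero hP h.symm] with y hy
    have hy' : (inner ℝ θ y) ^ 2 = 0 := hy
    simp [hy']
  · -- weighted arithmetic–geometric inequality, with the optimal weight
    set N := secondMoment P θ
    set k := Real.sqrt (kurtosis P) with hk
    set s := s4sq P
    have hk0 : 0 < k := Real.sqrt_pos.2 hκ
    have hk2 : k ^ 2 = kurtosis P := Real.sq_sqrt hκ.le
    set q := s / (k * N) with hq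
    have hq0 : 0 < q := by positivity
    have hi : Integrable (fun y => q / 2 * (inner ℝ θ y) ^ 4 + q⁻¹ / 2 * ‖y‖ ^ 4) P :=
      ((integrable_inner_pow_four hP θ).const_mul _).add (hP.const_mul _)
    have h1 := integral_mono (integrable_norm_sq_mul_inner_sq hP θ) hi (fun y => by
      have := sq_nonneg (q * (inner ℝ θ y) ^ 2 - ‖y‖ ^ 2)
      have h2 : ‖y‖ ^ 2 * (inner ℝ θ y) ^ 2 = q⁻¹ / 2 *
        (2 * (q * (inner ℝ θ y) ^ 2) * ‖y‖ ^ 2) := by field_simp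
      have h3 : q / 2 * (inner ℝ θ y) ^ 4 + q⁻¹ / 2 * ‖y‖ ^ 4 = q⁻¹ / 2 *
        ((q * (inner ℝ θ y) ^ 2) ^ 2 + (‖y‖ ^ 2) ^ 2) := by field_simp
      show ‖y‖ ^ 2 * (inner ℝ θ y) ^ 2 ≤ q / 2 * (inner ℝ θ y) ^ 4 + q⁻¹ / 2 * ‖y‖ ^ 4
      rw [h2, h3]
      exact mul_le_mul_of_nonneg_left (by linarith) (by positivity))
    rw [integral_add ((integrable_inner_pow_four hP θ).const_mul _) (hP.const_mul _),
      integral_const_mul, integral_const_mul, ← s4sq_sq] at h1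
    have h4 := mul_le_mul_of_nonneg_left (fourthMoment_le hP hκ θ) (by positivity : 0 ≤ q / 2)
    rw [← hk2] at h4
    refine h1.trans ((add_le_add_left h4 _).trans (le_of_eq ?_))
    rw [hq]
    field_simp
    ring

theorem secondMoment_le (hP : Integrable (fun x => ‖x‖ ^ 4) P)
    (θ : EuclideanSpace ℝ (Fin d)) (hθ : ‖θ‖ = 1) : secondMoment P θ ≤ s4sq P := by
  have h2 := integrable_norm_sq_of_pow_four hP
  have h1 : secondMoment P θ ≤ ∫ y, ‖y‖ ^ 2 ∂P := by
    refine integral_mono (integrable_inner_sq hP θ) h2 fun y => ?_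
    simpa [hθ] using inner_sq_le θ y
  set m := ∫ y, ‖y‖ ^ 2 ∂P with hm
  refine h1.trans (Real.le_sqrt_of_sq_le ?_)
  have hi : Integrable (fun y => 2 * m * ‖y‖ ^ 2 - m ^ 2) P :=
    (h2.const_mul _).sub (integrable_const _)
  have := integral_mono hi hP fun y => by
    show 2 * m * ‖y‖ ^ 2 - m ^ 2 ≤ ‖y‖ ^ 4
    nlinarith [sq_nonneg (‖y‖ ^ 2 - m)]
  rw [integral_sub (h2.const_mul _) (integrable_const _), integral_const_mul, ← hm] at this
  simp at this
  nlinarith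

theorem quadForm_gram (hP : Integrable (fun x => ‖x‖ ^ 4) P) (θ : EuclideanSpace ℝ (Fin d)) :
    quadForm (gram P) θ = secondMoment P θ := by
  have hi : ∀ j k : Fin d, Integrable (fun x : EuclideanSpace ℝ (Fin d) => x j * x k) P := by
    intro j k
    refine (integrable_norm_sq_of_pow_four hP).mono' (by fun_prop)
      (Filter.Eventually.of_forall fun x => ?_)
    rw [norm_mul, sq]
    exact mul_le_mul (PiLp.norm_apply_le x j) (PiLp.norm_apply_le x k) (norm_nonneg _)
      (norm_nonneg _)
  unfold quadForm secondMoment gram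
  have e : ∀ x : EuclideanSpace ℝ (Fin d), (inner ℝ θ x) ^ 2 =
      ∑ j, ∑ k, θ j * θ k * (x j * x k) := by
    intro x
    simp only [PiLp.inner_apply, RCLike.inner_apply, conj_trivial, sq, Finset.sum_mul_sum]
    refine Finset.sum_congr rfl fun j _ => Finset.sum_congr rfl fun k _ => ?_
    ring
  simp_rw [e]
  rw [integral_finsetSum _ fun j _ => integrable_finsetSum _ fun k _ => (hi j k).const_mul _]
  refine Finset.sum_congr rfl fun j _ => ?_
  rw [integral_finsetSum _ fun k _ => (hi j k).const_mul _]
  refine Finset.sum_congr rfl fun k _ => ?_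
  rw [integral_const_mul]
  simp only [Matrix.of_apply]
  ring

/-! ### Deviations of the empirical criterion -/

/-- The bound for the deviations of the empirical criterion `r_l(θ)` from `N(θ) - l`, where `β` is
the inverse variance of the perturbation and `b` the logarithm of the inverse probability of
failure. -/
def critDev (P : Measure (EuclideanSpace ℝ (Fin d))) (n : ℕ) (l β b : ℝ)
    (θ : EuclideanSpace ℝ (Fin d)) : ℝ :=
  ((kurtosis P - 1) * secondMoment P θ ^ 2 + (secondMoment P θ - l) ^ 2) / 2
    + (2 + cConst) * Real.sqrt (kurtosis P) * s4sq P * secondMoment P θ / β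
    + (2 + 3 * cConst) * s4sq P ^ 2 / (2 * β ^ 2) + β * ‖θ‖ ^ 2 / (2 * n) + b / n

theorem integral_criterion_bound_le (hP : Integrable (fun x => ‖x‖ ^ 4) P)
    (hκ : 0 < kurtosis P) (hs : 0 < s4sq P) (e l r : ℝ) (θ : EuclideanSpace ℝ (Fin d)) :
    ∫ y, (e * ((inner ℝ θ y) ^ 2 - l)
        + ((inner ℝ θ y) ^ 2 - l) ^ 2 / 2 + (2 + cConst) * r ^ 2 * (‖y‖ ^ 2 * (inner ℝ θ y) ^ 2)
        + (2 + 3 * cConst) / 2 * r ^ 4 * ‖y‖ ^ 4) ∂P ≤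
      e * (secondMoment P θ - l) +
      ((kurtosis P - 1) * secondMoment P θ ^ 2 + (secondMoment P θ - l) ^ 2) / 2
        + (2 + cConst) * r ^ 2 * (Real.sqrt (kurtosis P) * secondMoment P θ * s4sq P)
        + (2 + 3 * cConst) / 2 * r ^ 4 * s4sq P ^ 2 := by
  have hc := forty_le_cConst
  have i2 := (integrable_inner_sq hP θ).const_mul (e - l)
  have i4 := (integrable_inner_pow_four hP θ).const_mul (1 / 2)
  have i22 := (integrable_norm_sq_mul_inner_sq hP θ).const_mul ((2 + cConst) * r ^ 2)
  have iP := hP.const_mul ((2 + 3 * cConst) / 2 * r ^ 4)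
  have ic : Integrable (fun _ : EuclideanSpace ℝ (Fin d) => l ^ 2 / 2 - e * l) P :=
    integrable_const _
  have e1 : ∀ y : EuclideanSpace ℝ (Fin d), e * ((inner ℝ θ y) ^ 2 - l)
        + ((inner ℝ θ y) ^ 2 - l) ^ 2 / 2 + (2 + cConst) * r ^ 2 * (‖y‖ ^ 2 * (inner ℝ θ y) ^ 2)
        + (2 + 3 * cConst) / 2 * r ^ 4 * ‖y‖ ^ 4 =
      (l ^ 2 / 2 - e * l) + (e - l) * (inner ℝ θ y) ^ 2 + 1 / 2 * (inner ℝ θ y) ^ 4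
        + (2 + cConst) * r ^ 2 * (‖y‖ ^ 2 * (inner ℝ θ y) ^ 2)
        + (2 + 3 * cConst) / 2 * r ^ 4 * ‖y‖ ^ 4 := fun y => by ring
  simp_rw [e1]
  have hsplit := integral_add' (((ic.add i2).add i4).add i22) iP
  rw [integral_add' ((ic.add i2).add i4) i22, integral_add' (ic.add i2) i4,
    integral_add' ic i2] at hsplit
  refine hsplit.le.trans ?_
  simp only [integral_const_mul, integral_const, probReal_univ, one_smul]
  have h4 := fourthMoment_le hP hκ θ
  have h22 := mul_le_mul_of_nonneg_left (integral_norm_sq_mul_inner_sq_le hP hκ hs θ)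
    (by positivity : 0 ≤ (2 + cConst) * r ^ 2)
  rw [← s4sq_sq]
  have hN : ∫ y, (inner ℝ θ y) ^ 2 ∂P = secondMoment P θ := rfl
  have hF : ∫ y, (inner ℝ θ y) ^ 4 ∂P = fourthMoment P θ := rfl
  rw [hN, hF]
  linarith

/-- With high probability, the deviations of the empirical criterion at the scale `l` are bounded
uniformly in `θ`. -/
theorem exists_samples_abs_rCrit_sub_le (hP : Integrable (fun x => ‖x‖ ^ 4) P)
    (hκ : 0 < kurtosis P) (hs : 0 < s4sq P) {n : ℕ} (hn : 0 < n) (l : ℝ) {β : ℝ} (hβ : 0 < β)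
    {η : ℝ} (hη : 0 < η) :
    ∃ S : Set (Fin n → EuclideanSpace ℝ (Fin d)), MeasurableSet S ∧
      Measure.pi (fun _ : Fin n => P) Sᶜ ≤ ENNReal.ofReal (2 * η) ∧
      ∀ x ∈ S, ∀ θ, |rCrit x l θ - (secondMoment P θ - l)| ≤ critDev P n l β (Real.log η⁻¹) θ := by
  have hr : 0 < (Real.sqrt β)⁻¹ := by positivity
  have hr2 : (Real.sqrt β)⁻¹ ^ 2 = β⁻¹ := by rw [inv_pow, Real.sq_sqrt hβ.le]
  have hr4 : (Real.sqrt β)⁻¹ ^ 4 = (β ^ 2)⁻¹ := by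
    rw [show (Real.sqrt β)⁻¹ ^ 4 = ((Real.sqrt β)⁻¹ ^ 2) ^ 2 by ring, hr2, inv_pow]
  obtain ⟨S₁, hS₁m, hS₁, h₁⟩ := exists_good_samples (e := 1) (Or.inl rfl) l hr hP n hη
  obtain ⟨S₂, hS₂m, hS₂, h₂⟩ := exists_good_samples (e := -1) (Or.inr rfl) l hr hP n hη
  have hn' : (0 : ℝ) < n := Nat.cast_pos.2 hn
  have key : ∀ (e A : ℝ) (θ : EuclideanSpace ℝ (Fin d)), A ≤
        n * ∫ y, (e * ((inner ℝ θ y) ^ 2 - l)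
        + ((inner ℝ θ y) ^ 2 - l) ^ 2 / 2
        + (2 + cConst) * (Real.sqrt β)⁻¹ ^ 2 * (‖y‖ ^ 2 * (inner ℝ θ y) ^ 2)
        + (2 + 3 * cConst) / 2 * (Real.sqrt β)⁻¹ ^ 4 * ‖y‖ ^ 4) ∂P
        + ‖θ‖ ^ 2 / (2 * (Real.sqrt β)⁻¹ ^ 2) + Real.log η⁻¹ →
      (n : ℝ)⁻¹ * A ≤ e * (secondMoment P θ - l) + critDev P n l β (Real.log η⁻¹) θ := by
    intro e A θ hA
    have hb := mul_le_mul_of_nonneg_left (integral_criterion_bound_le hP hκ hs e l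
      (Real.sqrt β)⁻¹ θ) hn'.le
    have hA' := mul_le_mul_of_nonneg_left (hA.trans (add_le_add_left (add_le_add_left hb _) _))
      (inv_pos.2 hn').le
    refine hA'.trans (le_of_eq ?_)
    rw [hr2, hr4, critDev]
    field_simp
    ring
  refine ⟨S₁ ∩ S₂, hS₁m.inter hS₂m, ?_, fun x hx θ => ?_⟩
  · rw [Set.compl_inter, two_mul, ENNReal.ofReal_add hη.le hη.le]
    exact (measure_union_le _ _).trans (add_le_add hS₁ hS₂)
  · have k₁ := key 1 _ θ (h₁ x hx.1 θ)
    have k₂ := key (-1) _ θ (h₂ x hx.2 θ)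
    simp only [neg_mul, one_mul, psi_neg, Finset.sum_neg_distrib, mul_neg] at k₁ k₂
    rw [abs_le]
    unfold rCrit
    constructor <;> linarith

end Moments

/-! ### From the empirical criterion to confidence intervals -/

/-- The two inequalities relating the estimator `Ñ` of `N` to `N`, at a scale `l`: `lower`
expresses that `r_l` is non-positive at `α θ` for `α ^ 2 = l / t`, `t > Ñ`, and `upper` that it is
positive for `t < Ñ`. The constants `k`, `m`, `g`, `b` stand for `κ`, `μ`, `γ` and `β / (2 n)`. -/
structure CriterionBounds (N Nt k l m g b : ℝ) : Prop where
  lower : ∀ t, Nt < t → 0 < t →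
    (1 - m) * (N / t - 1) - k * l / 2 * (N / t - 1) ^ 2 ≤ g + b / t
  upper : ∀ t, 0 < t → t < Nt →
    0 ≤ (1 + m) * (N / t - 1) + k * l / 2 * (N / t - 1) ^ 2 + g + b / t

/-- The relations between the constants of `CriterionBounds`. -/
structure ScaleBounds (k l m g b : ℝ) : Prop where
  three_half_le : 3 / 2 ≤ k
  l_pos : 0 < l
  b_pos : 0 < b
  le_m : (k - 1) * l ≤ m
  le_g : (k - 1) * l / 2 ≤ g
  m_le : m ≤ 2 * g

section Interval

variable {N Nt k l m g b σ : ℝ}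

theorem ScaleBounds.kl_le (h : ScaleBounds k l m g b) : k * l ≤ 3 * ((k - 1) * l) := by
  nlinarith [h.three_half_le, h.l_pos]

theorem ScaleBounds.kl_nonneg (h : ScaleBounds k l m g b) : 0 < k * l :=
  mul_pos (by linarith [h.three_half_le]) h.l_pos

theorem ScaleBounds.g_pos (h : ScaleBounds k l m g b) : 0 < g := by
  have := h.kl_nonneg; have := h.kl_le; have := h.le_g
  linarith

/-- The confidence interval centred at `S = max Ñ σ` contains `max N σ`. -/
theorem CriterionBounds.abs_max_sub_le (hc : CriterionBounds N Nt k l m g b)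
    (h : ScaleBounds k l m g b) (hN : 0 ≤ N) (hσ : 0 < σ)
    (h6 : 6 * (g + b / max Nt σ) ≤ 1) :
    |max N σ - max Nt σ| ≤ max Nt σ *
      ((g + b / max Nt σ) / (1 - m - g - 2 * (b / max Nt σ))) := by
  set S := max Nt σ with hS
  have hS0 : 0 < S := lt_max_of_lt_right hσ
  have hσS : σ ≤ S := le_max_right _ _
  have hNtS : Nt ≤ S := le_max_left _ _
  have hg := h.g_pos
  have hkl := h.kl_le
  have hkl0 := h.kl_nonneg
  have hm := h.m_le
  have hlem := h.le_m
  have hleg := h.le_g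
  have hρ : 0 < b / S := div_pos h.b_pos hS0
  set ρ := b / S with hρdef
  set D := 1 - m - g - 2 * ρ with hD
  have hD2 : 1 / 2 ≤ D := by linarith
  set w := (g + ρ) / D with hw
  have hD0 : 0 < D := by linarith
  have hw0 : 0 < w := by positivity
  have hwD : w * D = g + ρ := div_mul_cancel₀ _ hD0.ne'
  have hw3 : w ≤ 1 / 3 := by
    rw [hw, div_le_iff₀ hD0]; linarith
  rw [abs_le]
  constructor
  · by_contra hlt
    push Not at hlt
    have hlt' : max N σ < S * (1 - w) := by linarith
    have hN1 : N < S * (1 - w) := (le_max_left _ _).trans_lt hlt'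
    have hσ1 : σ < S := ((le_max_right N σ).trans_lt hlt').trans_le (by nlinarith)
    have hSN : S = Nt := by
      rcases le_total Nt σ with h' | h'
      · rw [hS, max_eq_right h'] at hσ1; exact absurd hσ1 (lt_irrefl _)
      · rw [hS, max_eq_left h']
    -- the upper inequality, in the limit where `t` tends to `Ñ` from below
    have hlim : 0 ≤ (1 + m) * (N / S - 1) + k * l / 2 * (N / S - 1) ^ 2 + g + b / S := by
      have hcont : ContinuousAt (fun t => (1 + m) * (N / t - 1) + k * l / 2 * (N / t - 1) ^ 2
          + g + b / t) S := by
        have : S ≠ 0 := hS0.ne'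
        fun_prop (disch := assumption)
      refine ge_of_tendsto (hcont.tendsto.mono_left (nhdsWithin_le_nhds (s := Set.Iio S))) ?_
      filter_upwards [self_mem_nhdsWithin, mem_nhdsWithin_of_mem_nhds (Ioi_mem_nhds hS0)]
        with t h1 h2
      exact hc.upper t h2 (hSN ▸ h1)
    set y := 1 - N / S with hy
    have hyw : w < y := by
      have : N / S < 1 - w := by rw [div_lt_iff₀ hS0]; linarith
      linarith
    have hy1 : y ≤ 1 := by have := div_nonneg hN hS0.le; linarith
    rw [show N / S - 1 = -y by rw [hy]; ring] at hlim
    have h1 : k * l / 2 * (-y) ^ 2 ≤ k * l / 2 * y := by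
      have : y ^ 2 ≤ y := by nlinarith
      nlinarith
    have h2 : (1 + m - k * l / 2) * y ≤ g + ρ := by linarith
    have h3 : D ≤ 1 + m - k * l / 2 := by linarith
    have h4 : D * y ≤ (1 + m - k * l / 2) * y := mul_le_mul_of_nonneg_right h3 (by linarith)
    nlinarith
  · by_contra hlt
    push Not at hlt
    have hlt' : S * (1 + w) < max N σ := by linarith
    have hN1 : S * (1 + w) < N := by
      rcases lt_max_iff.1 hlt' with h' | h'
      · exact h'
      · nlinarith
    set t := N / (1 + w) with ht
    have hSt : S < t := by rw [ht, lt_div_iff₀ (by linarith)]; exact hN1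
    have ht0 : 0 < t := hS0.trans hSt
    have hNt : N / t - 1 = w := by
      rw [ht, div_div_cancel₀ (by nlinarith)]; ring
    have h1 := hc.lower t (hNtS.trans_lt hSt) ht0
    rw [hNt] at h1
    have h2 : b / t < ρ := div_lt_div_of_pos_left h.b_pos hS0 hSt
    have h3 : k * l / 2 * w ≤ g := by nlinarith
    have h4 : k * l / 2 * w ^ 2 ≤ g * w := by nlinarith
    nlinarith

/-- When the scale is adapted to `T = max N σ`, the constraint on the confidence interval is active
and its half-width is controlled by the accuracy at `T`. -/
theorem CriterionBounds.width_le (hc : CriterionBounds N Nt k l m g b)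
    (h : ScaleBounds k l m g b) (hN : 0 ≤ N) (hσ : 0 < σ) {η : ℝ}
    (hη : g + b / max N σ ≤ η) (h8 : η ≤ 1 / 8) :
    6 * (g + b / max Nt σ) ≤ 1 ∧ max Nt σ *
      ((g + b / max Nt σ) / (1 - m - g - 2 * (b / max Nt σ))) ≤
      max N σ * (η / (1 - 4 * η)) := by
  have hT0 : 0 < max N σ := lt_max_of_lt_right hσ
  have hS0 : 0 < max Nt σ := lt_max_of_lt_right hσ
  have hg := h.g_pos
  have hkl := h.kl_le
  have hkl0 := h.kl_nonneg
  have hm := h.m_le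
  have hleg := h.le_g
  have hb := h.b_pos
  have hρT : 0 < b / max N σ := div_pos hb hT0
  rcases le_or_gt (max N σ) (max Nt σ) with hTS | hST
  · have hle : b / max Nt σ ≤ b / max N σ := div_le_div_of_nonneg_left hb.le hT0 hTS
    have h6 : 6 * (g + b / max Nt σ) ≤ 1 := by linarith
    refine ⟨h6, ?_⟩
    have hi := (abs_le.1 (hc.abs_max_sub_le h hN hσ h6)).1
    set S := max Nt σ
    set T := max N σ
    have hρ : 0 < b / S := div_pos hb hS0
    set ρ := b / S
    set D := 1 - m - g - 2 * ρ with hD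
    have hD0 : 0 < D := by linarith
    set w := (g + ρ) / D with hw
    have hwD : w * D = g + ρ := div_mul_cancel₀ _ hD0.ne'
    have hw0 : 0 < w := by positivity
    rw [← mul_div_assoc T, le_div_iff₀ (by linarith)]
    -- `S (1 - w) ≤ T`, and `w (1 - 4 η) ≤ η (1 - w)` since `w D = g + ρ`
    have h1 : w * (1 - 3 * η) ≤ η := by nlinarith
    have h2 : S * (w * (1 - 4 * η)) ≤ S * (η * (1 - w)) :=
      mul_le_mul_of_nonneg_left (by nlinarith) hS0.le
    have h3 : S * (1 - w) * η ≤ T * η :=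
      mul_le_mul_of_nonneg_right (by linarith) (by linarith)
    linarith
  · have hσN : σ < N := by
      rcases lt_max_iff.1 ((le_max_right Nt σ).trans_lt hST) with h' | h'
      · exact h'
      · exact absurd h' (lt_irrefl _)
    rw [max_eq_left hσN.le] at *
    have hNS : 3 / 4 * N ≤ max Nt σ := by
      by_contra hlt
      push Not at hlt
      have h1 := hc.lower (3 / 4 * N) ((le_max_left _ _).trans_lt hlt) (by linarith)
      have e1 : N / (3 / 4 * N) - 1 = 1 / 3 := by field_simp; norm_num
      have e2 : b / (3 / 4 * N) = 4 / 3 * (b / N) := by field_simp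
      rw [e1, e2] at h1
      linarith
    have hle : b / max Nt σ ≤ 4 / 3 * (b / N) := by
      have : b / max Nt σ ≤ b / (3 / 4 * N) :=
        div_le_div_of_nonneg_left hb.le (by positivity) hNS
      have e2 : b / (3 / 4 * N) = 4 / 3 * (b / N) := by field_simp
      linarith
    have h6 : 6 * (g + b / max Nt σ) ≤ 1 := by linarith
    refine ⟨h6, ?_⟩
    set S := max Nt σ
    have hρ : 0 < b / S := div_pos hb hS0
    have hD0 : 0 < 1 - m - g - 2 * (b / S) := by linarith
    have hη4 : 0 < 1 - 4 * η := by linarith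
    rw [← mul_div_assoc S, ← mul_div_assoc N, div_le_div_iff₀ hD0 hη4]
    have e1 : S * (g + b / S) = S * g + b := by field_simp
    have e2 : N * (g + b / N) = N * g + b := by field_simp
    have h1 : S * (g + b / S) ≤ N * η := by
      rw [e1]
      have := mul_le_mul_of_nonneg_left hη hT0.le
      nlinarith
    exact mul_le_mul h1 (by linarith) hη4.le (by nlinarith)

end Interval

/-! ### The estimator of `N(θ)` -/

section Estimator

variable {n d : ℕ} (x : Fin n → EuclideanSpace ℝ (Fin d)) {l : ℝ} (θ : EuclideanSpace ℝ (Fin d))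

theorem rCrit_smul_mono (l : ℝ) {α α' : ℝ} (h0 : 0 ≤ α) (h : α ≤ α') :
    rCrit x l (α • θ) ≤ rCrit x l (α' • θ) := by
  unfold rCrit
  gcongr with i
  refine psi_monotone ?_
  simp only [inner_smul_left, conj_trivial, mul_pow]
  gcongr

theorem bddBelow_Ntilde_set (hl : 0 < l) : BddBelow {v : ℝ | ∃ α : ℝ, 0 < α ∧
    rCrit x l (α • θ) ≤ 0 ∧ v = l / α ^ 2} :=
  ⟨0, by rintro v ⟨α, hα, -, rfl⟩; positivity⟩

/-- Small multiples of `θ` have a non-positive criterion. -/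
theorem nonempty_Ntilde_set (hl : 0 < l) : {v : ℝ | ∃ α : ℝ, 0 < α ∧
    rCrit x l (α • θ) ≤ 0 ∧ v = l / α ^ 2}.Nonempty := by
  set A := ∑ i, (inner ℝ θ (x i)) ^ 2 with hA
  have hA0 : 0 ≤ A := Finset.sum_nonneg fun i _ => sq_nonneg _
  set α := Real.sqrt (l / (A + 1)) with hα
  have hα0 : 0 < α := Real.sqrt_pos.2 (by positivity)
  refine ⟨_, α, hα0, ?_, rfl⟩
  unfold rCrit
  refine mul_nonpos_of_nonneg_of_nonpos (by positivity) (Finset.sum_nonpos fun i hi => ?_)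
  have h0 : psi 0 = 0 := by simp [psi]
  rw [← h0]
  refine psi_monotone ?_
  have h1 : (inner ℝ θ (x i)) ^ 2 ≤ A :=
    Finset.single_le_sum (f := fun i => (inner ℝ θ (x i)) ^ 2) (fun i _ => sq_nonneg _) hi
  rw [inner_smul_left, conj_trivial, mul_pow, hα, Real.sq_sqrt (by positivity), div_mul_eq_mul_div,
    sub_nonpos, div_le_iff₀ (by positivity)]
  nlinarith

theorem sqrt_div_sq {t : ℝ} (hl : 0 < l) (ht : 0 < t) : l / Real.sqrt (l / t) ^ 2 = t := by
  rw [Real.sq_sqrt (by positivity)]; field_simp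

theorem rCrit_nonpos_of_Ntilde_lt (hl : 0 < l) {t : ℝ} (ht : 0 < t) (h : Ntilde x l θ < t) :
    rCrit x l (Real.sqrt (l / t) • θ) ≤ 0 := by
  obtain ⟨v, ⟨α, hα, hr, rfl⟩, hv⟩ := exists_lt_of_csInf_lt (nonempty_Ntilde_set x θ hl) h
  refine (rCrit_smul_mono x θ l (Real.sqrt_nonneg _) ?_).trans hr
  rw [Real.sqrt_le_left hα.le]
  rw [div_lt_iff₀ (by positivity)] at hv
  rw [div_le_iff₀ ht]
  linarith

theorem rCrit_pos_of_lt_Ntilde (hl : 0 < l) {t : ℝ} (ht : 0 < t) (h : t < Ntilde x l θ) :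
    0 < rCrit x l (Real.sqrt (l / t) • θ) := by
  by_contra hr
  push Not at hr
  refine notMem_of_lt_csInf h (bddBelow_Ntilde_set x θ hl)
    ⟨Real.sqrt (l / t), Real.sqrt_pos.2 (by positivity), hr, (sqrt_div_sq hl ht).symm⟩

end Estimator

/-- On the samples where the empirical criterion concentrates at the scale `l`, the estimator `Ñ`
satisfies the two inequalities of `CriterionBounds`. -/
theorem criterionBounds_of_abs_rCrit_sub_le {n d : ℕ} {P : Measure (EuclideanSpace ℝ (Fin d))}
    {x : Fin n → EuclideanSpace ℝ (Fin d)} {l β B : ℝ} (hl : 0 < l) (hβ : 0 < β) (hn : 0 < n)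
    (h : ∀ θ, |rCrit x l θ - (secondMoment P θ - l)| ≤ critDev P n l β B θ)
    {θ : EuclideanSpace ℝ (Fin d)} (hθ : ‖θ‖ = 1) :
    CriterionBounds (secondMoment P θ) (Ntilde x l θ) (kurtosis P) l
      ((kurtosis P - 1) * l + (2 + cConst) * Real.sqrt (kurtosis P) * s4sq P / β)
      ((kurtosis P - 1) * l / 2 + (2 + cConst) * Real.sqrt (kurtosis P) * s4sq P / β
        + (2 + 3 * cConst) * s4sq P ^ 2 / (2 * β ^ 2 * l) + B / (n * l)) (β / (2 * n)) := by
  have hn' : (0 : ℝ) < n := Nat.cast_pos.2 hn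
  set N := secondMoment P θ with hN
  set k := kurtosis P
  set s := s4sq P
  -- at `α ^ 2 = l / t`, the deviation is `l` times a quadratic polynomial in `N / t - 1`
  have key : ∀ t, 0 < t → critDev P n l β B (Real.sqrt (l / t) • θ) = l * (
      ((k - 1) * l + (2 + cConst) * Real.sqrt k * s / β) * (N / t - 1)
      + k * l / 2 * (N / t - 1) ^ 2
      + ((k - 1) * l / 2 + (2 + cConst) * Real.sqrt k * s / β
        + (2 + 3 * cConst) * s ^ 2 / (2 * β ^ 2 * l) + B / (n * l)) + β / (2 * n) / t) := by
    intro t ht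
    rw [critDev, secondMoment_smul, norm_smul, hθ, mul_one, Real.norm_eq_abs, sq_abs,
      Real.sq_sqrt (by positivity), ← hN]
    field_simp
    ring
  have key' : ∀ t, 0 < t → secondMoment P (Real.sqrt (l / t) • θ) - l = l * (N / t - 1) := by
    intro t ht
    rw [secondMoment_smul, Real.sq_sqrt (by positivity), ← hN]
    field_simp
  constructor
  · intro t ht ht0
    have h1 := rCrit_nonpos_of_Ntilde_lt x θ hl ht0 ht
    have h2 := (abs_le.1 (h (Real.sqrt (l / t) • θ))).1
    rw [key t ht0, key' t ht0] at h2
    have h3 : l * ((1 - ((k - 1) * l + (2 + cConst) * Real.sqrt k * s / β)) * (N / t - 1)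
        - k * l / 2 * (N / t - 1) ^ 2) ≤ l * (((k - 1) * l / 2 + (2 + cConst) * Real.sqrt k * s / β
        + (2 + 3 * cConst) * s ^ 2 / (2 * β ^ 2 * l) + B / (n * l)) + β / (2 * n) / t) := by
      linarith
    exact le_of_mul_le_mul_left h3 hl
  · intro t ht0 ht
    have h1 := rCrit_pos_of_lt_Ntilde x θ hl ht0 ht
    have h2 := (abs_le.1 (h (Real.sqrt (l / t) • θ))).2
    rw [key t ht0, key' t ht0] at h2
    refine nonneg_of_mul_nonneg_right (a := l) ?_ hl
    linarith

/-! ### The grid of scales -/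

theorem add_inv_le_two_mul_cosh {u b : ℝ} (hu : 0 < u) (h1 : u ≤ Real.exp b)
    (h2 : Real.exp (-b) ≤ u) : u + u⁻¹ ≤ 2 * Real.cosh b := by
  have h : |Real.log u| ≤ |b| := by
    refine (abs_le.2 ⟨?_, ?_⟩).trans (le_abs_self b)
    · rw [Real.le_log_iff_exp_le hu]; exact h2
    · rw [Real.log_le_iff_le_exp hu]; exact h1
  have := Real.cosh_le_cosh.2 h
  rw [Real.cosh_eq, Real.exp_neg, Real.exp_log hu] at this
  linarith

/-- The loss incurred when `p x + q / x` is evaluated at a point `x` distinct from its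
minimizer. -/
theorem mul_add_div_le_cosh {p q x b : ℝ} (hp : 0 < p) (hq : 0 < q) (hx : 0 < x)
    (h1 : q ≤ Real.exp (2 * b) * (p * x ^ 2)) (h2 : p * x ^ 2 ≤ Real.exp (2 * b) * q) :
    p * x + q / x ≤ 2 * Real.sqrt (p * q) * Real.cosh b := by
  set u := x * Real.sqrt (p / q) with hu
  have hu0 : 0 < u := by positivity
  have hu2 : u ^ 2 = p * x ^ 2 / q := by
    rw [hu, mul_pow, Real.sq_sqrt (by positivity)]; ring
  have he : ∀ b : ℝ, Real.exp (2 * b) = Real.exp b ^ 2 := fun b => by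
    rw [← Real.exp_nat_mul]; norm_num
  have hsq : Real.sqrt (p * q) = q * Real.sqrt (p / q) := by
    rw [Real.sqrt_eq_iff_mul_self_eq (by positivity) (by positivity),
      show q * Real.sqrt (p / q) * (q * Real.sqrt (p / q)) = q ^ 2 * Real.sqrt (p / q) ^ 2 by ring,
      Real.sq_sqrt (by positivity)]
    field_simp
  have e1 : p * x = Real.sqrt (p * q) * u := by
    rw [hsq, hu, show q * Real.sqrt (p / q) * (x * Real.sqrt (p / q))
      = q * x * Real.sqrt (p / q) ^ 2 by ring, Real.sq_sqrt (by positivity)]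
    field_simp
  have e2 : q / x = Real.sqrt (p * q) * u⁻¹ := by
    rw [hsq, hu]
    have : Real.sqrt (p / q) ≠ 0 := (Real.sqrt_pos.2 (by positivity)).ne'
    field_simp
  have hle : u ≤ Real.exp b := by
    refine le_of_sq_le_sq (α := ℝ) ?_ (Real.exp_pos b).le
    rw [hu2, ← he, div_le_iff₀ hq]
    exact h2
  have hge : Real.exp (-b) ≤ u := by
    refine le_of_sq_le_sq (α := ℝ) ?_ hu0.le
    rw [hu2, ← he, le_div_iff₀ hq, mul_neg, Real.exp_neg, inv_mul_le_iff₀ (Real.exp_pos _)]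
    exact h1
  rw [e1, e2, ← mul_add, mul_comm 2, mul_assoc]
  exact mul_le_mul_of_nonneg_left (add_inv_le_two_mul_cosh hu0 hle hge) (Real.sqrt_nonneg _)

section Grid

variable {n : ℕ} {κ s a ε σ t : ℝ}

theorem sqrt_le_zeta :
    Real.sqrt (2 * (2 + cConst) * Real.sqrt κ * s / t) ≤ zeta n κ s a ε t := by
  unfold zeta
  have h1 := le_mul_of_one_le_right
    (Real.sqrt_nonneg (2 * (2 + cConst) * Real.sqrt κ * s / t)) (Real.one_le_cosh (a / 2))
  have h2 := mul_nonneg (Real.sqrt_nonneg (2 * (κ - 1) * ((2 + 3 * cConst) * s /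
    (4 * (2 + cConst) * Real.sqrt κ * t) + Real.log (gridSize n κ a / ε))))
    (Real.cosh_pos (a / 4)).le
  linarith

theorem zeta_antitone (hκ : 3 / 2 ≤ κ) (hs : 0 < s) (hσ : 0 < σ) (h : σ ≤ t) :
    zeta n κ s a ε t ≤ zeta n κ s a ε σ := by
  have hc := forty_le_cConst
  have hk : 0 < Real.sqrt κ := Real.sqrt_pos.2 (by linarith)
  have hκ1 : 0 ≤ 2 * (κ - 1) := by linarith
  have h1 := Real.cosh_pos (a / 4)
  have h2 := Real.cosh_pos (a / 2)
  unfold zeta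
  gcongr

/-- `√t ζ(t)` is non-decreasing. -/
theorem zeta_le_sqrt_mul (hκ : 3 / 2 ≤ κ) (hs : 0 < s) (hσ : 0 < σ) (h : σ ≤ t)
    (hL : 0 ≤ Real.log (gridSize n κ a / ε)) :
    zeta n κ s a ε σ ≤ Real.sqrt (t / σ) * zeta n κ s a ε t := by
  have hc := forty_le_cConst
  have hk : 0 < Real.sqrt κ := Real.sqrt_pos.2 (by linarith)
  have hκ1 : 0 ≤ 2 * (κ - 1) := by linarith
  have ht : 0 < t := hσ.trans_le h
  have h1 := Real.cosh_pos (a / 4)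
  have h2 := Real.cosh_pos (a / 2)
  have hq : 1 ≤ t / σ := by rwa [one_le_div hσ]
  unfold zeta
  rw [mul_add (Real.sqrt (t / σ)), ← mul_assoc, ← mul_assoc, ← Real.sqrt_mul (by positivity),
    ← Real.sqrt_mul (by positivity)]
  have e1 : t / σ * (2 * (2 + cConst) * Real.sqrt κ * s / t) =
      2 * (2 + cConst) * Real.sqrt κ * s / σ := by field_simp
  have e2 : 2 * (κ - 1) * ((2 + 3 * cConst) * s / (4 * (2 + cConst) * Real.sqrt κ * σ)
      + Real.log (gridSize n κ a / ε)) ≤ t / σ * (2 * (κ - 1) * ((2 + 3 * cConst) * s /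
      (4 * (2 + cConst) * Real.sqrt κ * t) + Real.log (gridSize n κ a / ε))) := by
    have e3 : t / σ * ((2 + 3 * cConst) * s / (4 * (2 + cConst) * Real.sqrt κ * t)) =
        (2 + 3 * cConst) * s / (4 * (2 + cConst) * Real.sqrt κ * σ) := by field_simp
    rw [mul_left_comm, mul_add (t / σ), e3]
    have := le_mul_of_one_le_left hL hq
    gcongr
  rw [e1]
  have := Real.sqrt_le_sqrt e2
  gcongr

theorem lamGrid_pos (hn : 0 < n) (hκ : 3 / 2 ≤ κ) (hL : 0 ≤ Real.log (gridSize n κ a / ε))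
    (j : ℕ) : 0 < lamGrid n κ a ε j := by
  have hc := forty_le_cConst
  have hk : 0 < Real.sqrt κ := Real.sqrt_pos.2 (by linarith)
  have hn' : (0 : ℝ) < n := Nat.cast_pos.2 hn
  have hκ1 : 0 < κ - 1 := by linarith
  unfold lamGrid
  positivity

theorem betaGrid_pos (hn : 0 < n) (hκ : 3 / 2 ≤ κ) (hs : 0 < s) (j : ℕ) :
    0 < betaGrid n κ s a j := by
  have hc := forty_le_cConst
  have hk : 0 < Real.sqrt κ := Real.sqrt_pos.2 (by linarith)
  have hn' : (0 : ℝ) < n := Nat.cast_pos.2 hn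
  unfold betaGrid
  positivity

theorem rhoGrid_eq (j : ℕ) : rhoGrid n κ s a j t = betaGrid n κ s a j / (2 * n) / t := by
  rw [rhoGrid, div_div]

theorem scaleBounds_grid (hn : 0 < n) (hκ : 3 / 2 ≤ κ) (hs : 0 < s)
    (hL : 0 ≤ Real.log (gridSize n κ a / ε)) (j : ℕ) :
    ScaleBounds κ (lamGrid n κ a ε j) (muGrid n κ s a ε j) (gammaGrid n κ s a ε j)
      (betaGrid n κ s a j / (2 * n)) := by
  have hc := forty_le_cConst
  have hn' : (0 : ℝ) < n := Nat.cast_pos.2 hn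
  have hl := lamGrid_pos hn hκ hL j
  have hβ := betaGrid_pos (a := a) hn hκ hs j
  have h1 : 0 ≤ (2 + cConst) * Real.sqrt κ * s / betaGrid n κ s a j := by positivity
  have h2 : 0 ≤ (2 + 3 * cConst) * s ^ 2 /
    (2 * betaGrid n κ s a j ^ 2 * lamGrid n κ a ε j) := by positivity
  have h3 : 0 ≤ Real.log (gridSize n κ a / ε) / (n * lamGrid n κ a ε j) := by positivity
  refine ⟨hκ, hl, by positivity, ?_, ?_, ?_⟩
  · unfold muGrid; linarith
  · unfold gammaGrid; linarith
  · unfold muGrid gammaGrid; linarith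

/-- The scale whose index is the nearest integer to `log (s / t) / a` is adapted to the value
`t`. -/
theorem exists_scale (hn : 0 < n) (ha : 0 < a) (hκ : 3 / 2 ≤ κ) (hs : 0 < s) (hσ : 0 < σ)
    (hL : 0 ≤ Real.log (gridSize n κ a / ε)) (hζ : 8 * zeta n κ s a ε σ ≤ Real.sqrt n)
    (hσt : σ ≤ t) (hts : t ≤ s) :
    ∃ j < gridSize n κ a, gammaGrid n κ s a ε j + rhoGrid n κ s a j t ≤
      (Real.sqrt n)⁻¹ * zeta n κ s a ε t := by
  have hc := forty_le_cConst
  have hk : 0 < Real.sqrt κ := Real.sqrt_pos.2 (by linarith)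
  have hn' : (0 : ℝ) < n := Nat.cast_pos.2 hn
  have hκ1 : 0 < κ - 1 := by linarith
  have ht : 0 < t := hσ.trans_le hσt
  set y := Real.log (s / t) with hy
  have hy0 : 0 ≤ y := Real.log_nonneg (by rwa [one_le_div ht])
  have hey : Real.exp y = s / t := Real.exp_log (by positivity)
  set j := ⌊y / a + 1 / 2⌋₊ with hj
  have hj1 : (j : ℝ) ≤ y / a + 1 / 2 := Nat.floor_le (by positivity)
  have hj2 : y / a + 1 / 2 < j + 1 := Nat.lt_floor_add_one _
  have hj1' : j * a ≤ y + a / 2 := by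
    have := mul_le_mul_of_nonneg_right hj1 ha.le
    rwa [add_mul, div_mul_cancel₀ _ ha.ne', show 1 / 2 * a = a / 2 by ring] at this
  have hj2' : y ≤ j * a + a / 2 := by
    have := mul_le_mul_of_nonneg_right hj2.le ha.le
    rw [add_mul, div_mul_cancel₀ _ ha.ne'] at this
    linarith
  refine ⟨j, ?_, ?_⟩
  · -- `s / t ≤ s / σ` is at most the argument of the logarithm in `gridSize`
    have h1 : 64 * (2 * (2 + cConst) * Real.sqrt κ * s / σ) ≤ n := by
      have h2 : 8 * Real.sqrt (2 * (2 + cConst) * Real.sqrt κ * s / σ) ≤ Real.sqrt n := by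
        have := sqrt_le_zeta (n := n) (s := s) (a := a) (ε := ε) (κ := κ) (t := σ)
        linarith
      have h3 := pow_le_pow_left₀ (by positivity) h2 2
      rw [mul_pow, Real.sq_sqrt (by positivity), Real.sq_sqrt hn'.le] at h3
      linarith
    have h2 : s / t ≤ n / (72 * (2 + cConst) * Real.sqrt κ) := by
      have h3 : s / t ≤ s / σ := div_le_div_of_nonneg_left hs.le hσ hσt
      have e : 64 * (2 * (2 + cConst) * Real.sqrt κ * s / σ)
        = 128 * (2 + cConst) * Real.sqrt κ * (s / σ) := by ring
      rw [e] at h1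
      rw [le_div_iff₀ (by positivity)]
      have h4 : s / t * (72 * (2 + cConst) * Real.sqrt κ) ≤
        s / σ * (128 * (2 + cConst) * Real.sqrt κ) := by gcongr; norm_num
      linarith
    have h3 : y ≤ Real.log (n / (72 * (2 + cConst) * Real.sqrt κ)) :=
      Real.log_le_log (by positivity) h2
    have h4 : y / a ≤ ⌈a⁻¹ * Real.log (n / (72 * (2 + cConst) * Real.sqrt κ))⌉₊ := by
      refine le_trans ?_ (Nat.le_ceil _)
      rw [div_eq_inv_mul]
      gcongr
    have h5 : (j : ℝ) < ⌈a⁻¹ * Real.log (n / (72 * (2 + cConst) * Real.sqrt κ))⌉₊ + 1 := by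
      linarith
    rw [gridSize, add_comm]
    exact_mod_cast h5
  · set L := Real.log (gridSize n κ a / ε) with hLdef
    set A := (2 + 3 * cConst) / (4 * (2 + cConst) * Real.sqrt κ) with hA
    have hA0 : 0 < A := by positivity
    have hl := lamGrid_pos hn hκ hL j
    have hβ := betaGrid_pos (a := a) hn hκ hs j
    have hl2 : lamGrid n κ a ε j ^ 2 = 2 / (n * (κ - 1)) * (A * Real.exp (j * a) + L) := by
      rw [lamGrid, Real.sq_sqrt (by positivity)]
    have hβ2 : betaGrid n κ s a j ^ 2 =
        s ^ 2 * (2 * (2 + cConst) * Real.sqrt κ * n * Real.exp (-((j : ℝ) - 1 / 2) * a)) := by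
      rw [betaGrid, mul_pow, Real.sq_sqrt (by positivity)]
    set l := lamGrid n κ a ε j with hldef
    set β := betaGrid n κ s a j with hβdef
    set Q := A * Real.exp y + L with hQ
    have hQ0 : 0 < Q := by positivity
    -- the terms in `l`
    have h1 : (κ - 1) / 2 * l + Q / n / l ≤
        2 * Real.sqrt ((κ - 1) / 2 * (Q / n)) * Real.cosh (a / 4) := by
      have e1 : (κ - 1) / 2 * l ^ 2 = (A * Real.exp (j * a) + L) / n := by
        rw [hl2]; field_simp
      have hexp : 1 ≤ Real.exp (2 * (a / 4)) := Real.one_le_exp (by positivity)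
      have hLe := le_mul_of_one_le_left hL hexp
      refine mul_add_div_le_cosh (by positivity) (by positivity) hl ?_ ?_
      · rw [e1, ← mul_div_assoc]
        gcongr
        rw [hQ, mul_add, mul_left_comm, ← Real.exp_add]
        gcongr
        linarith
      · rw [e1, ← mul_div_assoc]
        gcongr
        rw [hQ, mul_add, mul_left_comm, ← Real.exp_add]
        gcongr
        linarith
    -- the terms in `β`
    have h2 : 1 / (2 * n * t) * β + (2 + cConst) * Real.sqrt κ * s / β ≤
        2 * Real.sqrt (1 / (2 * n * t) * ((2 + cConst) * Real.sqrt κ * s)) * Real.cosh (a / 2) := by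
      have e1 : 1 / (2 * n * t) * β ^ 2 = Real.exp (y + -((j : ℝ) - 1 / 2) * a) *
          ((2 + cConst) * Real.sqrt κ * s) := by
        rw [hβ2, Real.exp_add, hey]; field_simp
      refine mul_add_div_le_cosh (by positivity) (by positivity) hβ ?_ ?_
      · rw [e1, ← mul_assoc, ← Real.exp_add]
        refine le_mul_of_one_le_left (by positivity) (Real.one_le_exp ?_)
        nlinarith
      · rw [e1]
        gcongr
        nlinarith
    have hsqrt : ∀ z, 0 ≤ z → 2 * Real.sqrt (z / (4 * n)) = (Real.sqrt n)⁻¹ * Real.sqrt z := by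
      intro z hz
      rw [Real.sqrt_div hz, Real.sqrt_mul (by norm_num), show (4 : ℝ) = 2 ^ 2 by norm_num,
        Real.sqrt_sq (by norm_num)]
      field_simp
    have e1 : 2 * Real.sqrt ((κ - 1) / 2 * (Q / n)) = (Real.sqrt n)⁻¹ *
        Real.sqrt (2 * (κ - 1) *
          ((2 + 3 * cConst) * s / (4 * (2 + cConst) * Real.sqrt κ * t) + L)) := by
      have : (2 + 3 * cConst) * s / (4 * (2 + cConst) * Real.sqrt κ * t) + L = Q := by
        rw [hQ, hey, hA]; field_simp
      rw [this, ← hsqrt _ (by positivity)]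
      congr 2
      field_simp
      norm_num
    have e2 : 2 * Real.sqrt (1 / (2 * n * t) * ((2 + cConst) * Real.sqrt κ * s)) =
        (Real.sqrt n)⁻¹ * Real.sqrt (2 * (2 + cConst) * Real.sqrt κ * s / t) := by
      rw [← hsqrt _ (by positivity)]
      congr 2
      field_simp
      norm_num
    rw [e1] at h1
    rw [e2] at h2
    have h3 : (2 + 3 * cConst) * s ^ 2 / (2 * β ^ 2 * l) + L / (n * l) ≤ Q / n / l := by
      have e3 : (2 + 3 * cConst) * s ^ 2 / (2 * β ^ 2 * l) =
          A * Real.exp ((j - 1 / 2) * a) / n / l := by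
        rw [hβ2, hA, neg_mul, Real.exp_neg]
        field_simp
        norm_num
      have e4 : L / (n * l) = L / n / l := by rw [div_div]
      rw [e3, e4, ← add_div, ← add_div, hQ]
      gcongr
      linarith
    rw [zeta, gammaGrid, rhoGrid, ← hldef, ← hβdef, ← hLdef]
    have e5 : 1 / (2 * n * t) * β = β / (2 * n * t) := by ring
    have e6 : (κ - 1) / 2 * l = (κ - 1) * l / 2 := by ring
    rw [e5] at h2
    rw [e6] at h1
    linarith

/-- `t ↦ t B_*(t)` is non-decreasing on the range where `8 ζ ≤ √n`. -/
theorem mul_bound_monotone (hn : 0 < n) (hκ : 3 / 2 ≤ κ) (hs : 0 < s) (hσ : 0 < σ) (h : σ ≤ t)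
    (hL : 0 ≤ Real.log (gridSize n κ a / ε)) (hζ : 8 * zeta n κ s a ε σ ≤ Real.sqrt n) :
    σ * ((Real.sqrt n)⁻¹ * zeta n κ s a ε σ / (1 - 4 * (Real.sqrt n)⁻¹ * zeta n κ s a ε σ)) ≤
      t * ((Real.sqrt n)⁻¹ * zeta n κ s a ε t / (1 - 4 * (Real.sqrt n)⁻¹ * zeta n κ s a ε t)) := by
  have hR : 0 < Real.sqrt n := Real.sqrt_pos.2 (Nat.cast_pos.2 hn)
  have ht : 0 < t := hσ.trans_le h
  set q := Real.sqrt (t / σ) with hq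
  have hq1 : 1 ≤ q := Real.one_le_sqrt.2 (by rwa [one_le_div hσ])
  have hq2 : t = q ^ 2 * σ := by rw [hq, Real.sq_sqrt (by positivity)]; field_simp
  have h1 := mul_le_mul_of_nonneg_left (zeta_le_sqrt_mul hκ hs hσ h hL) (inv_pos.2 hR).le
  have h2 := mul_le_mul_of_nonneg_left (zeta_antitone (n := n) (a := a) (ε := ε) hκ hs hσ h)
    (inv_pos.2 hR).le
  have h3 : (Real.sqrt n)⁻¹ * zeta n κ s a ε σ ≤ 1 / 8 := by
    rw [inv_mul_le_iff₀ hR]; linarith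
  have h0 : 0 ≤ (Real.sqrt n)⁻¹ * zeta n κ s a ε t :=
    mul_nonneg (inv_pos.2 hR).le ((Real.sqrt_nonneg _).trans sqrt_le_zeta)
  rw [mul_assoc 4, mul_assoc 4]
  rw [mul_left_comm, ← hq] at h1
  set u := (Real.sqrt n)⁻¹ * zeta n κ s a ε σ
  set v := (Real.sqrt n)⁻¹ * zeta n κ s a ε t
  rw [← mul_div_assoc, ← mul_div_assoc, div_le_div_iff₀ (by linarith) (by linarith), hq2]
  have hu0 : 0 ≤ u := h0.trans h2
  have h4 : u + 4 * (q ^ 2 - 1) * u * v ≤ q ^ 2 * v := by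
    have h5 : 4 * u * ((q ^ 2 - 1) * v) ≤ 1 / 2 * ((q ^ 2 - 1) * v) :=
      mul_le_mul_of_nonneg_right (by linarith) (mul_nonneg (by nlinarith) h0)
    nlinarith [mul_nonneg (sq_nonneg (q - 1)) h0]
  nlinarith [mul_le_mul_of_nonneg_left h4 hσ.le]

end Grid

/-! ### Lipschitz functions of symmetric operators -/

section Perturbation

variable {E ι : Type*} [NormedAddCommGroup E] [InnerProductSpace ℝ E] [Fintype ι]

/-- A comparison of norms, coordinate by coordinate in an orthonormal basis. -/
theorem norm_le_of_abs_inner_le (p : OrthonormalBasis ι ℝ E) {u v : E} {c : ℝ} (hc : 0 ≤ c)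
    (h : ∀ i, |inner ℝ (p i) u| ≤ c * |inner ℝ (p i) v|) : ‖u‖ ≤ c * ‖v‖ := by
  refine le_of_sq_le_sq (α := ℝ) ?_ (by positivity)
  rw [mul_pow, ← p.sum_sq_inner_right u, ← p.sum_sq_inner_right v, Finset.mul_sum]
  refine Finset.sum_le_sum fun i _ => ?_
  have := pow_le_pow_left₀ (abs_nonneg _) (h i) 2
  rwa [mul_pow, sq_abs, sq_abs] at this

theorem exists_inner_eq (p : OrthonormalBasis ι ℝ E) (g : ι → ℝ) :
    ∃ y : E, ∀ i, inner ℝ (p i) y = g i := by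
  refine ⟨∑ i, g i • p i, fun i => ?_⟩
  simp [p.orthonormal.inner_right_fintype]

/-- `A` is the operator with eigenvectors `p i` and eigenvalues `a i`, as expressed by its
coordinates: `⟨p i, A v⟩ = a i ⟨p i, v⟩`. -/
def IsDiag (p : OrthonormalBasis ι ℝ E) (a : ι → ℝ) (A : E →L[ℝ] E) : Prop :=
  ∀ i v, inner ℝ (p i) (A v) = a i * inner ℝ (p i) v

theorem IsDiag.inner_apply {p : OrthonormalBasis ι ℝ E} {a : ι → ℝ} {A : E →L[ℝ] E}
    (h : IsDiag p a A) (u v : E) :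
    inner ℝ u (A v) = ∑ i, a i * (inner ℝ (p i) u * inner ℝ (p i) v) := by
  rw [← p.sum_inner_mul_inner]
  refine Finset.sum_congr rfl fun i _ => ?_
  rw [h, real_inner_comm]
  ring

theorem IsDiag.inner_comm {p : OrthonormalBasis ι ℝ E} {a : ι → ℝ} {A : E →L[ℝ] E}
    (h : IsDiag p a A) (u v : E) : inner ℝ u (A v) = inner ℝ (A u) v := by
  rw [h.inner_apply, ← real_inner_comm, h.inner_apply]
  exact Finset.sum_congr rfl fun i _ => by ring

/-- A form of Weyl's inequality: the number of eigenvalues of `C` above `ℓ + B` is at most the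
number of eigenvalues of `A` above `ℓ`, when `A` and `C` are at distance at most `B`. -/
theorem IsDiag.card_lt_le {p q : OrthonormalBasis ι ℝ E} {a c : ι → ℝ} {A C : E →L[ℝ] E}
    (hA : IsDiag p a A) (hC : IsDiag q c C) {B ℓ : ℝ} (hB : ∀ v, ‖A v - C v‖ ≤ B * ‖v‖) :
    (Finset.univ.filter fun k => ℓ + B < c k).card ≤
      (Finset.univ.filter fun i => ℓ < a i).card := by
  classical
  by_contra hlt
  push Not at hlt
  set I := Finset.univ.filter fun i => ℓ < a i
  set J := Finset.univ.filter fun k => ℓ + B < c k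
  -- a nonzero vector in the span of the `q k`, `k ∈ J`, orthogonal to the `p i`, `i ∈ I`
  let φ : (J → ℝ) →ₗ[ℝ] (I → ℝ) :=
    { toFun := fun x i => ∑ k, x k * inner ℝ (p i) (q k)
      map_add' := fun x y => by ext i; simp [add_mul, Finset.sum_add_distrib]
      map_smul' := fun r x => by ext i; simp [Finset.mul_sum, mul_assoc] }
  have hker : LinearMap.ker φ ≠ ⊥ := LinearMap.ker_ne_bot_of_finrank_lt (by simpa using hlt)
  obtain ⟨x, hx, hx0⟩ := Submodule.exists_mem_ne_zero_of_ne_bot hker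
  obtain ⟨k₀, hk₀⟩ := Function.ne_iff.1 hx0
  set u : E := ∑ k : J, x k • q k with hu
  have hqu : ∀ k, inner ℝ (q k) u = if h : k ∈ J then x ⟨k, h⟩ else 0 := by
    intro k
    rw [hu, inner_sum]
    simp only [inner_smul_right, q.inner_eq_ite]
    split_ifs with h
    · rw [Finset.sum_eq_single ⟨k, h⟩]
      · simp
      · intro b _ hb
        rw [if_neg (fun h' => hb (Subtype.ext h'.symm)), mul_zero]
      · simp
    · refine Finset.sum_eq_zero fun b _ => ?_
      rw [if_neg (fun h' : k = b => h (h' ▸ b.2)), mul_zero]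
  have hpu : ∀ i ∈ I, inner ℝ (p i) u = 0 := by
    intro i hi
    have h0 : ∑ k : J, x k * inner ℝ (p i) (q k) = 0 := congrFun (LinearMap.mem_ker.1 hx) ⟨i, hi⟩
    rw [hu, inner_sum]
    simp only [inner_smul_right]
    exact h0
  have h1 : inner ℝ u (A u) ≤ ℓ * ‖u‖ ^ 2 := by
    rw [hA.inner_apply, ← p.sum_sq_inner_right u, Finset.mul_sum]
    refine Finset.sum_le_sum fun i _ => ?_
    by_cases hi : i ∈ I
    · simp [hpu i hi]
    · have : a i ≤ ℓ := by simpa [I] using hi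
      rw [← sq]
      exact mul_le_mul_of_nonneg_right this (sq_nonneg _)
  have h2 : (ℓ + B) * ‖u‖ ^ 2 < inner ℝ u (C u) := by
    rw [hC.inner_apply, ← q.sum_sq_inner_right u, Finset.mul_sum]
    refine Finset.sum_lt_sum (fun k _ => ?_) ⟨k₀, Finset.mem_univ _, ?_⟩
    · by_cases hk : k ∈ J
      · have : ℓ + B < c k := by simpa [J] using hk
        rw [← sq]
        exact mul_le_mul_of_nonneg_right this.le (sq_nonneg _)
      · simp [hqu, hk]
    · have : ℓ + B < c k₀ := (Finset.mem_filter.1 k₀.2).2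
      rw [← sq]
      refine mul_lt_mul_of_pos_right this (sq_pos_of_ne_zero ?_)
      rw [hqu, dif_pos k₀.2]
      exact hk₀
  have h3 : -(B * ‖u‖ ^ 2) ≤ inner ℝ u (A u - C u) := by
    have := (abs_le.1 (abs_real_inner_le_norm u (A u - C u))).1
    nlinarith [mul_le_mul_of_nonneg_left (hB u) (norm_nonneg u)]
  rw [inner_sub_right] at h3
  linarith

/-- On the eigenvectors of either operator, the difference of the values of an `L`-Lipschitz
function is at most `L` times the difference of the operators. -/
theorem IsDiag.norm_sub_basis_le {p q : OrthonormalBasis ι ℝ E} {a c : ι → ℝ}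
    {A C A' C' : E →L[ℝ] E} (hA : IsDiag p a A) (hC : IsDiag q c C) {f : ℝ → ℝ} {L : ℝ} (hL : 0 ≤ L)
    (hf : ∀ x y, |f x - f y| ≤ L * |x - y|) (hA' : IsDiag p (fun i => f (a i)) A')
    (hC' : IsDiag q (fun k => f (c k)) C') {B : ℝ} (hB : ∀ v, ‖A v - C v‖ ≤ B * ‖v‖) (k : ι) :
    ‖A' (q k) - C' (q k)‖ ≤ L * B := by
  have h : ‖A' (q k) - C' (q k)‖ ≤ L * ‖A (q k) - C (q k)‖ := by
    refine norm_le_of_abs_inner_le p hL fun i => ?_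
    have e : ∀ {c : ι → ℝ} {C : E →L[ℝ] E}, IsDiag q c C →
        inner ℝ (p i) (C (q k)) = c k * inner ℝ (p i) (q k) := fun hC => by
      rw [hC.inner_comm, real_inner_comm, hC, real_inner_comm]
    rw [inner_sub_right, inner_sub_right, hA, hA', e hC, e hC', ← sub_mul, ← sub_mul, abs_mul,
      abs_mul, ← mul_assoc]
    exact mul_le_mul_of_nonneg_right (hf _ _) (abs_nonneg _)
  have := mul_le_mul_of_nonneg_left (hB (q k)) hL
  rw [q.norm_eq_one, mul_one] at this
  exact h.trans this

/-- The perturbation bound for Lipschitz functions of two nonnegative operators at distance at most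
`B`, when `A` has at most `r` eigenvalues above `ℓ`. On the leading eigenvectors of either operator,
`norm_sub_basis_le` gives a Hilbert–Schmidt contribution `r B²`; between the remaining eigenspaces
the spectra lie in `[0, ℓ]` and `[0, ℓ + B]`, where `f` is close to the constant `f (ℓ / 2)`. -/
theorem IsDiag.norm_sub_apply_le {p q : OrthonormalBasis ι ℝ E} {a c : ι → ℝ}
    {A C A' C' : E →L[ℝ] E} (hA : IsDiag p a A) (hC : IsDiag q c C) {f : ℝ → ℝ} {L : ℝ} (hL : 0 ≤ L)
    (hf : ∀ x y, |f x - f y| ≤ L * |x - y|) (hA' : IsDiag p (fun i => f (a i)) A')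
    (hC' : IsDiag q (fun k => f (c k)) C') {B : ℝ} (hB0 : 0 ≤ B)
    (hB : ∀ v, ‖A v - C v‖ ≤ B * ‖v‖) (ha : ∀ i, 0 ≤ a i) (hc : ∀ k, 0 ≤ c k)
    {ℓ : ℝ} (hℓ : 0 ≤ ℓ) {r : ℕ} (hr : (Finset.univ.filter fun i => ℓ < a i).card ≤ r) (x : E) :
    ‖A' x - C' x‖ ^ 2 ≤ L ^ 2 * (2 * r * B ^ 2 + (B + ℓ) ^ 2) * ‖x‖ ^ 2 := by
  classical
  have hB' : ∀ v, ‖C v - A v‖ ≤ B * ‖v‖ := fun v => by rw [norm_sub_rev]; exact hB v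
  have hJr := (hA.card_lt_le hC (ℓ := ℓ) hB).trans hr
  set I := Finset.univ.filter fun i => ℓ < a i with hI
  set J := Finset.univ.filter fun k => ℓ + B < c k with hJ
  set F := A' x - C' x with hF
  have hFcomm : ∀ v, inner ℝ v F = inner ℝ (A' v - C' v) x := fun v => by
    rw [hF, inner_sub_right, inner_sub_left, hA'.inner_comm, hC'.inner_comm]
  -- the component of `F` along the leading eigenvectors of `A`
  have hIpart : ∑ i ∈ I, (inner ℝ (p i) F) ^ 2 ≤ r * (L * B) ^ 2 * ‖x‖ ^ 2 := by
    have h1 : ∀ i ∈ I, (inner ℝ (p i) F) ^ 2 ≤ (L * B) ^ 2 * ‖x‖ ^ 2 := by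
      intro i _
      have hn := hC.norm_sub_basis_le hA hL hf hC' hA' hB' i
      rw [norm_sub_rev] at hn
      rw [hFcomm, ← sq_abs, ← mul_pow]
      refine pow_le_pow_left₀ (abs_nonneg _) ((abs_real_inner_le_norm _ _).trans ?_) 2
      exact mul_le_mul_of_nonneg_right hn (norm_nonneg _)
    refine (Finset.sum_le_card_nsmul _ _ _ h1).trans ?_
    rw [nsmul_eq_mul, mul_assoc]
    have : (I.card : ℝ) ≤ r := by exact_mod_cast hr
    exact mul_le_mul_of_nonneg_right this (by positivity)
  -- the orthogonal component of `F`, and the decomposition of `x` along the eigenvectors of `C`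
  obtain ⟨y, hy⟩ := exists_inner_eq p fun i => if i ∈ I then 0 else inner ℝ (p i) F
  obtain ⟨x', hx'⟩ := exists_inner_eq q fun k => if k ∈ J then 0 else inner ℝ (q k) x
  have hy2 : ‖y‖ ^ 2 = inner ℝ y F := by
    rw [← p.sum_sq_inner_right y, ← p.sum_inner_mul_inner]
    refine Finset.sum_congr rfl fun i _ => ?_
    rw [show inner ℝ y (p i) = inner ℝ (p i) y from real_inner_comm _ _, hy]
    split_ifs <;> ring
  have hsplit : ‖F‖ ^ 2 = ∑ i ∈ I, (inner ℝ (p i) F) ^ 2 + ‖y‖ ^ 2 := by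
    rw [← p.sum_sq_inner_right F, ← p.sum_sq_inner_right y,
      ← Finset.sum_add_sum_compl I fun i => inner ℝ (p i) F ^ 2,
      ← Finset.sum_add_sum_compl I fun i => inner ℝ (p i) y ^ 2,
      Finset.sum_eq_zero (s := I) (f := fun i => inner ℝ (p i) y ^ 2) fun i hi => by
        rw [hy, if_pos hi, zero_pow two_ne_zero], zero_add]
    congr 1
    refine Finset.sum_congr rfl fun i hi => ?_
    rw [hy, if_neg (Finset.mem_compl.1 hi)]
  set xJ := x - x' with hxJ
  have hxJk : ∀ k, inner ℝ (q k) xJ = if k ∈ J then inner ℝ (q k) x else 0 := by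
    intro k
    rw [hxJ, inner_sub_right, hx']
    split_ifs <;> ring
  have hx2 : ‖x‖ ^ 2 = ‖xJ‖ ^ 2 + ‖x'‖ ^ 2 := by
    rw [← q.sum_sq_inner_right x, ← q.sum_sq_inner_right xJ, ← q.sum_sq_inner_right x',
      ← Finset.sum_add_distrib]
    refine Finset.sum_congr rfl fun k _ => ?_
    rw [hxJk, hx']
    split_ifs <;> ring
  have hJpart : |inner ℝ y (A' xJ - C' xJ)| ≤ ‖y‖ * (L * B * (Real.sqrt r * ‖xJ‖)) := by
    have hexp : xJ = ∑ k ∈ J, inner ℝ (q k) xJ • q k := by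
      conv_lhs => rw [← q.sum_repr' xJ]
      symm
      refine Finset.sum_subset (Finset.subset_univ _) fun k _ hk => ?_
      rw [hxJk, if_neg hk, zero_smul]
    have h1 : ‖A' xJ - C' xJ‖ ≤ ∑ k ∈ J, |inner ℝ (q k) xJ| * (L * B) := by
      conv_lhs => rw [hexp]
      rw [map_sum, map_sum, ← Finset.sum_sub_distrib]
      refine (norm_sum_le _ _).trans (Finset.sum_le_sum fun k _ => ?_)
      rw [map_smul, map_smul, ← smul_sub, norm_smul, Real.norm_eq_abs]
      exact mul_le_mul_of_nonneg_left (hA.norm_sub_basis_le hC hL hf hA' hC' hB k) (abs_nonneg _)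
    have h2 : ∑ k ∈ J, |inner ℝ (q k) xJ| ≤ Real.sqrt r * ‖xJ‖ := by
      refine le_of_sq_le_sq (α := ℝ) ?_ (by positivity)
      rw [mul_pow, Real.sq_sqrt (Nat.cast_nonneg r)]
      refine (sq_sum_le_card_mul_sum_sq (s := J) (f := fun k => |inner ℝ (q k) xJ|)).trans ?_
      have h3 : ∑ k ∈ J, |inner ℝ (q k) xJ| ^ 2 ≤ ‖xJ‖ ^ 2 := by
        simp_rw [sq_abs]
        rw [← q.sum_sq_inner_right xJ]
        exact Finset.sum_le_sum_of_subset_of_nonneg (Finset.subset_univ _) fun _ _ _ => sq_nonneg _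
      have : (J.card : ℝ) ≤ r := by exact_mod_cast hJr
      exact mul_le_mul this h3 (Finset.sum_nonneg fun _ _ => by positivity) (Nat.cast_nonneg r)
    refine (abs_real_inner_le_norm _ _).trans (mul_le_mul_of_nonneg_left (h1.trans ?_)
      (norm_nonneg _))
    rw [← Finset.sum_mul, mul_comm]
    exact mul_le_mul_of_nonneg_left h2 (mul_nonneg hL hB0)
  -- on the remaining components, both operators are compared to `f (ℓ / 2)`
  have hpart : |inner ℝ y (A' x' - C' x')| ≤ ‖y‖ * (L * (ℓ + B) * ‖x'‖) := by
    set z := f (ℓ / 2)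
    have h1 : ‖A' y - z • y‖ ≤ L * (ℓ / 2) * ‖y‖ := by
      refine norm_le_of_abs_inner_le p (by positivity) fun i => ?_
      rw [inner_sub_right, inner_smul_right, hA', ← sub_mul, abs_mul]
      by_cases hi : i ∈ I
      · simp [hy, hi]
      · have hai : a i ≤ ℓ := by simpa [hI] using hi
        refine mul_le_mul_of_nonneg_right ((hf _ _).trans (mul_le_mul_of_nonneg_left ?_ hL))
          (abs_nonneg _)
        have := ha i
        rw [abs_le]; constructor <;> linarith
    have h2 : ‖C' x' - z • x'‖ ≤ L * (ℓ / 2 + B) * ‖x'‖ := by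
      refine norm_le_of_abs_inner_le q (by positivity) fun k => ?_
      rw [inner_sub_right, inner_smul_right, hC', ← sub_mul, abs_mul]
      by_cases hk : k ∈ J
      · simp [hx', hk]
      · have hck : c k ≤ ℓ + B := by simpa [hJ] using hk
        refine mul_le_mul_of_nonneg_right ((hf _ _).trans (mul_le_mul_of_nonneg_left ?_ hL))
          (abs_nonneg _)
        have := hc k
        rw [abs_le]; constructor <;> linarith
    have e : inner ℝ y (A' x' - C' x') =
        inner ℝ (A' y - z • y) x' - inner ℝ y (C' x' - z • x') := by
      rw [inner_sub_right, inner_sub_left, inner_sub_right, hA'.inner_comm, inner_smul_left,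
        inner_smul_right, conj_trivial]
      ring
    rw [e]
    refine (abs_sub _ _).trans ?_
    have k1 := (abs_real_inner_le_norm (A' y - z • y) x').trans
      (mul_le_mul_of_nonneg_right h1 (norm_nonneg _))
    have k2 := (abs_real_inner_le_norm y (C' x' - z • x')).trans
      (mul_le_mul_of_nonneg_left h2 (norm_nonneg _))
    linarith
  have hynorm : ‖y‖ ≤ L * B * (Real.sqrt r * ‖xJ‖) + L * (ℓ + B) * ‖x'‖ := by
    rcases (norm_nonneg y).eq_or_lt with h0 | h0
    · rw [← h0]; positivity
    refine le_of_mul_le_mul_left ?_ h0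
    have e : inner ℝ y F = inner ℝ y (A' xJ - C' xJ) + inner ℝ y (A' x' - C' x') := by
      rw [← inner_add_right, hF, hxJ]
      congr 1
      rw [map_sub, map_sub]
      abel
    have := (le_abs_self _).trans
      (abs_add_le (inner ℝ y (A' xJ - C' xJ)) (inner ℝ y (A' x' - C' x')))
    rw [← e, ← hy2] at this
    linarith
  have hy3 : ‖y‖ ^ 2 ≤ L ^ 2 * (r * B ^ 2 + (B + ℓ) ^ 2) * ‖x‖ ^ 2 := by
    refine (pow_le_pow_left₀ (norm_nonneg _) hynorm 2).trans ?_
    have hr2 : Real.sqrt r ^ 2 = r := Real.sq_sqrt (Nat.cast_nonneg r)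
    have hcs : (B * Real.sqrt r * ‖xJ‖ + (ℓ + B) * ‖x'‖) ^ 2 ≤
        ((B * Real.sqrt r) ^ 2 + (ℓ + B) ^ 2) * (‖xJ‖ ^ 2 + ‖x'‖ ^ 2) := by
      nlinarith [sq_nonneg (B * Real.sqrt r * ‖x'‖ - (ℓ + B) * ‖xJ‖)]
    rw [mul_pow, hr2, ← hx2] at hcs
    calc (L * B * (Real.sqrt r * ‖xJ‖) + L * (ℓ + B) * ‖x'‖) ^ 2
        = L ^ 2 * (B * Real.sqrt r * ‖xJ‖ + (ℓ + B) * ‖x'‖) ^ 2 := by ring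
      _ ≤ L ^ 2 * ((B ^ 2 * r + (ℓ + B) ^ 2) * ‖x‖ ^ 2) :=
          mul_le_mul_of_nonneg_left hcs (sq_nonneg L)
      _ = _ := by ring
  rw [hsplit]
  calc _ ≤ r * (L * B) ^ 2 * ‖x‖ ^ 2 + L ^ 2 * (r * B ^ 2 + (B + ℓ) ^ 2) * ‖x‖ ^ 2 :=
        add_le_add hIpart hy3
    _ = _ := by ring

end Perturbation

/-! ### Symmetric matrices as operators on Euclidean space -/

section Matrices

variable {d : ℕ}

/-- The operator on Euclidean space defined by a matrix. -/
abbrev toOp (M : Matrix (Fin d) (Fin d) ℝ) :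
    EuclideanSpace ℝ (Fin d) →L[ℝ] EuclideanSpace ℝ (Fin d) :=
  Matrix.toEuclideanCLM (n := Fin d) (𝕜 := ℝ) M

theorem quadForm_eq_inner (M : Matrix (Fin d) (Fin d) ℝ) (θ : EuclideanSpace ℝ (Fin d)) :
    quadForm M θ = inner ℝ θ (toOp M θ) := by
  rw [Matrix.inner_toEuclideanCLM, quadForm]
  simp only [dotProduct, Matrix.mulVec, Finset.mul_sum, mul_assoc]

theorem isDiag_of_apply_eq {p : OrthonormalBasis (Fin d) ℝ (EuclideanSpace ℝ (Fin d))}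
    {a : Fin d → ℝ} {A : EuclideanSpace ℝ (Fin d) →L[ℝ] EuclideanSpace ℝ (Fin d)}
    (h : ∀ i, A (p i) = a i • p i) : IsDiag p a A := by
  intro i v
  conv_lhs => rw [← p.sum_repr' v]
  simp only [map_sum, map_smul, h, inner_sum, inner_smul_right, p.inner_eq_ite]
  rw [Finset.sum_eq_single i (fun j _ hj => by rw [if_neg hj.symm]; ring) (by simp)]
  simp [mul_comm]

theorem isDiag_toOp {M : Matrix (Fin d) (Fin d) ℝ} (hM : M.IsHermitian) :
    IsDiag hM.eigenvectorBasis hM.eigenvalues (toOp M) := by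
  refine isDiag_of_apply_eq fun i => ?_
  apply WithLp.ofLp_injective 2
  rw [Matrix.ofLp_toEuclideanCLM, hM.mulVec_eigenvectorBasis]
  rfl

theorem isDiag_toOp_spectralMap {M : Matrix (Fin d) (Fin d) ℝ} (hM : M.IsHermitian) (f : ℝ → ℝ) :
    IsDiag hM.eigenvectorBasis (fun i => f (hM.eigenvalues i)) (toOp (spectralMap f M)) := by
  refine isDiag_of_apply_eq fun i => ?_
  apply WithLp.ofLp_injective 2
  rw [Matrix.ofLp_toEuclideanCLM, spectralMap, hM.cfc_eq, Matrix.IsHermitian.cfc,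
    Unitary.conjStarAlgAut_apply, ← Matrix.mulVec_mulVec, ← Matrix.mulVec_mulVec,
    hM.star_eigenvectorUnitary_mulVec, Matrix.diagonal_mulVec_single, mul_one,
    ← mul_one ((RCLike.ofReal ∘ f ∘ hM.eigenvalues) i), ← smul_eq_mul, Pi.single_smul,
    Matrix.mulVec_smul, hM.eigenvectorUnitary_mulVec]
  rfl

theorem IsDiag.apply_self {p : OrthonormalBasis (Fin d) ℝ (EuclideanSpace ℝ (Fin d))}
    {a : Fin d → ℝ} {M : Matrix (Fin d) (Fin d) ℝ} (h : IsDiag p a (toOp M)) (i : Fin d) :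
    quadForm M (p i) = a i := by
  rw [quadForm_eq_inner, h, real_inner_self_eq_norm_sq, p.norm_eq_one]
  ring

theorem spectralMap_isHermitian (M : Matrix (Fin d) (Fin d) ℝ) (f : ℝ → ℝ) :
    (spectralMap f M).IsHermitian :=
  cfc_predicate f M

theorem norm_toOp_le_of_abs_quadForm_le {M : Matrix (Fin d) (Fin d) ℝ} (hM : M.IsHermitian) {B : ℝ}
    (hB : 0 ≤ B) (h : ∀ θ : EuclideanSpace ℝ (Fin d), ‖θ‖ = 1 → |quadForm M θ| ≤ B)
    (v : EuclideanSpace ℝ (Fin d)) : ‖toOp M v‖ ≤ B * ‖v‖ := by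
  refine norm_le_of_abs_inner_le hM.eigenvectorBasis hB fun i => ?_
  rw [isDiag_toOp hM, abs_mul, ← (isDiag_toOp hM).apply_self]
  exact mul_le_mul_of_nonneg_right (h _ (hM.eigenvectorBasis.norm_eq_one i)) (abs_nonneg _)

/-- Taking the positive part moves an operator by no more than the size of its negative part. -/
theorem norm_toOp_posPart_sub_le {M : Matrix (Fin d) (Fin d) ℝ} (hM : M.IsHermitian) {B : ℝ}
    (hB : 0 ≤ B) (h : ∀ θ : EuclideanSpace ℝ (Fin d), ‖θ‖ = 1 → -B ≤ quadForm M θ)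
    (v : EuclideanSpace ℝ (Fin d)) : ‖toOp (posPart M) v - toOp M v‖ ≤ B * ‖v‖ := by
  refine norm_le_of_abs_inner_le hM.eigenvectorBasis hB fun i => ?_
  rw [inner_sub_right, posPart, isDiag_toOp_spectralMap hM, isDiag_toOp hM, ← sub_mul, abs_mul]
  refine mul_le_mul_of_nonneg_right ?_ (abs_nonneg _)
  have := h _ (hM.eigenvectorBasis.norm_eq_one i)
  rw [(isDiag_toOp hM).apply_self] at this
  change |max (hM.eigenvalues i) 0 - hM.eigenvalues i| ≤ B
  rcases le_total (hM.eigenvalues i) 0 with h0 | h0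
  · rw [max_eq_right h0, zero_sub, abs_neg, abs_of_nonpos h0]; linarith
  · rw [max_eq_left h0, sub_self, abs_zero]; exact hB

theorem quadForm_posPart_nonneg {M : Matrix (Fin d) (Fin d) ℝ} (hM : M.IsHermitian)
    (θ : EuclideanSpace ℝ (Fin d)) : 0 ≤ quadForm (posPart M) θ := by
  rw [quadForm_eq_inner, posPart, (isDiag_toOp_spectralMap hM _).inner_apply]
  exact Finset.sum_nonneg fun i _ => mul_nonneg (le_max_right _ _) (mul_self_nonneg _)

theorem frobNorm_eq (M : Matrix (Fin d) (Fin d) ℝ) :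
    frobNorm M = Real.sqrt (∑ i, ∑ j, M i j ^ 2) := by
  rw [frobNorm, Finset.sum_comm]
  simp only [Matrix.trace, Matrix.diag, Matrix.mul_apply, Matrix.transpose_apply, sq]

theorem norm_toOp_le_frobNorm (M : Matrix (Fin d) (Fin d) ℝ) (v : EuclideanSpace ℝ (Fin d)) :
    ‖toOp M v‖ ≤ frobNorm M * ‖v‖ := by
  refine le_of_sq_le_sq (α := ℝ) ?_ (mul_nonneg (Real.sqrt_nonneg _) (norm_nonneg _))
  rw [mul_pow, frobNorm_eq, Real.sq_sqrt (by positivity), EuclideanSpace.real_norm_sq_eq,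
    EuclideanSpace.real_norm_sq_eq, Finset.sum_mul]
  refine Finset.sum_le_sum fun i _ => ?_
  rw [Matrix.ofLp_toEuclideanCLM]
  exact Finset.sum_mul_sq_le_sq_mul_sq Finset.univ (M i) v

theorem abs_quadForm_sub_le (M : Matrix (Fin d) (Fin d) ℝ) {θ ξ : EuclideanSpace ℝ (Fin d)}
    (hθ : ‖θ‖ = 1) (hξ : ‖ξ‖ = 1) {δ : ℝ} (h : ‖θ - ξ‖ ≤ δ) :
    |quadForm M θ - quadForm M ξ| ≤ 2 * δ * frobNorm M := by
  have hF : 0 ≤ frobNorm M := Real.sqrt_nonneg _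
  have e : quadForm M θ - quadForm M ξ =
      inner ℝ (θ - ξ) (toOp M θ) + inner ℝ ξ (toOp M (θ - ξ)) := by
    rw [quadForm_eq_inner, quadForm_eq_inner, map_sub, inner_sub_left, inner_sub_right]
    ring
  have h1 := abs_real_inner_le_norm (θ - ξ) (toOp M θ)
  have h2 := abs_real_inner_le_norm ξ (toOp M (θ - ξ))
  have h3 := norm_toOp_le_frobNorm M θ
  have h4 := norm_toOp_le_frobNorm M (θ - ξ)
  rw [hθ, mul_one] at h3
  rw [hξ, one_mul] at h2
  have h5 := mul_le_mul h h3 (norm_nonneg _) ((norm_nonneg _).trans h)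
  have h6 := mul_le_mul_of_nonneg_left h hF
  rw [e]
  refine (abs_add_le _ _).trans ?_
  linarith

end Matrices

/-! ### The spectrum of the Gram matrix -/

section Gram

variable {d : ℕ} (P : Measure (EuclideanSpace ℝ (Fin d)))

theorem gramEigenvalue_eq (i : Fin d) :
    ∃ k, gramEigenvalue P i = (gram_isHermitian P).eigenvalues k :=
  ⟨Fintype.equivOfCardEq (Fintype.card_fin _) (Fin.cast (Fintype.card_fin d).symm i), by
    rw [Matrix.IsHermitian.eigenvalues, Equiv.symm_apply_apply]; rfl⟩

variable {P} [IsProbabilityMeasure P]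

theorem eigenvalues_gram_eq (hP : Integrable (fun x => ‖x‖ ^ 4) P) (k : Fin d) :
    (gram_isHermitian P).eigenvalues k =
      secondMoment P ((gram_isHermitian P).eigenvectorBasis k) := by
  rw [← quadForm_gram hP, (isDiag_toOp (gram_isHermitian P)).apply_self]

theorem eigenvalues_gram_nonneg (hP : Integrable (fun x => ‖x‖ ^ 4) P) (k : Fin d) :
    0 ≤ (gram_isHermitian P).eigenvalues k := by
  rw [eigenvalues_gram_eq hP]
  exact secondMoment_nonneg _

theorem gramEigenvalue_le_s4sq (hP : Integrable (fun x => ‖x‖ ^ 4) P) (i : Fin d) :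
    gramEigenvalue P i ≤ s4sq P := by
  obtain ⟨k, hk⟩ := gramEigenvalue_eq P i
  rw [hk, eigenvalues_gram_eq hP]
  exact secondMoment_le hP _ ((gram_isHermitian P).eigenvectorBasis.norm_eq_one k)

theorem secondMoment_le_gramEigenvalue [NeZero d] (hP : Integrable (fun x => ‖x‖ ^ 4) P)
    {θ : EuclideanSpace ℝ (Fin d)} (hθ : ‖θ‖ = 1) : secondMoment P θ ≤ gramEigenvalue P 0 := by
  rw [← quadForm_gram hP, quadForm_eq_inner, (isDiag_toOp (gram_isHermitian P)).inner_apply,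
    ← mul_one (gramEigenvalue P 0), ← one_pow 2, ← hθ,
    ← (gram_isHermitian P).eigenvectorBasis.sum_sq_inner_right θ, Finset.mul_sum]
  refine Finset.sum_le_sum fun i _ => ?_
  rw [← sq]
  refine mul_le_mul_of_nonneg_right ((gram_isHermitian P).eigenvalues₀_antitone ?_) (sq_nonneg _)
  exact Fin.le_def.2 (by simp)

/-- A level above which there are at most `r` eigenvalues of the Gram matrix, namely
`λ_{r+1}`, or `0` if `r = d`. -/
theorem exists_eigenvalue_level (hP : Integrable (fun x => ‖x‖ ^ 4) P) {r : ℕ} (hr : r ≤ d) :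
    ∃ ℓ : ℝ, 0 ≤ ℓ ∧
      (Finset.univ.filter fun i => ℓ < (gram_isHermitian P).eigenvalues i).card ≤ r ∧
      ℓ ^ 2 ≤ ∑ i ∈ Finset.univ.filter (fun i : Fin d => r ≤ (i : ℕ)), gramEigenvalue P i ^ 2 := by
  rcases hr.eq_or_lt with rfl | hrd
  · refine ⟨0, le_rfl, (Finset.card_le_univ _).trans (by simp), ?_⟩
    rw [zero_pow two_ne_zero]
    positivity
  · refine ⟨gramEigenvalue P ⟨r, hrd⟩, ?_, ?_, ?_⟩
    · obtain ⟨k, hk⟩ := gramEigenvalue_eq P ⟨r, hrd⟩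
      rw [hk]
      exact eigenvalues_gram_nonneg hP k
    · refine (Finset.card_le_card_of_injOn (t := Finset.range r)
        (fun i => ((Fintype.equivOfCardEq (Fintype.card_fin _)).symm i :
          Fin (Fintype.card (Fin d))))
        (fun i hi => ?_) (fun i _ j _ hij => by simpa [Fin.val_inj] using hij)).trans
        (Finset.card_range r).le
      have hi' := (Finset.mem_filter.1 hi).2
      simp only [Finset.coe_range, Set.mem_Iio]
      by_contra hge
      push Not at hge
      exact absurd ((gram_isHermitian P).eigenvalues₀_antitone
        (a := Fin.cast (Fintype.card_fin d).symm ⟨r, hrd⟩) hge) (not_le.2 hi')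
    · exact Finset.single_le_sum (f := fun i => gramEigenvalue P i ^ 2) (fun _ _ => sq_nonneg _)
        (by simp)

end Gram

/-! ### The convex program -/

section Program

variable {n d : ℕ} {κ s a ε σ : ℝ} {Θ : Finset (EuclideanSpace ℝ (Fin d))}
  {x : Fin n → EuclideanSpace ℝ (Fin d)}

theorem continuous_quadForm (θ : EuclideanSpace ℝ (Fin d)) :
    Continuous fun Q : Matrix (Fin d) (Fin d) ℝ => quadForm Q θ := by
  unfold quadForm
  fun_prop

theorem continuous_frobNorm : Continuous (frobNorm (d := d)) := by
  unfold frobNorm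
  fun_prop

theorem isClosed_feasible : IsClosed (feasible κ s a ε σ Θ x) := by
  have h1 : IsClosed {Q : Matrix (Fin d) (Fin d) ℝ | Q.IsSymm} :=
    isClosed_eq (by fun_prop) continuous_id
  have h2 : ∀ θ ∈ Θ, IsClosed {Q : Matrix (Fin d) (Fin d) ℝ | 0 ≤ quadForm Q θ ∧
      ∀ j < gridSize n κ a, InConfidenceInterval κ s a ε σ x j θ (quadForm Q θ)} := by
    intro θ _
    have hq := continuous_quadForm θ
    have h3 : ∀ j < gridSize n κ a, IsClosed {Q : Matrix (Fin d) (Fin d) ℝ |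
        InConfidenceInterval κ s a ε σ x j θ (quadForm Q θ)} := by
      intro j _
      unfold InConfidenceInterval
      refine isClosed_imp (X := Matrix (Fin d) (Fin d) ℝ) isOpen_const
        (isClosed_le ?_ continuous_const)
      exact ((hq.max continuous_const).sub continuous_const).abs
    have h4 := (isClosed_le (f := fun _ => (0 : ℝ)) continuous_const hq).inter
      (isClosed_iInter fun j => isClosed_iInter fun hj => h3 j hj)
    convert! h4 using 1
    ext Q
    simp
  convert! h1.inter (isClosed_biInter h2) using 1
  ext Q
  simp [feasible]

theorem abs_apply_le_frobNorm (M : Matrix (Fin d) (Fin d) ℝ) (i j : Fin d) :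
    |M i j| ≤ frobNorm M := by
  rw [frobNorm_eq]
  refine Real.abs_le_sqrt ?_
  refine (Finset.single_le_sum (f := fun j => M i j ^ 2) (fun _ _ => sq_nonneg _)
    (Finset.mem_univ j)).trans ?_
  exact Finset.single_le_sum (f := fun i => ∑ j, M i j ^ 2)
    (fun _ _ => Finset.sum_nonneg fun _ _ => sq_nonneg _) (Finset.mem_univ i)

theorem isCompact_frobNorm_le (R : ℝ) :
    IsCompact {M : Matrix (Fin d) (Fin d) ℝ | frobNorm M ≤ R} := by
  have h : IsCompact (Set.pi Set.univ fun _ : Fin d => Set.pi Set.univ fun _ : Fin d =>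
      Set.Icc (-R) R) := isCompact_univ_pi fun _ => isCompact_univ_pi fun _ => isCompact_Icc
  refine h.of_isClosed_subset (isClosed_le continuous_frobNorm continuous_const) ?_
  intro M hM i _ j _
  exact abs_le.1 ((abs_apply_le_frobNorm M i j).trans hM)

/-- A closed set of matrices containing `G` has an element of least norm, as the ball of radius
`‖G‖_F` is compact. The convexity of the set is not needed. -/
theorem exists_isLeastNormFeasible {G : Matrix (Fin d) (Fin d) ℝ}
    (hG : G ∈ feasible κ s a ε σ Θ x) : ∃ Q, IsLeastNormFeasible κ s a ε σ Θ x Q := by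
  obtain ⟨Q, hQ, hmin⟩ := ((isCompact_frobNorm_le (frobNorm G)).inter_left
    (isClosed_feasible (κ := κ) (s := s) (a := a) (ε := ε) (σ := σ) (Θ := Θ)
      (x := x))).exists_isMinOn
    ⟨G, hG, le_refl (frobNorm G)⟩ continuous_frobNorm.continuousOn
  refine ⟨Q, hQ.1, fun Q' hQ' => ?_⟩
  rcases le_total (frobNorm Q') (frobNorm G) with h | h
  · exact hmin ⟨hQ', h⟩
  · exact le_trans hQ.2 h

theorem estQ_isLeastNormFeasible {G : Matrix (Fin d) (Fin d) ℝ}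
    (hG : G ∈ feasible κ s a ε σ Θ x) :
    IsLeastNormFeasible κ s a ε σ Θ x (estQ κ s a ε σ Θ x) := by
  rw [estQ, dif_pos (exists_isLeastNormFeasible hG)]
  exact (exists_isLeastNormFeasible hG).choose_spec

end Program

/-! ### The deviation of the estimator -/

section Deviation

variable {n d : ℕ} {P : Measure (EuclideanSpace ℝ (Fin d))} [IsProbabilityMeasure P]
  {a ε σ δ : ℝ} {Θ : Finset (EuclideanSpace ℝ (Fin d))} {x : Fin n → EuclideanSpace ℝ (Fin d)}

variable (P a ε x) in
/-- The samples for which the criterion is controlled at all the scales, and on the whole sphere. -/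
def IsGoodSample : Prop :=
  ∀ j < gridSize n (kurtosis P) a, ∀ θ : EuclideanSpace ℝ (Fin d), ‖θ‖ = 1 →
    CriterionBounds (secondMoment P θ) (Ntilde x (lamGrid n (kurtosis P) a ε j) θ) (kurtosis P)
      (lamGrid n (kurtosis P) a ε j) (muGrid n (kurtosis P) (s4sq P) a ε j)
      (gammaGrid n (kurtosis P) (s4sq P) a ε j) (betaGrid n (kurtosis P) (s4sq P) a j / (2 * n))

/-- On a good sample the confidence intervals contain the true values `θᵀ G θ`. -/
theorem gram_mem_feasible (hP : Integrable (fun x => ‖x‖ ^ 4) P) (hn : 0 < n)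
    (hκ : 3 / 2 ≤ kurtosis P) (hs : 0 < s4sq P) (hσ : 0 < σ)
    (hL : 0 ≤ Real.log (gridSize n (kurtosis P) a / ε)) (hΘ : ∀ ξ ∈ Θ, ‖ξ‖ = 1)
    (hx : IsGoodSample P a ε x) :
    gram P ∈ feasible (kurtosis P) (s4sq P) a ε σ Θ x := by
  refine ⟨(gram_isHermitian P), fun θ hθ => ?_⟩
  rw [quadForm_gram hP]
  refine ⟨secondMoment_nonneg θ, fun j hj h6 => ?_⟩
  simp only [rhoGrid_eq] at h6 ⊢
  exact (hx j hj θ (hΘ θ hθ)).abs_max_sub_le (scaleBounds_grid hn hκ hs hL j)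
    (secondMoment_nonneg θ) hσ h6

/-- The relative accuracy `n^{-1/2} ζ(t) / (1 - 4 n^{-1/2} ζ(t))`, that is, `B_*(t)` for
`t ≥ σ` where it is finite. -/
def relDev (n : ℕ) (κ s a ε t : ℝ) : ℝ :=
  (Real.sqrt n)⁻¹ * zeta n κ s a ε t / (1 - 4 * (Real.sqrt n)⁻¹ * zeta n κ s a ε t)

/-- On the net, `ξᵀ Q ξ` and `ξᵀ G ξ` both belong to the confidence interval at the scale adapted to
`ξᵀ G ξ`, at a bounded distance from its centre; this bound is non-decreasing in `ξᵀ G ξ`, which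
is at most `λ₁`. -/
theorem abs_quadForm_sub_secondMoment_le [NeZero d] (hP : Integrable (fun x => ‖x‖ ^ 4) P)
    (hn : 0 < n) (ha : 0 < a) (hκ : 3 / 2 ≤ kurtosis P) (hs : 0 < s4sq P) (hσ : 0 < σ)
    (hσs : σ ≤ s4sq P) (hL : 0 ≤ Real.log (gridSize n (kurtosis P) a / ε))
    (hζ : 8 * zeta n (kurtosis P) (s4sq P) a ε σ ≤ Real.sqrt n)
    (hΘ : ∀ ξ ∈ Θ, ‖ξ‖ = 1) (hx : IsGoodSample P a ε x) {Q : Matrix (Fin d) (Fin d) ℝ}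
    (hQ : Q ∈ feasible (kurtosis P) (s4sq P) a ε σ Θ x) {ξ : EuclideanSpace ℝ (Fin d)}
    (hξ : ξ ∈ Θ) :
    |quadForm Q ξ - secondMoment P ξ| ≤ 2 * (max (gramEigenvalue P 0) σ *
      relDev n (kurtosis P) (s4sq P) a ε (max (gramEigenvalue P 0) σ)) + σ := by
  set κ := kurtosis P
  set s := s4sq P
  set N := secondMoment P ξ with hN
  set T := max N σ with hT
  have hN0 : 0 ≤ N := secondMoment_nonneg ξ
  have hσT : σ ≤ T := le_max_right _ _
  have hTs : T ≤ s := max_le (secondMoment_le hP ξ (hΘ ξ hξ)) hσs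
  have hTl : T ≤ max (gramEigenvalue P 0) σ :=
    max_le_max_right _ (secondMoment_le_gramEigenvalue hP (hΘ ξ hξ))
  have hR : 0 < Real.sqrt n := Real.sqrt_pos.2 (Nat.cast_pos.2 hn)
  obtain ⟨j, hj, hη⟩ := exists_scale hn ha hκ hs hσ hL hζ hσT hTs
  have hζT : 8 * zeta n κ s a ε T ≤ Real.sqrt n := by
    linarith [zeta_antitone (n := n) (a := a) (ε := ε) hκ hs hσ hσT]
  set η := (Real.sqrt n)⁻¹ * zeta n κ s a ε T with hηdef
  have h8 : η ≤ 1 / 8 := by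
    rw [hηdef, inv_mul_le_iff₀ hR]; linarith
  rw [rhoGrid_eq] at hη
  have hc := hx j hj ξ (hΘ ξ hξ)
  have hsc := scaleBounds_grid hn hκ hs hL j
  obtain ⟨h6, hw⟩ := hc.width_le hsc hN0 hσ hη h8
  have hG := hc.abs_max_sub_le hsc hN0 hσ h6
  have hQξ := hQ.2 ξ hξ
  have hQj := hQξ.2 j hj
  unfold InConfidenceInterval at hQj
  simp only [rhoGrid_eq] at hQj
  have hQ' := hQj h6
  have hmono := mul_bound_monotone hn hκ hs (hσ.trans_le hσT) hTl hL hζT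
  have hrel : η / (1 - 4 * η) = relDev n κ s a ε T := by
    rw [relDev, hηdef, mul_assoc 4]
  rw [hrel] at hw
  change T * relDev n κ s a ε T ≤ _ * relDev n κ s a ε _ at hmono
  -- thresholding at `σ` moves a nonnegative number by at most `σ`
  have hmax : ∀ t : ℝ, 0 ≤ t → t ≤ max t σ ∧ max t σ ≤ t + σ := fun t ht =>
    ⟨le_max_left _ _, max_le (by linarith) (by linarith)⟩
  obtain ⟨m1, m2⟩ := hmax _ hN0
  obtain ⟨m3, m4⟩ := hmax _ hQξ.1
  rw [abs_le] at hG hQ' ⊢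
  constructor <;> linarith [hG.1, hG.2, hQ'.1, hQ'.2]

/-- The extension from the net to the sphere costs `2 δ (‖G‖_F + ‖Q‖_F) ≤ 4 δ ‖G‖_F`, and the
positive part `2 δ ‖Q‖_F ≤ 2 δ ‖G‖_F`, because `Q` is nonnegative on the net. -/
theorem norm_gram_sub_estGram_le [NeZero d] (hP : Integrable (fun x => ‖x‖ ^ 4) P)
    (hn : 0 < n) (ha : 0 < a) (hκ : 3 / 2 ≤ kurtosis P) (hs : 0 < s4sq P) (hσ : 0 < σ)
    (hσs : σ ≤ s4sq P) (hδ : 0 < δ) (hL : 0 ≤ Real.log (gridSize n (kurtosis P) a / ε))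
    (hζ : 8 * zeta n (kurtosis P) (s4sq P) a ε σ ≤ Real.sqrt n)
    (hΘ : IsSphereNet δ Θ) (hx : IsGoodSample P a ε x) (v : EuclideanSpace ℝ (Fin d)) :
    ‖toOp (gram P) v - toOp (estGram (kurtosis P) (s4sq P) a ε σ Θ x) v‖ ≤
      (2 * max (gramEigenvalue P 0) σ *
        relDev n (kurtosis P) (s4sq P) a ε (max (gramEigenvalue P 0) σ)
        + (7 * δ * frobNorm (gram P) + σ)) * ‖v‖ := by
  have hGf := gram_mem_feasible hP hn hκ hs hσ hL hΘ.1 hx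
  obtain ⟨hQf, hQmin⟩ := estQ_isLeastNormFeasible hGf
  rw [estGram]
  set Q := estQ (kurtosis P) (s4sq P) a ε σ Θ x
  have hQF := hQmin _ hGf
  have hQH : Q.IsHermitian := hQf.1
  have hF0 : 0 ≤ frobNorm (gram P) := Real.sqrt_nonneg _
  have hδF := mul_le_mul_of_nonneg_left hQF hδ.le
  have hδF0 := mul_nonneg hδ.le hF0
  set D := 2 * (max (gramEigenvalue P 0) σ *
    relDev n (kurtosis P) (s4sq P) a ε (max (gramEigenvalue P 0) σ)) + σ with hD
  have hnet : ∀ ξ ∈ Θ, |quadForm Q ξ - secondMoment P ξ| ≤ D := fun ξ hξ =>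
    abs_quadForm_sub_secondMoment_le hP hn ha hκ hs hσ hσs hL hζ hΘ.1 hx hQf hξ
  -- the net is not empty, so that the bound `D` is nonnegative
  obtain ⟨ξ₀, hξ₀, -⟩ := hΘ.2 (EuclideanSpace.single 0 1) (by simp)
  have hD0 : 0 ≤ D := (abs_nonneg _).trans (hnet ξ₀ hξ₀)
  have hsub : ∀ θ, quadForm (gram P - Q) θ = quadForm (gram P) θ - quadForm Q θ := fun θ => by
    rw [quadForm_eq_inner, quadForm_eq_inner, quadForm_eq_inner, ← inner_sub_right]
    simp [toOp]
  have h1 := norm_toOp_le_of_abs_quadForm_le ((gram_isHermitian P).sub hQH)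
    (B := D + 4 * δ * frobNorm (gram P)) (by linarith) (fun θ hθ => by
      obtain ⟨ξ, hξ, hθξ⟩ := hΘ.2 θ hθ
      have k1 := abs_le.1 (abs_quadForm_sub_le (gram P) hθ (hΘ.1 ξ hξ) hθξ)
      have k2 := abs_le.1 (abs_quadForm_sub_le Q hθ (hΘ.1 ξ hξ) hθξ)
      have k3 := abs_le.1 (hnet ξ hξ)
      rw [quadForm_gram hP ξ] at k1
      rw [hsub, abs_le]
      constructor <;> linarith [k1.1, k1.2, k2.1, k2.2, k3.1, k3.2]) v
  have h2 := norm_toOp_posPart_sub_le hQH (B := 2 * δ * frobNorm (gram P)) (by linarith)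
    (fun θ hθ => by
      obtain ⟨ξ, hξ, hθξ⟩ := hΘ.2 θ hθ
      have k2 := abs_le.1 (abs_quadForm_sub_le Q hθ (hΘ.1 ξ hξ) hθξ)
      linarith [k2.1, (hQf.2 ξ hξ).1]) v
  have e : toOp (gram P) v - toOp (posPart Q) v =
      toOp (gram P - Q) v - (toOp (posPart Q) v - toOp Q v) := by
    simp [toOp]
  rw [e]
  refine (norm_sub_le _ _).trans ((add_le_add h1 h2).trans ?_)
  rw [← add_mul]
  refine mul_le_mul_of_nonneg_right ?_ (norm_nonneg v)
  rw [hD]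
  linarith

/-- The deviation function at `λ₁` is finite: `λ₁ ≤ s₄²`, and `6 + (κ - 1)⁻¹ ≤ 8` as `κ ≥ 3 / 2`. -/
theorem Bdev_gramEigenvalue_zero [NeZero d] (hP : Integrable (fun x => ‖x‖ ^ 4) P) (hn : 0 < n)
    (hκ : 3 / 2 ≤ kurtosis P) (hs : 0 < s4sq P) (hσ : 0 < σ) (hδ : 0 < δ)
    (hζ : 8 * zeta n (kurtosis P) (s4sq P) a ε σ ≤ Real.sqrt n) :
    Bdev P n a ε σ δ (gramEigenvalue P 0) = ENNReal.ofReal (2 * max (gramEigenvalue P 0) σ *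
        relDev n (kurtosis P) (s4sq P) a ε (max (gramEigenvalue P 0) σ)
        + (7 * δ * frobNorm (gram P) + σ)) := by
  set T := max (gramEigenvalue P 0) σ with hT
  have hσT : σ ≤ T := le_max_right _ _
  have hR : 0 < Real.sqrt n := Real.sqrt_pos.2 (Nat.cast_pos.2 hn)
  have hF0 : 0 ≤ frobNorm (gram P) := Real.sqrt_nonneg _
  have hz := zeta_antitone (n := n) (a := a) (ε := ε) hκ hs hσ hσT
  have hz0 : 0 ≤ zeta n (kurtosis P) (s4sq P) a ε T := (Real.sqrt_nonneg _).trans sqrt_le_zeta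
  have hinv : (kurtosis P - 1)⁻¹ ≤ 2 := by
    rw [inv_le_comm₀ (by linarith) two_pos]; linarith
  have hη : (Real.sqrt n)⁻¹ * zeta n (kurtosis P) (s4sq P) a ε T ≤ 1 / 8 := by
    rw [inv_mul_le_iff₀ hR]; linarith
  have hrel : 0 ≤ relDev n (kurtosis P) (s4sq P) a ε T := by
    rw [relDev]
    refine div_nonneg (by positivity) ?_
    rw [mul_assoc]
    linarith
  rw [Bdev, min_eq_left (gramEigenvalue_le_s4sq hP 0), Bstar, ← hT, if_pos, ← ENNReal.ofReal_mul,
    ← ENNReal.ofReal_add]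
  · rfl
  · exact mul_nonneg (by linarith) hrel
  · positivity
  · linarith
  · refine le_trans ?_ (show 8 * zeta n (kurtosis P) (s4sq P) a ε T ≤ _ by linarith)
    exact mul_le_mul_of_nonneg_right (by linarith) hz0

end Deviation

/-! ### The event of large probability and the operator norm bound -/

section Conclusion

variable {n d : ℕ} {P : Measure (EuclideanSpace ℝ (Fin d))} [IsProbabilityMeasure P]
  {a ε : ℝ}

/-- A union bound over the `K` scales, each with the probability of failure `2 ε / K`. -/
theorem exists_isGoodSample (hP : Integrable (fun x => ‖x‖ ^ 4) P) (hn : 0 < n) (hε : 0 < ε)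
    (hκ : 3 / 2 ≤ kurtosis P) (hs : 0 < s4sq P)
    (hL : 0 ≤ Real.log (gridSize n (kurtosis P) a / ε)) :
    ∃ S : Set (Fin n → EuclideanSpace ℝ (Fin d)), MeasurableSet S ∧
      Measure.pi (fun _ : Fin n => P) Sᶜ ≤ ENNReal.ofReal (2 * ε) ∧
      ∀ x ∈ S, IsGoodSample P a ε x := by
  set K := gridSize n (kurtosis P) a with hKdef
  have hK : (0 : ℝ) < K := by
    have : 0 < K := by rw [hKdef, gridSize]; omega
    exact_mod_cast this
  choose S hSm hSP hS using fun j : ℕ => exists_samples_abs_rCrit_sub_le (P := P) hP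
    (by linarith : 0 < kurtosis P) hs hn (lamGrid n (kurtosis P) a ε j)
    (betaGrid_pos (a := a) hn hκ hs j) (div_pos hε hK)
  refine ⟨⋂ j ∈ Finset.range K, S j, Finset.measurableSet_biInter _ fun j _ => hSm j, ?_, ?_⟩
  · rw [Set.compl_iInter₂]
    refine (measure_biUnion_finset_le _ _).trans ((Finset.sum_le_sum fun j _ => hSP j).trans ?_)
    rw [Finset.sum_const, Finset.card_range, nsmul_eq_mul, ← ENNReal.ofReal_natCast,
      ← ENNReal.ofReal_mul hK.le]
    refine ENNReal.ofReal_le_ofReal (le_of_eq ?_)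
    field_simp
  · intro x hx j hj θ hθ
    have hxj : x ∈ S j := Set.mem_iInter₂.1 hx j (Finset.mem_range.2 hj)
    have h := hS j x hxj
    rw [inv_div] at h
    exact criterionBounds_of_abs_rCrit_sub_le (lamGrid_pos hn hκ hL j)
      (betaGrid_pos hn hκ hs j) hn h hθ

theorem sqrt_le_add_sqrt {B ℓ τ : ℝ} (hB : 0 ≤ B) (hτ : ℓ ^ 2 ≤ τ) (r : ℕ) :
    Real.sqrt (2 * r * B ^ 2 + (B + ℓ) ^ 2) ≤ B + Real.sqrt (4 * r * B ^ 2 + 2 * τ) := by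
  have hr : (0 : ℝ) ≤ r * B ^ 2 := by positivity
  have hτ0 : 0 ≤ τ := (sq_nonneg ℓ).trans hτ
  have h0 : 0 ≤ 4 * r * B ^ 2 + 2 * τ := by linarith
  have hw := Real.sq_sqrt h0
  have hw0 := Real.sqrt_nonneg (4 * r * B ^ 2 + 2 * τ)
  set w := Real.sqrt (4 * r * B ^ 2 + 2 * τ)
  have hℓw : ℓ ≤ w := le_of_sq_le_sq (α := ℝ) (by linarith) hw0
  rw [Real.sqrt_le_left (by linarith)]
  nlinarith [mul_le_mul_of_nonneg_left hℓw hB]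

theorem opNorm_spectralMap_sub_le (hP : Integrable (fun x => ‖x‖ ^ 4) P)
    {M : Matrix (Fin d) (Fin d) ℝ} (hM : M.IsHermitian) {B : ℝ} (hB0 : 0 ≤ B)
    (hB : ∀ v, ‖toOp (gram P) v - toOp (posPart M) v‖ ≤ B * ‖v‖) {f : ℝ → ℝ} {c : ℝ≥0}
    (hf : LipschitzWith c f) {r : ℕ} (hr : r ≤ d) :
    opNorm (spectralMap f (gram P) - spectralMap f (posPart M)) ≤
      c * (B + Real.sqrt (4 * r * B ^ 2 +
        2 * ∑ i ∈ Finset.univ.filter (fun i : Fin d => r ≤ (i : ℕ)), gramEigenvalue P i ^ 2)) := by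
  obtain ⟨ℓ, hℓ, hcard, hτ⟩ := exists_eigenvalue_level hP hr
  have hMp : (posPart M).IsHermitian := spectralMap_isHermitian _ _
  refine le_trans ?_ (mul_le_mul_of_nonneg_left (sqrt_le_add_sqrt hB0 hτ r) c.coe_nonneg)
  refine ContinuousLinearMap.opNorm_le_bound _ (by positivity) fun v => ?_
  have h := (isDiag_toOp (gram_isHermitian P)).norm_sub_apply_le (isDiag_toOp hMp) c.coe_nonneg
    (fun x y => by simpa [Real.dist_eq] using hf.dist_le_mul x y)
    (isDiag_toOp_spectralMap (gram_isHermitian P) f) (isDiag_toOp_spectralMap hMp f) hB0 hB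
    (eigenvalues_gram_nonneg hP)
    (fun k => by
      rw [← (isDiag_toOp hMp).apply_self]
      exact quadForm_posPart_nonneg hM _) hℓ hcard v
  rw [map_sub, sub_apply]
  refine le_of_sq_le_sq (α := ℝ) (h.trans (le_of_eq ?_)) (by positivity)
  rw [mul_pow, mul_pow, Real.sq_sqrt (by positivity)]

theorem ofReal_mul_add_sqrt (L : ℝ≥0) (hL : 0 < L) {B τ : ℝ} (hB : 0 ≤ B) (hτ : 0 ≤ τ) (r : ℕ) :
    ENNReal.ofReal ((L⁻¹ : ℝ≥0) * (B + Real.sqrt (4 * r * B ^ 2 + τ))) =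
      (L : ℝ≥0∞)⁻¹ * (ENNReal.ofReal B + (4 * (r : ℝ≥0∞) * ENNReal.ofReal B ^ 2 +
        ENNReal.ofReal τ) ^ (1 / 2 : ℝ)) := by
  have h0 : 0 ≤ 4 * (r : ℝ) * B ^ 2 := by positivity
  rw [ENNReal.ofReal_mul (NNReal.coe_nonneg _), ENNReal.ofReal_coe_nnreal, ENNReal.coe_inv hL.ne',
    ENNReal.ofReal_add hB (Real.sqrt_nonneg _), Real.sqrt_eq_rpow,
    ← ENNReal.ofReal_rpow_of_nonneg (by positivity) (by norm_num), ENNReal.ofReal_add h0 hτ,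
    ENNReal.ofReal_mul (by positivity), ENNReal.ofReal_mul (by norm_num),
    ENNReal.ofReal_pow hB, ENNReal.ofReal_natCast, ENNReal.ofReal_ofNat]

theorem estQ_isHermitian {κ s σ : ℝ} {Θ : Finset (EuclideanSpace ℝ (Fin d))}
    {x : Fin n → EuclideanSpace ℝ (Fin d)} {G : Matrix (Fin d) (Fin d) ℝ}
    (hG : G ∈ feasible κ s a ε σ Θ x) : (estQ κ s a ε σ Θ x).IsHermitian :=
  (estQ_isLeastNormFeasible hG).1.1

end Conclusion

end RobustPCA
end

theorem proposition5p2 {d : ℕ} [NeZero d] {n : ℕ}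
    (P : Measure (EuclideanSpace ℝ (Fin d))) [IsProbabilityMeasure P]
    (hP : Integrable (fun x => ‖x‖ ^ 4) P)
    (a ε σ δ : ℝ) (ha : 0 < a) (hε : 0 < ε) (hδ : 0 < δ)
    (hσ : 0 < σ) (hσs : σ ≤ RobustPCA.s4sq P)
    (hζ : 8 * RobustPCA.zeta n (RobustPCA.kurtosis P) (RobustPCA.s4sq P) a ε σ ≤ Real.sqrt n)
    (hκ : 3 / 2 ≤ RobustPCA.kurtosis P)
    (Θ : Finset (EuclideanSpace ℝ (Fin d))) (hΘ : RobustPCA.IsSphereNet δ Θ)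
    {Ω : Type*} [MeasurableSpace Ω] (μ : Measure Ω) [IsProbabilityMeasure μ]
    (X : Fin n → Ω → EuclideanSpace ℝ (Fin d)) (hX : ∀ i, Measurable (X i))
    (hlaw : ∀ i, μ.map (X i) = P) (hindep : iIndepFun X μ) :
    ∃ E : Set Ω, MeasurableSet E ∧ ENNReal.ofReal (1 - 2 * ε) ≤ μ E ∧
      ∀ ω ∈ E, ∀ (L : ℝ≥0) (f : ℝ → ℝ), 0 < L → LipschitzWith L⁻¹ f →
        ENNReal.ofReal (RobustPCA.opNorm
          (RobustPCA.spectralMap f (RobustPCA.gram P) -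
            RobustPCA.spectralMap f
              (RobustPCA.estGram (RobustPCA.kurtosis P) (RobustPCA.s4sq P) a ε σ Θ
                (fun i => X i ω)))) ≤
          ⨅ r ∈ Finset.Icc 1 d, (L : ℝ≥0∞)⁻¹ *
            (RobustPCA.Bdev P n a ε σ δ (RobustPCA.gramEigenvalue P 0) +
              (4 * (r : ℝ≥0∞) * RobustPCA.Bdev P n a ε σ δ (RobustPCA.gramEigenvalue P 0) ^ 2 +
                ENNReal.ofReal (2 * ∑ i ∈ Finset.univ.filter (fun i : Fin d => r ≤ (i : ℕ)),
                  RobustPCA.gramEigenvalue P i ^ 2)) ^ (1 / 2 : ℝ)) := by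
  rcases le_or_gt (1 / 2) ε with hε2 | hε2
  · -- the required probability is `0`
    refine ⟨∅, MeasurableSet.empty, ?_, fun ω hω => absurd hω (Set.notMem_empty ω)⟩
    rw [ENNReal.ofReal_of_nonpos (by linarith)]
    exact zero_le
  have hs : 0 < RobustPCA.s4sq P := hσ.trans_le hσs
  have hn : 0 < n := by
    -- for `n = 0` the hypothesis on `ζ(σ)` would force `ζ(σ) ≤ 0`
    rcases Nat.eq_zero_or_pos n with h0 | h0
    · have h1 := RobustPCA.sqrt_le_zeta (n := n) (κ := RobustPCA.kurtosis P)
        (s := RobustPCA.s4sq P) (a := a) (ε := ε) (t := σ)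
      have h2 : 0 < Real.sqrt (2 * (2 + RobustPCA.cConst) * Real.sqrt (RobustPCA.kurtosis P) *
          RobustPCA.s4sq P / σ) := by
        have := RobustPCA.forty_le_cConst
        have hk : 0 < Real.sqrt (RobustPCA.kurtosis P) := Real.sqrt_pos.2 (by linarith)
        exact Real.sqrt_pos.2 (by positivity)
      have h3 : Real.sqrt (n : ℝ) = 0 := by rw [h0]; simp
      linarith
    · exact h0
  have hL : 0 ≤ Real.log (RobustPCA.gridSize n (RobustPCA.kurtosis P) a / ε) := by
    refine Real.log_nonneg ((one_le_div hε).2 ?_)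
    have : (1 : ℝ) ≤ RobustPCA.gridSize n (RobustPCA.kurtosis P) a := by
      rw [RobustPCA.gridSize]; push_cast; linarith [Nat.cast_nonneg (α := ℝ)
        ⌈a⁻¹ * Real.log (n / (72 * (2 + RobustPCA.cConst) *
          Real.sqrt (RobustPCA.kurtosis P)))⌉₊]
    linarith
  obtain ⟨S, hSm, hSP, hS⟩ := RobustPCA.exists_isGoodSample hP hn hε hκ hs hL
  have hXm : Measurable fun ω i => X i ω := measurable_pi_lambda _ hX
  have hmap : μ.map (fun ω i => X i ω) = Measure.pi fun _ : Fin n => P := by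
    rw [(iIndepFun_iff_map_fun_eq_pi_map fun i => (hX i).aemeasurable).1 hindep]
    simp only [hlaw]
  refine ⟨(fun ω i => X i ω) ⁻¹' S, hXm hSm, ?_, ?_⟩
  · rw [← Measure.map_apply hXm hSm, hmap, ENNReal.ofReal_sub _ (by linarith), ENNReal.ofReal_one,
      tsub_le_iff_right, ← prob_add_prob_compl (μ := Measure.pi fun _ : Fin n => P) hSm]
    exact add_le_add le_rfl hSP
  · intro ω hω L f hL0 hf
    have hx := hS _ hω
    have hG := RobustPCA.gram_mem_feasible (Θ := Θ) hP hn hκ hs hσ hL hΘ.1 hx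
    have hdev := RobustPCA.norm_gram_sub_estGram_le hP hn ha hκ hs hσ hσs hδ hL hζ hΘ hx
    rw [RobustPCA.Bdev_gramEigenvalue_zero hP hn hκ hs hσ hδ hζ]
    set B := 2 * max (RobustPCA.gramEigenvalue P 0) σ * RobustPCA.relDev n (RobustPCA.kurtosis P)
      (RobustPCA.s4sq P) a ε (max (RobustPCA.gramEigenvalue P 0) σ) +
      (7 * δ * RobustPCA.frobNorm (RobustPCA.gram P) + σ)
    have hB0 : 0 ≤ B := by
      have := (norm_nonneg _).trans (hdev (EuclideanSpace.single 0 1))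
      simpa using this
    refine le_iInf₂ fun r hr => ?_
    rw [← RobustPCA.ofReal_mul_add_sqrt L hL0 hB0 (by positivity)]
    exact ENNReal.ofReal_le_ofReal (RobustPCA.opNorm_spectralMap_sub_le hP
      (RobustPCA.estQ_isHermitian hG) hB0 hdev hf (Finset.mem_Icc.1 hr).2)
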